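/- A closed polygonal chain $P=(v_0,\dots,v_{n-1})$ in $\mathbb R^3$ (indices mod $n$) is a simple polygon if $n\ge 3$, its edges $v_iv_{i+1}$ are nondegenerate, consecutive edges meet only in their common endpoint, and all other pairs of edges are disjoint. A motion of $P$ is a continuous family of chains that keeps all edge lengths fixed and keeps the chain simple at all times. **Theorem (St. Louis Arch Algorithm).** (a) Every simple polygon with $n$ vertices lying in a plane of $\mathbb R^3$ can be moved, by a motion in $\mathbb R^3$, to a planar convex polygon (straight joints allowed); moreover joints that are straight at the start can be kept straight throughout. (b) The following algorithm performs the convexification when $n\ge4$, $P$ is a simple polygon in the plane $z=0$, and $P$ has no straight vertices. Let $\delta>0$ be such that the disks of radius $\delta$ around the vertices contain no other vertices and meet only the two incident edges, and such that every polygon obtained by displacing the vertices within these disks is simple and has no straight vertices. Such a $\delta$ exists, and for each such $\delta$ the minimum separation $\sigma$ of two vertices and the minimum deviation $\beta$ of a joint angle from $\pi$, over all displaced polygons, are positive. There is a bound $\epsilon_0>0$, depending only on $\delta,\sigma,\beta$ (and not otherwise on $n$ or $P$), such that for all $0<\epsilon\le\epsilon_0$ the following steps can be carried out, each by a motion. Write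 $\Pi_\epsilon$ for the plane $z=\epsilon$. To *lift* a vertex means to rotate it upward about the line through the current positions of its two neighbours until it lies on $\Pi_\epsilon$; its projection to $z=0$ ends within $\delta$ of where it started. S0: lift $v_1$, then $v_0$, then $v_2$; then rotate $v_1$ by a right angle about the line $v_0v_2$ upward into the vertical plane through $v_0,v_2$. For $i=3,\dots,n-1$ in turn: S1: lift $v_i$. S2: rotate the arch $(v_0,\dots,v_{i-1})$ by a right angle about the line $v_0v_{i-1}$ into $\Pi_\epsilon$, away from $v_{i-1}v_i$. S3: within $\Pi_\epsilon$, with $v_0$, $v_i$ and the rest of the chain fixed, and with $(v_0,\dots,v_i)$ closed by the segment $v_iv_0$ being a simple polygon except possibly at the start, move $(v_0,\dots,v_i)$ so that it becomes a convex polygon strictly convex at $v_0$ and $v_i$. S4 (only if $i\le n-2$): rotate $(v_0,\dots,v_i)$ by a right angle about $v_0v_i$ upward into the vertical plane through $v_0,v_i$. After S0 (with $i=2$) and after each S4, $v_0$ and $v_i$ lie on $\Pi_\epsilon$ and project within $\delta$ of their original positions; $v_1,\dots,v_{i-1}$ lie above $\Pi_\epsilon$; the polygon $(v_0,\dots,v_i)$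 is convex and lies in the vertical plane through $v_0,v_i$; and $v_{i+1},\dots,v_{n-1}$ are in their original positions, below $\Pi_\epsilon$. After S3 for $i=n-1$ the whole chain is a convex polygon in $\Pi_\epsilon$. -/

import Mathlib

noncomputable section

namespace Arch

/-- Euclidean 3-space; the plane `Π_xy` is the set of points with last coordinate `0`. -/
abbrev E3 : Type := EuclideanSpace ℝ (Fin 3)

/-- A closed chain `(v_0, …, v_{n-1})` in space; index arithmetic in `Fin n` is modulo `n`. -/
abbrev Conf (n : ℕ) : Type := Fin n → E3

/-! ### Simple and convex polygons -/

/-- The closed edge `e_i = v_i v_{i+1}`. -/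
def edge {n : ℕ} [NeZero n] (p : Conf n) (i : Fin n) : Set E3 := segment ℝ (p i) (p (i + 1))

/-- Simple polygon: at least three vertices, nondegenerate edges, consecutive edges meet only in
their common endpoint, and all other pairs of edges are disjoint. -/
def IsSimplePolygon {n : ℕ} [NeZero n] (p : Conf n) : Prop :=
  3 ≤ n ∧
  (∀ i, p i ≠ p (i + 1)) ∧
  (∀ i, edge p i ∩ edge p (i + 1) = {p (i + 1)}) ∧
  (∀ i j, j ≠ i → j ≠ i + 1 → i ≠ j + 1 → Disjoint (edge p i) (edge p j))

/-- The smaller of the two (interior and exterior) angles at `v_j`, in `[0, π]`. -/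
def jointAngle {n : ℕ} [NeZero n] (p : Conf n) (j : Fin n) : ℝ :=
  EuclideanGeometry.angle (p (j - 1)) (p j) (p (j + 1))

/-- The joint at `v_j` is straight. -/
def IsStraight {n : ℕ} [NeZero n] (p : Conf n) (j : Fin n) : Prop :=
  jointAngle p j = Real.pi

/-- Planar convex polygon in space: a simple polygon lying in a plane, all of which is on one side
of the line through each of its edges (straight joints are allowed). The vector `u` is a normal of
the edge; the last clause says that it is not also normal to the plane of the polygon. -/
def IsConvexPolygon {n : ℕ} [NeZero n] (p : Conf n) : Prop :=
  IsSimplePolygon p ∧ Coplanar ℝ (Set.range p) ∧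
  ∀ i, ∃ u : E3, inner ℝ u (p (i + 1) - p i) = 0 ∧
    (∀ j, 0 ≤ inner ℝ u (p j - p i)) ∧ ∃ j, 0 < inner ℝ u (p j - p i)

/-! ### Motions -/

/-- `γ`, on the time interval `[0,1]`, is a continuous motion of the closed chain from `p` to `q`
that keeps all link lengths and keeps the chain simple at all times. -/
def IsMotion {n : ℕ} [NeZero n] (γ : ℝ → Conf n) (p q : Conf n) : Prop :=
  ContinuousOn γ (Set.Icc 0 1) ∧ γ 0 = p ∧ γ 1 = q ∧
  ∀ t ∈ Set.Icc (0 : ℝ) 1, IsSimplePolygon (γ t) ∧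
    ∀ j, dist (γ t j) (γ t (j + 1)) = dist (p j) (p (j + 1))

/-- The cross product of `E3`. -/
def cross (u v : E3) : E3 := WithLp.toLp 2 (crossProduct u.ofLp v.ofLp)

/-- Rotation of the point `x` by the angle `θ` about the line from `a` to `b` (for `a ≠ b`). -/
def rotateAbout (a b : E3) (θ : ℝ) (x : E3) : E3 :=
  let u : E3 := ‖b - a‖⁻¹ • (b - a)
  a + Real.cos θ • (x - a) + Real.sin θ • cross u (x - a)
    + ((1 - Real.cos θ) * inner ℝ u (x - a)) • u

open Classical in
/-- The path in which the vertices with index in `S` rotate monotonically about the line `ab`,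
by the total angle `θ`, while the other vertices stay fixed. -/
def rotationPath {n : ℕ} (S : Set (Fin n)) (a b : E3) (θ : ℝ) (p : Conf n) (t : ℝ) : Conf n :=
  fun j => if j ∈ S then rotateAbout a b (t * θ) (p j) else p j

/-- Height above `Π_xy`. -/
def height (x : E3) : ℝ := x 2

/-- Distance between the projections to `Π_xy`. -/
def hdist (x y : E3) : ℝ := Real.sqrt ((x 0 - y 0) ^ 2 + (x 1 - y 1) ^ 2)

/-- Twice the signed area of the triangle `abc`, projected to `Π_xy`. It is zero iff `c` lies in
the vertical plane through `a` and `b` (when these have distinct projections), and otherwise its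
sign tells on which side of that plane `c` lies. -/
def turn (a b c : E3) : ℝ := (b 0 - a 0) * (c 1 - a 1) - (b 1 - a 1) * (c 0 - a 0)

/-! ### The parameters -/

/-- The positions of the polygon with every vertex displaced, within `Π_xy`, by at most `δ`
(ignoring the link lengths). -/
def Displaced {n : ℕ} (p : Conf n) (δ : ℝ) : Set (Conf n) :=
  {q | ∀ j, height (q j) = 0 ∧ dist (q j) (p j) ≤ δ}

/-- The conditions on `δ`: disks of radius `δ` around the vertices contain no other vertex and meet
only the two incident edges, and a polygon with vertices displaced within these disks
remains simple and has no straight vertices. -/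
def DeltaOK {n : ℕ} [NeZero n] (p : Conf n) (δ : ℝ) : Prop :=
  0 < δ ∧
  (∀ j k, k ≠ j → δ < dist (p k) (p j)) ∧
  (∀ j k, k ≠ j → k + 1 ≠ j → ∀ x ∈ edge p k, δ < dist x (p j)) ∧
  ∀ q ∈ Displaced p δ, IsSimplePolygon q ∧ ∀ j, ¬ IsStraight q j

/-- `σ`: the minimum vertex separation over all displaced positions. -/
def sigma {n : ℕ} (p : Conf n) (δ : ℝ) : ℝ :=
  sInf {s | ∃ q ∈ Displaced p δ, ∃ j k, j ≠ k ∧ s = dist (q j) (q k)}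

/-- `β`: the minimum deviation from straightness over all joints and displaced positions. -/
def beta {n : ℕ} [NeZero n] (p : Conf n) (δ : ℝ) : ℝ :=
  sInf {s | ∃ q ∈ Displaced p δ, ∃ j, s = Real.pi - jointAngle q j}

/-! ### The St. Louis Arch Algorithm -/

/-- The arch polygon `(v_0, …, v_i)`, closed by its base `v_i v_0`. -/
def arch {n : ℕ} (i : Fin n) (p : Conf n) : Conf (i + 1) :=
  fun k => p ⟨k, by have := i.isLt; have := k.isLt; omega⟩

/-- The state of the chain `p` after step `i`, where `p₀` is the original polygon:
(H1) `v_0` and `v_i` are in `Π_ε`, the vertices between them are above it, the others below;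
(H2) the arch lies in the vertical plane through `v_0`, `v_i` and is convex;
(H3) `v_0` and `v_i` project within `δ` of their original positions;
(H5) `v_{i+1}, …, v_{n-1}` are in their original position (in `Π_xy`), so that
(H4) the edges `v_{n-1} v_0` and `v_i v_{i+1}` connect `Π_xy` and `Π_ε`. -/
def Hyp {n : ℕ} [NeZero n] (ε δ : ℝ) (p₀ : Conf n) (i : Fin n) (p : Conf n) : Prop :=
  (height (p 0) = ε ∧ height (p i) = ε ∧ (∀ j, 0 < j → j < i → ε < height (p j)) ∧
    ∀ j, i < j → height (p j) < ε) ∧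
  ((∀ j, j ≤ i → turn (p 0) (p i) (p j) = 0) ∧ IsConvexPolygon (arch i p)) ∧
  (hdist (p 0) (p₀ 0) ≤ δ ∧ hdist (p i) (p₀ i) ≤ δ) ∧
  (∀ j, i < j → p j = p₀ j)

/-- Lifting: `v_k`, lying in `Π_xy`, rotates upward about the line through its two neighbours
until it lies on `Π_ε`; it ends with its projection within `δ` of where it was. -/
def Lift {n : ℕ} [NeZero n] (ε δ : ℝ) (k : Fin n) (p q : Conf n) : Prop :=
  ∃ θ : ℝ, IsMotion (rotationPath {k} (p (k - 1)) (p (k + 1)) θ p) p q ∧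
    height (p k) = 0 ∧
    StrictMonoOn (fun t => height (rotationPath {k} (p (k - 1)) (p (k + 1)) θ p t k))
      (Set.Icc 0 1) ∧
    height (q k) = ε ∧ hdist (q k) (p k) ≤ δ

/-- Laying the arch `(v_0, …, v_{i-1})` down: it rotates by a right angle about its base
`v_0 v_{i-1}` into `Π_ε`, away from `v_{i-1} v_i`. -/
def LayDown {n : ℕ} [NeZero n] (ε : ℝ) (i : Fin n) (p q : Conf n) : Prop :=
  ∃ θ : ℝ, (θ = Real.pi / 2 ∨ θ = -(Real.pi / 2)) ∧
    IsMotion (rotationPath {j | 0 < j ∧ j < i - 1} (p 0) (p (i - 1)) θ p) p q ∧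
    ∀ j, 0 < j → j < i - 1 → height (q j) = ε ∧
      turn (p 0) (p (i - 1)) (q j) * turn (p 0) (p (i - 1)) (q i) ≤ 0

/-- Convexifying the arch `(v_0, …, v_i)` in `Π_ε`: a motion within `Π_ε` in which `v_0`, `v_i` and
the rest of the chain do not move, and which ends with a convex polygon having strictly convex
vertices `v_0` and `v_i`. The arch closed by its base may be only weakly simple at the
start, but it is simple from then on. -/
def ConvexifyArch {n : ℕ} [NeZero n] (ε : ℝ) (i : Fin n) (p q : Conf n) : Prop :=
  ∃ γ : ℝ → Conf n, IsMotion γ p q ∧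
    (∀ t ∈ Set.Icc (0 : ℝ) 1, (∀ j, j = 0 ∨ i ≤ j → γ t j = p j) ∧
      (∀ j, j ≤ i → height (γ t j) = ε) ∧ (0 < t → IsSimplePolygon (arch i (γ t)))) ∧
    IsConvexPolygon (arch i q) ∧
    ¬ IsStraight (arch i q) 0 ∧ ¬ IsStraight (arch i q) (Fin.last i)

/-- Raising the arch `(v_0, …, v_i)`: it rotates by a right angle about its base `v_0 v_i`; the
vertical final position and the upward direction are fixed by `Hyp` below. -/
def Raise {n : ℕ} [NeZero n] (i : Fin n) (p q : Conf n) : Prop :=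
  ∃ θ : ℝ, (θ = Real.pi / 2 ∨ θ = -(Real.pi / 2)) ∧
    IsMotion (rotationPath {j | 0 < j ∧ j < i} (p 0) (p i) θ p) p q

/-- Step S0: lift `v_1`, `v_0` and `v_2` (in this order), then raise the triangle `v_0 v_1 v_2`. -/
def Init {n : ℕ} [NeZero n] (ε δ : ℝ) (p q : Conf n) : Prop :=
  ∃ a b c : Conf n, Lift ε δ 1 p a ∧ Lift ε δ 0 a b ∧ Lift ε δ 2 b c ∧ Raise 2 c q

/-- Steps S1, S2 and S3 for the vertex `v_i`. -/
def Steps123 {n : ℕ} [NeZero n] (ε δ : ℝ) (i : Fin n) (p q : Conf n) : Prop :=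
  ∃ a b : Conf n, Lift ε δ i p a ∧ LayDown ε i a b ∧ ConvexifyArch ε i b q

/-- The St. Louis Arch Algorithm with parameters `ε`, `δ` runs correctly on `p₀` (with `n ≥ 4`
vertices), ending with `q`. Here `c i` is the configuration after step `i`. The vertex `v_{n-1}`
is treated last, without raising the arch again, and the result is a convex polygon in `Π_ε`. -/
def Run {n : ℕ} [NeZero n] (ε δ : ℝ) (p₀ q : Conf n) : Prop :=
  ∃ c : Fin n → Conf n,
    (Init ε δ p₀ (c 2) ∧ Hyp ε δ p₀ 2 (c 2)) ∧
    (∀ i : Fin n, 3 ≤ (i : ℕ) → (i : ℕ) + 2 ≤ n →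
      (∃ d : Conf n, Steps123 ε δ i (c (i - 1)) d ∧ Raise i d (c i)) ∧ Hyp ε δ p₀ i (c i)) ∧
    (∀ i : Fin n, (i : ℕ) + 1 = n → Steps123 ε δ i (c (i - 1)) q) ∧
    IsConvexPolygon q ∧ ∀ j, height (q j) = ε

end Arch

end

noncomputable section

namespace Arch

/-! ### Clockwise chains in the complex plane -/

/-! The core is planar: a convex chain with fixed edge lengths can be opened until it is straight,
through convex chains whose end distance (the base) exceeds the initial one (`WArc.openable`, a
motion form of Cauchy's arm lemma). The plane is ℂ, and `cw` measures clockwise orientation. If a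
base angle is at most a right angle, its end edge turns about its inner end until it is in line with
the next edge. The base grows and the angle stays non-obtuse. The joint that became straight is
frozen, and one argues by induction on the number of edges (`StrictArc.openable_of_acute`). If both
base angles are obtuse, the inner vertices stay at rest and the base descends parallel to itself
while its two ends move apart. This stops when a joint becomes straight (induction) or a base angle
becomes a right angle (the first case); see `ObtuseArc.openable`. Frozen joints are the reason for
the inductive form of `WArc`: a straight vertex divides its edge in a fixed ratio, so every motion
of the core carries it along. Simplicity and convexity are read off from the inequalities in
`WeakArc`.

To convexify `(v_0, …, v_i)` when `(v_0, …, v_{i-1})` is convex and `v_i` lies on the other side of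
its base, complete the moving arc by the triangle over its base whose other sides have the lengths
`|v_0 v_i|` and `|v_{i-1} v_i|`. As the arc opens, arc and triangle flatten; shortly before one of
them is flat the whole polygon is convex (`WArc.exists_fold`). A rotation and translation keep `v_0`
and `v_i` at rest. If `v_i` lies on the base, the triangle is already flat, and closing the arc a
little does the same.

In space, the part of the chain outside the arch has height at most `ε` and projects to edges of a
polygon displaced by at most `δ`, so it is simple by the choice of `δ` (`LowChain`). The arch lies
above `Π_ε`, or in `Π_ε` on the far side of its base, and therefore avoids that part
(`ArcOver.isSimplePolygon`). Lifts are short: non-straightness under all displacements bounds the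
altitudes of the triangle of three consecutive vertices from below by `δ / 2` (`DeltaOK.le_turn`),
so for `ε ≤ δ / 1000` the rotation angle is small and the projection moves by a few `ε` only
(`lift_estimates`, `exists_lift_angle`).

For the first assertion, straight vertices are removed one at a time and later carried along on
their edges (`convexifiable_succ`). A triangle is convex already; any other polygon is moved into `z
= 0` by an isometry and the algorithm is run there. -/

/-- Twice the area of the triangle `abc`, positive when it is traversed clockwise. -/
def cw (a b c : ℂ) : ℝ := (b - a).im * (c - a).re - (b - a).re * (c - a).im

theorem cw_rotate (a b c : ℂ) : cw b c a = cw a b c := by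
  simp only [cw, Complex.sub_re, Complex.sub_im]; ring

theorem cw_pos_rotate {a b c : ℂ} (h : 0 < cw a b c) : 0 < cw b c a := by rwa [cw_rotate]

theorem cw_pos_rotate' {a b c : ℂ} (h : 0 < cw a b c) : 0 < cw c a b := by rwa [← cw_rotate]

theorem cw_swap (a b c : ℂ) : cw b a c = -cw a b c := by
  simp only [cw, Complex.sub_re, Complex.sub_im]; ring

theorem cw_self_left (a b : ℂ) : cw a a b = 0 := by simp [cw]

theorem cw_self_right (a b : ℂ) : cw a b b = 0 := by
  simp only [cw]; ring

theorem cw_self_outer (a b : ℂ) : cw a b a = 0 := by simp [cw]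

/-- The three-term Plücker relation for the four vectors from `o`. It yields the transitivity rules
below, by which convexity of an extended chain follows from three of its new triples. -/
theorem cw_pluecker (o a b c d : ℂ) :
    cw o a c * cw o b d = cw o a b * cw o c d + cw o a d * cw o b c := by
  simp only [cw, Complex.sub_re, Complex.sub_im]; ring

theorem cw_lineMap_mid (o b c d : ℂ) (t : ℝ) :
    cw o (AffineMap.lineMap b c t) d = (1 - t) * cw o b d + t * cw o c d := by
  simp only [cw, AffineMap.lineMap_apply, vsub_eq_sub, vadd_eq_add, Complex.sub_re, Complex.sub_im,
    Complex.add_re, Complex.add_im, Complex.real_smul, Complex.re_ofReal_mul, Complex.im_ofReal_mul]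
  ring

theorem cw_lineMap_right (o b c d : ℂ) (t : ℝ) :
    cw o d (AffineMap.lineMap b c t) = (1 - t) * cw o d b + t * cw o d c := by
  simp only [cw, AffineMap.lineMap_apply, vsub_eq_sub, vadd_eq_add, Complex.sub_re, Complex.sub_im,
    Complex.add_re, Complex.add_im, Complex.real_smul, Complex.re_ofReal_mul, Complex.im_ofReal_mul]
  ring

theorem cw_lineMap_left (o b c d : ℂ) (t : ℝ) :
    cw (AffineMap.lineMap b c t) o d = (1 - t) * cw b o d + t * cw c o d := by
  rw [cw_swap, cw_lineMap_mid, cw_swap b, cw_swap c]; ring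

/-- If `a, b, c, d` are in clockwise order around `o`, with `a`, `c` within a half-plane, then `d`
comes clockwise after `b`. -/
theorem cw_pos_of_ac {o a b c d : ℂ} (hac : 0 < cw o a c) (hab : 0 < cw o a b)
    (hcd : 0 < cw o c d) (had : 0 ≤ cw o a d) (hbc : 0 ≤ cw o b c) : 0 < cw o b d := by
  have h := cw_pluecker o a b c d
  have : 0 < cw o a c * cw o b d := by rw [h]; positivity
  exact (pos_iff_pos_of_mul_pos this).1 hac

theorem cw_pos_of_bd {o a b c d : ℂ} (hbd : 0 < cw o b d) (hab : 0 < cw o a b)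
    (hcd : 0 < cw o c d) (had : 0 ≤ cw o a d) (hbc : 0 ≤ cw o b c) : 0 < cw o a c := by
  have h := cw_pluecker o a b c d
  have : 0 < cw o a c * cw o b d := by rw [h]; positivity
  exact (pos_iff_pos_of_mul_pos this).2 hbd

/-- All triples of vertices of the chain `p 0, …, p k` are strictly clockwise. -/
def StrictArc (k : ℕ) (p : ℕ → ℂ) : Prop :=
  ∀ a b c, a < b → b < c → c ≤ k → 0 < cw (p a) (p b) (p c)

theorem StrictArc.congr {k : ℕ} {p q : ℕ → ℂ} (h : StrictArc k p) (e : ∀ j ≤ k, q j = p j) :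
    StrictArc k q := by
  intro a b c hab hbc hc
  rw [e a (by omega), e b (by omega), e c hc]; exact h a b c hab hbc hc

theorem StrictArc.mono {k l : ℕ} {p : ℕ → ℂ} (h : StrictArc k p) (hl : l ≤ k) : StrictArc l p :=
  fun a b c hab hbc hc => h a b c hab hbc (hc.trans hl)

theorem StrictArc.shift {k : ℕ} {p : ℕ → ℂ} (h : StrictArc (k + 1) p) :
    StrictArc k (fun j => p (j + 1)) :=
  fun a b c hab hbc hc => h (a + 1) (b + 1) (c + 1) (by omega) (by omega) (by omega)

/-- Adding a last vertex to a strictly convex arc. -/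
theorem StrictArc.snoc {k : ℕ} {p : ℕ → ℂ} (hk : 1 ≤ k) (h : StrictArc k p)
    (h0 : 0 < cw (p 0) (p k) (p (k + 1))) (h1 : 0 < cw (p 0) (p 1) (p (k + 1)))
    (h2 : 0 < cw (p (k - 1)) (p k) (p (k + 1))) : StrictArc (k + 1) p := by
  -- Seen from `p 0`, the vertices `p 1, …, p k` and the new one are in clockwise order, so the
  -- triple for `b` follows from the extreme cases `b = 1` and `b = k`.
  have s1 : ∀ b, 0 < b → b ≤ k → 0 < cw (p 0) (p b) (p (k + 1)) := by
    intro b hb hbk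
    rcases Nat.lt_or_ge 1 b with hb1 | hb1
    · rcases hbk.lt_or_eq with hb2 | rfl
      · exact cw_pos_of_ac (h 0 1 k (by omega) (by omega) le_rfl)
          (h 0 1 b (by omega) hb1 hbk) h0 h1.le (h 0 b k (by omega) hb2 le_rfl).le
      · exact h0
    · obtain rfl : b = 1 := by omega
      exact h1
  -- The same around `p k`, between the extreme cases `a = 0` and `a = k - 1`.
  have s2 : ∀ a, a < k → 0 < cw (p a) (p k) (p (k + 1)) := by
    intro a ha
    rcases Nat.eq_zero_or_pos a with rfl | ha0
    · exact h0
    · rcases (show a ≤ k - 1 by omega).lt_or_eq with ha1 | ha1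
      · have e1 := h 0 a k ha0 ha le_rfl
        have e2 := h 0 (k - 1) k (by omega) (by omega) le_rfl
        have e3 := h a (k - 1) k (by omega) (by omega) le_rfl
        exact cw_pos_rotate' <| cw_pos_of_bd (cw_pos_rotate' e2) (cw_pos_rotate h0)
          (cw_pos_rotate' e3) (cw_pos_rotate h2).le (cw_pos_rotate' e1).le
      · rw [ha1]; exact h2
  intro a b c hab hbc hc
  rcases hc.lt_or_eq with hc | rfl
  · exact h a b c hab hbc (by omega)
  · rcases Nat.eq_zero_or_pos a with rfl | ha0
    · exact s1 b hab (by omega)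
    · rcases (show b ≤ k by omega).lt_or_eq with hbk | rfl
      · have e1 := h 0 a b ha0 hab hbk.le
        have e2 := h 0 a k ha0 (by omega) le_rfl
        have e3 := s1 a ha0 (by omega)
        exact cw_pos_of_bd (cw_pos_rotate e2) (h a b k hab hbk le_rfl) (cw_pos_rotate e3)
          (cw_pos_rotate e1).le (s2 a (by omega)).le
      · exact s2 a hab

/-- Adding a first vertex to a strictly convex arc. -/
theorem StrictArc.front {k : ℕ} {p : ℕ → ℂ} (hk : 1 ≤ k) (h : StrictArc k fun j => p (j + 1))
    (h0 : 0 < cw (p 0) (p 1) (p (k + 1))) (h1 : 0 < cw (p 0) (p 1) (p 2))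
    (h2 : 0 < cw (p 0) (p k) (p (k + 1))) : StrictArc (k + 1) p := by
  have h' : ∀ a b c, 0 < a → a < b → b < c → c ≤ k + 1 → 0 < cw (p a) (p b) (p c) := by
    intro a b c ha hab hbc hc
    have := h (a - 1) (b - 1) (c - 1) (by omega) (by omega) (by omega)
    simpa only [show a - 1 + 1 = a by omega, show b - 1 + 1 = b by omega,
      show c - 1 + 1 = c by omega] using this
  have s1 : ∀ c, 1 < c → c ≤ k + 1 → 0 < cw (p 0) (p 1) (p c) := by
    intro c hc hck
    rcases Nat.lt_or_ge 2 c with hc1 | hc1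
    · rcases hck.lt_or_eq with hc2 | rfl
      · exact cw_pos_rotate' <| cw_pos_of_ac (h' 1 2 (k + 1) (by omega) (by omega) (by omega) le_rfl)
          (h' 1 2 c (by omega) (by omega) (by omega) hck) (cw_pos_rotate h0)
          (cw_pos_rotate h1).le (h' 1 c (k + 1) (by omega) (by omega) hc2 le_rfl).le
      · exact h0
    · obtain rfl : c = 2 := by omega
      exact h1
  have s2 : ∀ b, 0 < b → b ≤ k → 0 < cw (p 0) (p b) (p (k + 1)) := by
    intro b hb hbk
    rcases hbk.lt_or_eq with hb1 | rfl
    · rcases (show 1 ≤ b by omega).lt_or_eq with hb2 | rfl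
      · have e1 := h' 1 k (k + 1) (by omega) (by omega) (by omega) le_rfl
        have e2 := h' b k (k + 1) (by omega) (by omega) (by omega) le_rfl
        have e3 := h' 1 b (k + 1) (by omega) (by omega) (by omega) le_rfl
        exact cw_pos_rotate <| cw_pos_of_bd (cw_pos_rotate' e1) (cw_pos_rotate' h0)
          (cw_pos_rotate' e2) (cw_pos_rotate' h2).le (cw_pos_rotate' e3).le
      · exact h0
    · exact h2
  intro a b c hab hbc hc
  rcases Nat.eq_zero_or_pos a with rfl | ha0
  · rcases hc.lt_or_eq with hc1 | rfl
    · rcases (show 1 ≤ b by omega).lt_or_eq with hb2 | rfl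
      · have e1 := h' 1 b (k + 1) (by omega) (by omega) (by omega) le_rfl
        have e2 := h' b c (k + 1) (by omega) (by omega) (by omega) le_rfl
        have e3 := h' 1 b c (by omega) (by omega) (by omega) (by omega)
        exact cw_pos_rotate' <| cw_pos_of_bd (cw_pos_rotate e1) e2 (cw_pos_rotate' (s1 b hb2 (by omega)))
          (cw_pos_rotate e3).le (cw_pos_rotate (s2 b (by omega) (by omega))).le
      · exact s1 c hbc hc
    · exact s2 b hab (by omega)
  · exact h' a b c ha0 hab hbc hc

/-- The mirror image of a chain, traversed backwards. -/
def mirror (k : ℕ) (p : ℕ → ℂ) : ℕ → ℂ := fun j => -(starRingEnd ℂ) (p (k - j))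

/-- A reflection and a reversal of the order each change the orientation; together they preserve it.
Statements about the first base angle thereby transfer to the last. -/
theorem cw_mirror (a b c : ℂ) :
    cw (-(starRingEnd ℂ) a) (-(starRingEnd ℂ) b) (-(starRingEnd ℂ) c) = cw c b a := by
  simp only [cw, Complex.sub_re, Complex.sub_im, Complex.neg_re, Complex.neg_im, Complex.conj_re,
    Complex.conj_im]
  ring

theorem mirror_mirror {k : ℕ} (p : ℕ → ℂ) {j : ℕ} (hj : j ≤ k) :
    mirror k (mirror k p) j = p j := by
  simp [mirror, show k - (k - j) = j by omega]

theorem StrictArc.mirror {k : ℕ} {p : ℕ → ℂ} (h : StrictArc k p) : StrictArc k (mirror k p) := by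
  intro a b c hab hbc hc
  simp only [Arch.mirror, cw_mirror]
  exact h _ _ _ (by omega) (by omega) (by omega)

/-! ### Straight vertices -/

/-- The chain `p` with a vertex inserted, at position `j`, into the edge from `j - 1` to `j`. -/
def insertAt (j : ℕ) (r : ℝ) (p : ℕ → ℂ) : ℕ → ℂ := fun l =>
  if l < j then p l else if l = j then AffineMap.lineMap (p (j - 1)) (p j) r else p (l - 1)

theorem insertAt_lt {j l : ℕ} (r : ℝ) (p : ℕ → ℂ) (h : l < j) : insertAt j r p l = p l := by
  simp [insertAt, h]

theorem insertAt_self (j : ℕ) (r : ℝ) (p : ℕ → ℂ) :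
    insertAt j r p j = AffineMap.lineMap (p (j - 1)) (p j) r := by
  simp [insertAt]

theorem insertAt_gt {j l : ℕ} (r : ℝ) (p : ℕ → ℂ) (h : j < l) : insertAt j r p l = p (l - 1) := by
  simp [insertAt, h.not_gt, h.ne']

/-- Convex arcs: strictly convex arcs, with straight vertices inserted. -/
inductive WArc : ℕ → (ℕ → ℂ) → Prop
  | core {k : ℕ} {p : ℕ → ℂ} : 2 ≤ k → StrictArc k p → WArc k p
  | ins {k : ℕ} {p q : ℕ → ℂ} (j : ℕ) (r : ℝ) : WArc k p → 1 ≤ j → j ≤ k → 0 < r → r < 1 →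
      (∀ l ≤ k + 1, q l = insertAt j r p l) → WArc (k + 1) q

theorem WArc.congr {k : ℕ} {p q : ℕ → ℂ} (h : WArc k p) (e : ∀ j ≤ k, q j = p j) : WArc k q := by
  cases h with
  | core hk h => exact .core hk (h.congr e)
  | ins j r h h1 h2 h3 h4 h5 => exact .ins j r h h1 h2 h3 h4 fun l hl => (e l hl).trans (h5 l hl)

theorem WArc.two_le {k : ℕ} {p : ℕ → ℂ} (h : WArc k p) : 2 ≤ k := by
  induction h with
  | core hk => exact hk
  | ins => omega

/-- Convexity by inequalities: all triples are weakly clockwise, and the vertices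
strictly between the ends are strictly above the base. -/
structure WeakArc (k : ℕ) (p : ℕ → ℂ) : Prop where
  tri : ∀ a b c, a ≤ b → b ≤ c → c ≤ k → 0 ≤ cw (p a) (p b) (p c)
  base : ∀ j, 0 < j → j < k → 0 < cw (p 0) (p j) (p k)
  ne : ∀ j < k, p j ≠ p (j + 1)

theorem StrictArc.weakArc {k : ℕ} {p : ℕ → ℂ} (hk : 2 ≤ k) (h : StrictArc k p) : WeakArc k p where
  tri a b c hab hbc hc := by
    rcases hab.lt_or_eq with hab | rfl
    · rcases hbc.lt_or_eq with hbc | rfl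
      · exact (h a b c hab hbc hc).le
      · rw [cw_self_right]
    · rw [cw_self_left]
  base j h0 hj := h 0 j k h0 hj le_rfl
  ne j hj e := by
    rcases Nat.eq_zero_or_pos j with rfl | h0
    · have := h 0 1 2 (by omega) (by omega) hk
      simp only [zero_add] at e
      rw [← e, cw_self_left] at this; exact this.false
    · have := h 0 j (j + 1) (by omega) (by omega) hj
      rw [← e, cw_self_right] at this; exact this.false

/-- `cw` is affine in each argument, so an inequality at the inserted point is a convex combination
of the inequalities at the two ends of its edge. -/
theorem WeakArc.insertAt {k : ℕ} {p : ℕ → ℂ} (h : WeakArc k p) {j : ℕ} {r : ℝ} (hj : 1 ≤ j)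
    (hjk : j ≤ k) (hr : 0 < r) (hr1 : r < 1) (hk : 2 ≤ k) : WeakArc (k + 1) (insertAt j r p) := by
  have hs : ∀ l, l ≠ j → Arch.insertAt j r p l = p (if l < j then l else l - 1) := by
    intro l hl
    rcases lt_or_gt_of_ne hl with h' | h'
    · rw [insertAt_lt _ _ h', if_pos h']
    · rw [insertAt_gt _ _ h', if_neg (by omega)]
  have h1 : 0 ≤ 1 - r := by linarith
  refine ⟨fun a b c hab hbc hc => ?_, fun l h0 hl => ?_, fun l hl => ?_⟩
  · rcases hab.lt_or_eq with hab | rfl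
    swap
    · rw [cw_self_left]
    rcases hbc.lt_or_eq with hbc | rfl
    swap
    · rw [cw_self_right]
    by_cases ha : a = j
    · subst ha
      rw [insertAt_self, hs b (by omega), hs c (by omega), cw_lineMap_left, if_neg (by omega),
        if_neg (by omega)]
      exact add_nonneg (mul_nonneg h1 (h.tri _ _ _ (by omega) (by omega) (by omega)))
        (mul_nonneg hr.le (h.tri _ _ _ (by omega) (by omega) (by omega)))
    by_cases hb : b = j
    · subst hb
      rw [insertAt_self, hs a ha, hs c (by omega), cw_lineMap_mid, if_pos (by omega),
        if_neg (by omega)]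
      exact add_nonneg (mul_nonneg h1 (h.tri _ _ _ (by omega) (by omega) (by omega)))
        (mul_nonneg hr.le (h.tri _ _ _ (by omega) (by omega) (by omega)))
    by_cases hc' : c = j
    · subst hc'
      rw [insertAt_self, hs a ha, hs b hb, cw_lineMap_right, if_pos (by omega), if_pos (by omega)]
      exact add_nonneg (mul_nonneg h1 (h.tri _ _ _ (by omega) (by omega) (by omega)))
        (mul_nonneg hr.le (h.tri _ _ _ (by omega) (by omega) (by omega)))
    rw [hs a ha, hs b hb, hs c hc']
    exact h.tri _ _ _ (by split_ifs <;> omega) (by split_ifs <;> omega) (by split_ifs <;> omega)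
  · rw [insertAt_lt (l := 0) _ _ (by omega), insertAt_gt (l := k + 1) _ _ (by omega),
      Nat.add_sub_cancel]
    have hn : ∀ m ≤ k, 0 ≤ cw (p 0) (p m) (p k) := fun m hm => h.tri 0 m k (by omega) hm le_rfl
    by_cases hlj : l = j
    · subst hlj
      rw [insertAt_self, cw_lineMap_mid]
      -- Since `2 ≤ k`, an end of the divided edge is an inner vertex; it supplies the strict
      -- inequality.
      rcases hjk.lt_or_eq with hlt | rfl
      · have := h.base l h0 hlt
        have := hn (l - 1) (by omega)
        nlinarith
      · have := h.base (l - 1) (by omega) (by omega)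
        have := hn l le_rfl
        nlinarith
    · rw [hs l hlj]
      exact h.base _ (by split_ifs <;> omega) (by split_ifs <;> omega)
  · by_cases hlj : l = j
    · subst hlj
      rw [insertAt_self, insertAt_gt _ _ (by omega), Nat.add_sub_cancel]
      intro e
      have hne := h.ne (l - 1) (by omega)
      rw [Nat.sub_add_cancel hj] at hne
      exact hr1.ne ((AffineMap.lineMap_eq_right_iff.1 e).resolve_left hne)
    · by_cases hlj' : l + 1 = j
      · subst hlj'
        rw [insertAt_self, insertAt_lt _ _ (by omega), Nat.add_sub_cancel]
        intro e
        exact hr.ne' ((AffineMap.lineMap_eq_left_iff.1 e.symm).resolve_left (h.ne l (by omega)))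
      · rw [hs l hlj, hs (l + 1) hlj']
        have : (if l + 1 < j then l + 1 else l + 1 - 1) = (if l < j then l else l - 1) + 1 := by
          split_ifs <;> omega
        rw [this]
        exact h.ne _ (by split_ifs <;> omega)

theorem WeakArc.congr {k : ℕ} {p q : ℕ → ℂ} (h : WeakArc k p) (e : ∀ j ≤ k, q j = p j) :
    WeakArc k q where
  tri a b c hab hbc hc := by
    rw [e a (by omega), e b (by omega), e c hc]; exact h.tri a b c hab hbc hc
  base j h0 hj := by rw [e 0 (by omega), e j (by omega), e k le_rfl]; exact h.base j h0 hj
  ne j hj := by rw [e j (by omega), e (j + 1) (by omega)]; exact h.ne j hj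

/-- Motions act on the inductive form, where an inserted vertex rides on its edge; simplicity and
convexity need only these inequalities. -/
theorem WArc.weakArc {k : ℕ} {p : ℕ → ℂ} (h : WArc k p) : WeakArc k p := by
  induction h with
  | core hk h => exact h.weakArc hk
  | ins j r h h1 h2 h3 h4 h5 ih => exact (ih.insertAt h1 h2 h3 h4 h.two_le).congr h5

/-! ### Rigid motions and reflections of convex arcs -/

/-- Chains related by an orientation preserving isometry of the plane. -/
theorem cw_rigid (u w a b c : ℂ) (hu : ‖u‖ = 1) :
    cw (u * a + w) (u * b + w) (u * c + w) = cw a b c := by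
  have : u.re * u.re + u.im * u.im = 1 := by
    rw [← Complex.normSq_apply, Complex.normSq_eq_norm_sq, hu]; norm_num
  have e : cw (u * a + w) (u * b + w) (u * c + w) = (u.re * u.re + u.im * u.im) * cw a b c := by
    simp only [cw, Complex.sub_re, Complex.sub_im, Complex.add_re, Complex.add_im, Complex.mul_re,
      Complex.mul_im]
    ring
  rw [e, this, one_mul]

theorem StrictArc.rigid {k : ℕ} {p : ℕ → ℂ} (h : StrictArc k p) {u : ℂ} (w : ℂ) (hu : ‖u‖ = 1) :
    StrictArc k (fun j => u * p j + w) := by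
  intro a b c hab hbc hc
  rw [cw_rigid _ _ _ _ _ hu]; exact h a b c hab hbc hc

theorem lineMap_rigid (u w a b : ℂ) (r : ℝ) :
    u * AffineMap.lineMap a b r + w = AffineMap.lineMap (u * a + w) (u * b + w) r := by
  simp only [AffineMap.lineMap_apply, vsub_eq_sub, vadd_eq_add, Complex.real_smul]; ring

theorem WArc.rigid {k : ℕ} {p : ℕ → ℂ} (h : WArc k p) {u : ℂ} (w : ℂ) (hu : ‖u‖ = 1) :
    WArc k (fun j => u * p j + w) := by
  induction h with
  | core hk h => exact .core hk (h.rigid w hu)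
  | ins j r h h1 h2 h3 h4 h5 ih =>
    refine .ins j r ih h1 h2 h3 h4 fun l hl => ?_
    simp only [h5 l hl, Arch.insertAt]
    split_ifs
    · rfl
    · rw [lineMap_rigid]
    · rfl

theorem lineMap_mirror (a b : ℂ) (r : ℝ) :
    -(starRingEnd ℂ) (AffineMap.lineMap a b r) =
      AffineMap.lineMap (-(starRingEnd ℂ) b) (-(starRingEnd ℂ) a) (1 - r) := by
  simp only [AffineMap.lineMap_apply, vsub_eq_sub, vadd_eq_add, Complex.real_smul, map_add, map_mul,
    map_sub, Complex.conj_ofReal]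
  push_cast
  ring

/-- Reversal turns position `j` into `k + 1 - j`, and the edge, traversed backwards, is divided at
`1 - r`. -/
theorem mirror_insertAt {k j : ℕ} (p : ℕ → ℂ) (r : ℝ) (hj : 1 ≤ j) (hjk : j ≤ k) {l : ℕ}
    (hl : l ≤ k + 1) :
    mirror (k + 1) (insertAt j r p) l = insertAt (k + 1 - j) (1 - r) (mirror k p) l := by
  rcases lt_trichotomy l (k + 1 - j) with h | h | h
  · rw [insertAt_lt _ _ h, mirror, mirror, insertAt_gt _ _ (by omega)]
    congr 3; omega
  · subst h
    rw [insertAt_self, mirror, mirror, mirror, show k + 1 - (k + 1 - j) = j by omega, insertAt_self,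
      lineMap_mirror, show k - (k + 1 - j - 1) = j by omega, show k - (k + 1 - j) = j - 1 by omega]
  · rw [insertAt_gt _ _ h, mirror, mirror, insertAt_lt _ _ (by omega)]
    congr 3; omega

theorem WArc.mirror {k : ℕ} {p : ℕ → ℂ} (h : WArc k p) : WArc k (mirror k p) := by
  induction h with
  | core hk h => exact .core hk h.mirror
  | @ins k p q j r h h1 h2 h3 h4 h5 ih =>
    refine .ins (k + 1 - j) (1 - r) ih (by omega) (by omega) (by linarith) (by linarith)
      fun l hl => ?_
    rw [← mirror_insertAt p r h1 h2 hl, Arch.mirror, Arch.mirror, h5 _ (by omega)]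

/-! ### Adding a vertex below the base -/

/-- The ends of a chain keep their directions when straight vertices are inserted. -/
theorem WArc.exists_snoc {k : ℕ} {p : ℕ → ℂ} (h : WArc k p)
    (h0 : 0 < cw (p 0) (p k) (p (k + 1))) (h1 : 0 < cw (p 0) (p 1) (p (k + 1)))
    (h2 : 0 < cw (p (k - 1)) (p k) (p (k + 1))) : WArc (k + 1) p := by
  generalize hx : p (k + 1) = x at *
  suffices ∀ q : ℕ → ℂ, (∀ j ≤ k, q j = p j) → q (k + 1) = x → WArc (k + 1) q from
    this p (fun _ _ => rfl) hx
  clear hx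
  induction h with
  | @core k p hk h =>
    intro q hq hx
    refine .core (by omega) (StrictArc.snoc (by omega) (h.congr hq) ?_ ?_ ?_)
    · rw [hx, hq 0 (by omega), hq k le_rfl]; exact h0
    · rw [hx, hq 0 (by omega), hq 1 (by omega)]; exact h1
    · rw [hx, hq (k - 1) (by omega), hq k le_rfl]; exact h2
  | @ins k p p' j r h hj hjk hr hr1 he ih =>
    intro q hq hx
    have hk := h.two_le
    have e0 : p' 0 = p 0 := by rw [he 0 (by omega), insertAt_lt _ _ (by omega)]
    have ek : p' (k + 1) = p k := by rw [he _ le_rfl, insertAt_gt _ _ (by omega), Nat.add_sub_cancel]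
    rw [e0, ek] at h0
    rw [e0] at h1
    rw [ek, Nat.add_sub_cancel] at h2
    -- A vertex inserted into the first edge shortens the initial vector without changing its
    -- direction, so the sign is that of the chain without it.
    have h1' : 0 < cw (p 0) (p 1) x := by
      rcases hj.lt_or_eq with hj | rfl
      · rwa [he 1 (by omega), insertAt_lt _ _ hj] at h1
      · rw [he 1 (by omega), insertAt_self, cw_lineMap_mid, cw_self_left, mul_zero, zero_add] at h1
        exact (pos_iff_pos_of_mul_pos h1).1 hr
    have h2' : 0 < cw (p (k - 1)) (p k) x := by
      rcases hjk.lt_or_eq with hj | rfl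
      · rwa [he k (by omega), insertAt_gt _ _ hj] at h2
      · rw [he j (by omega), insertAt_self, cw_lineMap_left, cw_self_left, mul_zero, add_zero] at h2
        exact (pos_iff_pos_of_mul_pos h2).1 (by linarith)
    have := ih h0 h1' h2' (fun l => if l ≤ k then p l else x) (fun l hl => by simp [hl]) (by simp)
    refine .ins j r this hj (by omega) hr hr1 fun l hl => ?_
    rcases hl.lt_or_eq with hl | rfl
    · rw [hq l (by omega), he l (by omega)]
      simp only [insertAt]
      rw [if_pos (show j - 1 ≤ k by omega), if_pos hjk]
      split_ifs <;> first | rfl | omega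
    · rw [hx, insertAt_gt _ _ (by omega)]; simp

end Arch
end

noncomputable section

namespace Arch

open Set

/-! ### Simplicity of arcs -/

/-- `x` lies on the lines `ab` and `bc`, which meet only in `b`. -/
theorem eq_of_cw_eq_zero {a b c x : ℂ} (h : 0 < cw a b c) (h1 : cw a b x = 0) (h2 : cw b x c = 0) :
    x = b := by
  simp only [cw, Complex.sub_re, Complex.sub_im] at h h1 h2
  apply Complex.ext
  · apply mul_left_cancel₀ h.ne'
    linear_combination (c.re - b.re) * h1 + (b.re - a.re) * h2
  · apply mul_left_cancel₀ h.ne'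
    linear_combination (c.im - b.im) * h1 + (b.im - a.im) * h2

/-- The lines from `p 0` and from `p k` through `p (i + 1)` weakly separate the two edges: the
earlier edge is on one side of both lines, the later edge on the other. The lines are distinct, so a
common point is `p (i + 1)`, which the half-open edge `i` omits. -/
theorem WeakArc.disjoint_edges {k : ℕ} {p : ℕ → ℂ} (h : WeakArc k p) {i j : ℕ} (hij : i < j)
    (hj : j < k) {s t : ℝ} (hs : s ∈ Ico (0 : ℝ) 1) (ht : t ∈ Ico (0 : ℝ) 1) :
    AffineMap.lineMap (p i) (p (i + 1)) s ≠ AffineMap.lineMap (p j) (p (j + 1)) t := by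
  intro e
  obtain ⟨hs0, hs1⟩ := hs
  obtain ⟨ht0, ht1⟩ := ht
  have hb := h.base (i + 1) (by omega) (by omega)
  set x := AffineMap.lineMap (p i) (p (i + 1)) s with hx
  have a1 : cw (p 0) (p (i + 1)) x = -((1 - s) * cw (p 0) (p i) (p (i + 1))) := by
    rw [hx, cw_lineMap_right, cw_self_right, ← cw_rotate, cw_swap, cw_rotate]; ring
  have a2 : cw (p 0) (p (i + 1)) x =
      (1 - t) * cw (p 0) (p (i + 1)) (p j) + t * cw (p 0) (p (i + 1)) (p (j + 1)) := by
    rw [e, cw_lineMap_right]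
  have a3 : cw (p (i + 1)) x (p k) = -((1 - s) * cw (p i) (p (i + 1)) (p k)) := by
    rw [hx, cw_lineMap_mid, cw_self_left, cw_swap]; ring
  have a4 : cw (p (i + 1)) x (p k) =
      (1 - t) * cw (p (i + 1)) (p j) (p k) + t * cw (p (i + 1)) (p (j + 1)) (p k) := by
    rw [e, cw_lineMap_mid]
  have b1 := h.tri 0 i (i + 1) (by omega) (by omega) (by omega)
  have b2 := h.tri 0 (i + 1) j (by omega) (by omega) (by omega)
  have b3 := h.tri 0 (i + 1) (j + 1) (by omega) (by omega) (by omega)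
  have b4 := h.tri i (i + 1) k (by omega) (by omega) (by omega)
  have b5 := h.tri (i + 1) j k (by omega) (by omega) (by omega)
  have b6 := h.tri (i + 1) (j + 1) k (by omega) (by omega) (by omega)
  have c1 : cw (p 0) (p (i + 1)) x = 0 := by
    apply le_antisymm
    · rw [a1]; nlinarith
    · rw [a2]; exact add_nonneg (mul_nonneg (by linarith) b2) (mul_nonneg ht0 b3)
  have c2 : cw (p (i + 1)) x (p k) = 0 := by
    apply le_antisymm
    · rw [a3]; nlinarith
    · rw [a4]; exact add_nonneg (mul_nonneg (by linarith) b5) (mul_nonneg ht0 b6)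
  have := eq_of_cw_eq_zero hb c1 c2
  exact hs1.ne ((AffineMap.lineMap_eq_right_iff.1 this).resolve_left (h.ne i (by omega)))

theorem WeakArc.ends_ne {k : ℕ} {p : ℕ → ℂ} (h : WeakArc k p) (hk : 2 ≤ k) : p k ≠ p 0 := by
  intro e
  have := h.base 1 (by omega) (by omega)
  rw [e, cw_self_outer] at this
  exact this.false

/-- The signed height over the base is affine along an edge and positive at inner vertices;
half-open edges omit `p k`, so it vanishes only at `p 0`. -/
theorem WeakArc.above_or {k : ℕ} {p : ℕ → ℂ} (h : WeakArc k p) (hk : 2 ≤ k) {i : ℕ} (hi : i < k)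
    {s : ℝ} (hs : s ∈ Ico (0 : ℝ) 1) :
    0 < cw (p 0) (AffineMap.lineMap (p i) (p (i + 1)) s) (p k) ∨ (i = 0 ∧ s = 0) := by
  obtain ⟨hs0, hs1⟩ := hs
  rw [cw_lineMap_mid]
  have b := h.tri 0 (i + 1) k (by omega) (by omega) (by omega)
  rcases Nat.eq_zero_or_pos i with rfl | h0
  · rcases hs0.lt_or_eq with hs | hs
    · left
      have := h.base 1 (by omega) (by omega)
      rw [cw_self_left, mul_zero, zero_add, zero_add]
      exact mul_pos hs this
    · exact .inr ⟨rfl, hs.symm⟩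
  · left
    have := h.base i h0 hi
    exact add_pos_of_pos_of_nonneg (mul_pos (by linarith) this) (mul_nonneg hs0 b)

/-- The closed polygon `p 0, …, p N` in the plane has pairwise disjoint half-open edges. -/
def PlanarSimple (N : ℕ) (p : ℕ → ℂ) : Prop :=
  (∀ j ≤ N, p j ≠ p (if j = N then 0 else j + 1)) ∧
  ∀ i j, i < j → j ≤ N → ∀ s ∈ Ico (0 : ℝ) 1, ∀ t ∈ Ico (0 : ℝ) 1,
    AffineMap.lineMap (p i) (p (i + 1)) s ≠
      AffineMap.lineMap (p j) (p (if j = N then 0 else j + 1)) t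

theorem WeakArc.planarSimple {k : ℕ} {p : ℕ → ℂ} (h : WeakArc k p) (hk : 2 ≤ k) :
    PlanarSimple k p := by
  refine ⟨fun j hj => ?_, fun i j hij hj s hs t ht => ?_⟩
  · split_ifs with e
    · rw [e]; exact h.ends_ne hk
    · exact h.ne j (by omega)
  · split_ifs with e
    · subst e
      intro e
      rcases h.above_or hk hij hs with h' | ⟨rfl, rfl⟩
      · rw [e, cw_lineMap_mid, cw_self_right, cw_self_left] at h'
        simp at h'
      · rw [AffineMap.lineMap_apply_zero] at e
        exact ht.2.ne ((AffineMap.lineMap_eq_right_iff.1 e.symm).resolve_left (h.ends_ne hk))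
    · exact h.disjoint_edges hij (by omega) hs ht

/-- An arc, closed by two edges to a vertex below the base, is simple. -/
theorem WeakArc.planarSimple_succ {k : ℕ} {p : ℕ → ℂ} (h : WeakArc k p) (hk : 2 ≤ k)
    (hx : 0 < cw (p 0) (p k) (p (k + 1))) : PlanarSimple (k + 1) p := by
  have hx' : cw (p 0) (p (k + 1)) (p k) < 0 := by
    rw [← cw_rotate, cw_swap, cw_rotate]; linarith
  have hxk : p k ≠ p (k + 1) := fun e => by rw [e, cw_self_right] at hx; exact hx.false
  have hx0 : p (k + 1) ≠ p 0 := fun e => by rw [e, cw_self_outer] at hx; exact hx.false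
  refine ⟨fun j hj => ?_, fun i j hij hj s hs t ht e => ?_⟩
  · split_ifs with e
    · rw [e]; exact hx0
    · rcases (show j ≤ k by omega).lt_or_eq with hj | rfl
      · exact h.ne j hj
      · exact hxk
  · obtain ⟨ht0, ht1⟩ := ht
    rcases (show j ≤ k + 1 by omega).lt_or_eq with hj1 | rfl
    · rw [if_neg hj1.ne] at e
      rcases (show j ≤ k by omega).lt_or_eq with hj2 | rfl
      · exact h.disjoint_edges hij hj2 hs ⟨ht0, ht1⟩ e
      -- Signed height over the base, `p j` being the end of the arc: it is nonnegative on the arc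
      -- and nonpositive on the edge to the new vertex, so a common point could only be `p 0`.
      · have e1 := congrArg (fun y => cw (p 0) y (p j)) e
        simp only [cw_lineMap_mid _ (p j), cw_self_right, mul_zero, zero_add] at e1
        have h1 : t * cw (p 0) (p (j + 1)) (p j) ≤ 0 := by nlinarith
        rcases h.above_or hk hij hs with h' | ⟨rfl, rfl⟩
        · linarith
        · rw [AffineMap.lineMap_apply_zero, cw_self_left] at e1
          rcases mul_eq_zero.1 e1.symm with h2 | h2
          · rw [h2, AffineMap.lineMap_apply_zero, AffineMap.lineMap_apply_zero] at e
            exact h.ends_ne hk e.symm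
          · linarith
    · rw [if_pos rfl] at e
      rcases (show i ≤ k by omega).lt_or_eq with hi | rfl
      · have e1 := congrArg (fun y => cw (p 0) y (p k)) e
        simp only [cw_lineMap_mid _ (p (k + 1)), cw_self_left, mul_zero, add_zero] at e1
        have h1 : (1 - t) * cw (p 0) (p (k + 1)) (p k) < 0 := by nlinarith
        rcases h.above_or hk hi hs with h' | ⟨rfl, rfl⟩
        · linarith
        · rw [AffineMap.lineMap_apply_zero, cw_self_left] at e1
          linarith
      · have e1 := congrArg (fun y => cw (p i) (p (i + 1)) y) e
        simp only [cw_lineMap_right, cw_self_right, cw_self_outer, mul_zero, add_zero,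
          zero_add] at e1
        rw [cw_rotate] at e1
        rcases mul_eq_zero.1 e1.symm with h2 | h2
        · rw [h2, AffineMap.lineMap_apply_zero] at e
          exact hs.2.ne ((AffineMap.lineMap_eq_right_iff.1 e).resolve_left hxk)
        · linarith

/-! ### Paths of chains -/

/-- First `f`, then `g`. -/
def concat {X : Type*} (f g : ℝ → X) (t : ℝ) : X := if t ≤ 1 / 2 then f (2 * t) else g (2 * t - 1)

theorem concat_le {X : Type*} (f g : ℝ → X) {t : ℝ} (h : t ≤ 1 / 2) : concat f g t = f (2 * t) :=
  if_pos h

theorem concat_gt {X : Type*} (f g : ℝ → X) {t : ℝ} (h : 1 / 2 < t) :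
    concat f g t = g (2 * t - 1) := if_neg h.not_ge

theorem continuousOn_concat {X : Type*} [TopologicalSpace X] {f g : ℝ → X}
    (hf : ContinuousOn f (Icc 0 1)) (hg : ContinuousOn g (Icc 0 1)) (h : f 1 = g 0) :
    ContinuousOn (concat f g) (Icc 0 1) := by
  have hf' := (continuousOn_iff_continuous_domRestrict.1 hf).Icc_extend' (h := zero_le_one)
  have hg' := (continuousOn_iff_continuous_domRestrict.1 hg).Icc_extend' (h := zero_le_one)
  have : Continuous fun t : ℝ => if t ≤ 1 / 2 then IccExtend zero_le_one ((Icc (0 : ℝ) 1).domRestrict f) (2 * t)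
      else IccExtend zero_le_one ((Icc (0 : ℝ) 1).domRestrict g) (2 * t - 1) := by
    refine Continuous.if_le (by fun_prop) (by fun_prop) continuous_id continuous_const ?_
    intro t ht
    rw [ht, IccExtend_of_mem _ _ (by norm_num), IccExtend_of_mem _ _ (by norm_num)]
    change f (2 * (1 / 2)) = g (2 * (1 / 2) - 1)
    norm_num [h]
  refine this.continuousOn.congr fun t ht => ?_
  beta_reduce
  obtain ⟨h0, h1⟩ := ht
  by_cases hh : t ≤ 1 / 2
  · rw [concat_le _ _ hh, if_pos hh, IccExtend_of_mem _ _ ⟨by linarith, by linarith⟩]; rfl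
  · rw [concat_gt _ _ (not_le.1 hh), if_neg hh,
      IccExtend_of_mem _ _ ⟨by linarith, by linarith⟩]; rfl

/-- A property that holds along `f` and `g` holds along `concat f g`. -/
theorem concat_induction {X : Type*} {f g : ℝ → X} {C : X → Prop} {t : ℝ}
    (ht : t ∈ Icc (0 : ℝ) 1) (hf : ∀ s ∈ Icc (0 : ℝ) 1, C (f s)) (hg : ∀ s ∈ Icc (0 : ℝ) 1, C (g s)) :
    C (concat f g t) := by
  obtain ⟨h0, h1⟩ := ht
  by_cases hh : t ≤ 1 / 2
  · rw [concat_le _ _ hh]; exact hf _ ⟨by linarith, by linarith⟩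
  · have := not_le.1 hh
    rw [concat_gt _ _ this]; exact hg _ ⟨by linarith, by linarith⟩

/-- A deformation of the chain `p 0, …, p k` that keeps the edge lengths. -/
structure ChainPath (k : ℕ) (p : ℕ → ℂ) (P : ℝ → ℕ → ℂ) : Prop where
  cont : ∀ j ≤ k, ContinuousOn (fun t => P t j) (Icc 0 1)
  zero : ∀ j ≤ k, P 0 j = p j
  len : ∀ t ∈ Icc (0 : ℝ) 1, ∀ j < k, dist (P t j) (P t (j + 1)) = dist (p j) (p (j + 1))

/-- The chain can be opened, through convex arcs with longer bases, until it is straight. -/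
def Openable (k : ℕ) (p : ℕ → ℂ) : Prop :=
  ∃ P : ℝ → ℕ → ℂ, ChainPath k p P ∧
    (∀ t ∈ Ioc (0 : ℝ) 1, dist (p 0) (p k) < dist (P t 0) (P t k)) ∧
    (∀ t ∈ Ico (0 : ℝ) 1, WArc k (P t)) ∧
    ∀ j < k, ∃ r : ℝ, 0 < r ∧ P 1 (j + 1) - P 1 j = r • (P 1 k - P 1 0)

theorem Openable.congr {k : ℕ} {p q : ℕ → ℂ} (h : Openable k p) (e : ∀ j ≤ k, q j = p j) :
    Openable k q := by
  obtain ⟨P, hP, h1, h2, h3⟩ := h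
  refine ⟨P, ⟨hP.cont, fun j hj => (hP.zero j hj).trans (e j hj).symm, fun t ht j hj => ?_⟩,
    fun t ht => ?_, h2, h3⟩
  · rw [e j (by omega), e (j + 1) (by omega)]; exact hP.len t ht j hj
  · rw [e 0 (by omega), e k le_rfl]; exact h1 t ht

/-- The base need not grow monotonically: the later bases exceed that of `q`, which exceeds that of
`p`. -/
theorem Openable.trans {k : ℕ} {p q : ℕ → ℂ} {P : ℝ → ℕ → ℂ} (hP : ChainPath k p P)
    (hb : ∀ t ∈ Ioc (0 : ℝ) 1, dist (p 0) (p k) < dist (P t 0) (P t k))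
    (hW : ∀ t ∈ Icc (0 : ℝ) 1, WArc k (P t)) (hq : ∀ j ≤ k, P 1 j = q j) (h : Openable k q) :
    Openable k p := by
  obtain ⟨Q, hQ, h1, h2, h3⟩ := h
  have hbq : dist (p 0) (p k) < dist (q 0) (q k) := by
    rw [← hq 0 (by omega), ← hq k le_rfl]; exact hb 1 ⟨by norm_num, le_rfl⟩
  refine ⟨concat P Q, ⟨fun j hj => ?_, fun j hj => ?_, fun t ht j hj => ?_⟩, fun t ht => ?_,
    fun t ht => ?_, fun j hj => ?_⟩
  · have := continuousOn_concat (hP.cont j hj) (hQ.cont j hj) (by rw [hq j hj, hQ.zero j hj])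
    refine this.congr fun t ht => ?_
    simp only [concat]; split_ifs <;> rfl
  · rw [concat_le _ _ (by norm_num), mul_zero]; exact hP.zero j hj
  · refine concat_induction (C := fun f : ℕ → ℂ => dist (f j) (f (j + 1)) = dist (p j) (p (j + 1))) ht
      (fun s hs => hP.len s hs j hj) fun s hs => ?_
    rw [hQ.len s hs j hj, ← hq j (by omega), ← hq (j + 1) (by omega)]
    exact hP.len 1 (by norm_num) j hj
  · obtain ⟨ht0, ht1⟩ := ht
    by_cases hh : t ≤ 1 / 2
    · rw [concat_le _ _ hh]; exact hb _ ⟨by linarith, by linarith⟩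
    · have := not_le.1 hh
      rw [concat_gt _ _ this]; exact hbq.trans (h1 _ ⟨by linarith, by linarith⟩)
  · obtain ⟨ht0, ht1⟩ := ht
    by_cases hh : t ≤ 1 / 2
    · rw [concat_le _ _ hh]; exact hW _ ⟨by linarith, by linarith⟩
    · have := not_le.1 hh
      rw [concat_gt _ _ this]; exact h2 _ ⟨by linarith, by linarith⟩
  · rw [concat_gt _ _ (by norm_num), show (2 : ℝ) * 1 - 1 = 1 by norm_num]; exact h3 j hj

theorem continuousOn_insertAt {j : ℕ} {r : ℝ} {k : ℕ} {P : ℝ → ℕ → ℂ} {s : Set ℝ}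
    (h : ∀ l ≤ k, ContinuousOn (fun t => P t l) s) (hj : j ≤ k) {l : ℕ} (hl : l ≤ k + 1) :
    ContinuousOn (fun t => insertAt j r (P t) l) s := by
  simp only [insertAt]
  split_ifs
  · exact h l (by omega)
  · simp only [AffineMap.lineMap_apply, vsub_eq_sub, vadd_eq_add]
    exact (((h j hj).sub (h (j - 1) (by omega))).const_smul r).add (h (j - 1) (by omega))
  · exact h (l - 1) (by omega)

theorem dist_insertAt {k j : ℕ} {p q : ℕ → ℂ} (r : ℝ) (hj : 1 ≤ j)
    (h : ∀ l < k, dist (p l) (p (l + 1)) = dist (q l) (q (l + 1))) (hjk : j ≤ k) {l : ℕ}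
    (hl : l < k + 1) :
    dist (insertAt j r p l) (insertAt j r p (l + 1)) =
      dist (insertAt j r q l) (insertAt j r q (l + 1)) := by
  rcases lt_trichotomy l j with h1 | rfl | h1
  · rcases (show l + 1 ≤ j by omega).lt_or_eq with h2 | rfl
    · simp only [insertAt_lt _ _ h1, insertAt_lt _ _ h2]
      exact h l (by omega)
    · simp only [insertAt_lt _ _ h1, insertAt_self, Nat.add_sub_cancel, dist_left_lineMap,
        h l (by omega)]
  · simp only [insertAt_gt _ _ (Nat.lt_add_one l), insertAt_self, Nat.add_sub_cancel,
      dist_lineMap_right]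
    have := h (l - 1) (by omega)
    rw [Nat.sub_add_cancel hj] at this
    rw [this]
  · simp only [insertAt_gt _ _ h1, insertAt_gt _ _ (show j < l + 1 by omega), Nat.add_sub_cancel]
    have := h (l - 1) (by omega)
    rwa [Nat.sub_add_cancel (by omega)] at this

/-- The inserted vertex rides on its edge at the fixed ratio `r`. Since `1 ≤ j ≤ k`, the ends of the
chain, and hence the base, are unchanged. -/
theorem Openable.insertAt {k : ℕ} {p : ℕ → ℂ} (h : Openable k p) {j : ℕ} {r : ℝ} (hj : 1 ≤ j)
    (hjk : j ≤ k) (hr : 0 < r) (hr1 : r < 1) : Openable (k + 1) (insertAt j r p) := by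
  obtain ⟨P, hP, h1, h2, h3⟩ := h
  have e0 : ∀ p, Arch.insertAt j r p 0 = p 0 := fun p => insertAt_lt _ _ (by omega)
  have ek : ∀ p, Arch.insertAt j r p (k + 1) = p k := fun p => insertAt_gt _ _ (by omega)
  refine ⟨fun t => Arch.insertAt j r (P t), ⟨fun l hl => continuousOn_insertAt hP.cont hjk hl,
    fun l hl => ?_, fun t ht l hl => dist_insertAt r hj (hP.len t ht) hjk hl⟩, fun t ht => ?_,
    fun t ht => .ins j r (h2 t ht) hj hjk hr hr1 fun _ _ => rfl, fun l hl => ?_⟩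
  · simp only [Arch.insertAt, hP.zero j hjk, hP.zero (j - 1) (by omega)]
    split_ifs
    · exact hP.zero l (by omega)
    · rfl
    · exact hP.zero (l - 1) (by omega)
  · beta_reduce; rw [e0, ek, e0, ek]; exact h1 t ht
  · beta_reduce; rw [e0, ek]
    rcases lt_trichotomy l j with h1 | rfl | h1
    · rcases (show l + 1 ≤ j by omega).lt_or_eq with h2 | rfl
      · rw [insertAt_lt _ _ h1, insertAt_lt _ _ h2]; exact h3 l (by omega)
      · obtain ⟨a, ha, e⟩ := h3 l (by omega)
        refine ⟨r * a, by positivity, ?_⟩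
        rw [insertAt_lt _ _ h1, insertAt_self, Nat.add_sub_cancel, AffineMap.lineMap_apply,
          vsub_eq_sub, vadd_eq_add, add_sub_cancel_right, e, smul_smul]
    · obtain ⟨a, ha, e⟩ := h3 (l - 1) (by omega)
      refine ⟨(1 - r) * a, mul_pos (by linarith) ha, ?_⟩
      rw [Nat.sub_add_cancel hj] at e
      rw [insertAt_gt _ _ (Nat.lt_add_one l), insertAt_self, Nat.add_sub_cancel, mul_smul, ← e,
        AffineMap.lineMap_apply, vsub_eq_sub, vadd_eq_add]
      module
    · rw [insertAt_gt _ _ h1, insertAt_gt _ _ (show j < l + 1 by omega), Nat.add_sub_cancel]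
      have := h3 (l - 1) (by omega)
      rwa [Nat.sub_add_cancel (by omega)] at this

theorem dist_neg_conj (a b : ℂ) : dist (-(starRingEnd ℂ) a) (-(starRingEnd ℂ) b) = dist a b := by
  rw [dist_neg_neg, Complex.dist_conj_conj]

theorem Openable.of_mirror {k : ℕ} {p : ℕ → ℂ} (h : Openable k (mirror k p)) : Openable k p := by
  obtain ⟨P, hP, h1, h2, h3⟩ := h
  have e1 : ∀ f : ℕ → ℂ, mirror k f 0 = -(starRingEnd ℂ) (f k) := fun f => rfl
  have e2 : ∀ f : ℕ → ℂ, mirror k f k = -(starRingEnd ℂ) (f 0) := fun f => by simp [mirror]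
  refine ⟨fun t => mirror k (P t), ⟨fun j hj => ?_, fun j hj => ?_, fun t ht j hj => ?_⟩,
    fun t ht => ?_, fun t ht => (h2 t ht).mirror, fun j hj => ?_⟩
  · exact (Complex.continuous_conj.comp_continuousOn (hP.cont (k - j) (by omega))).neg
  · rw [mirror, hP.zero _ (by omega)]; exact mirror_mirror p hj
  · have := hP.len t ht (k - (j + 1)) (by omega)
    rw [show k - (j + 1) + 1 = k - j by omega] at this
    rw [mirror, mirror, dist_neg_conj, dist_comm, this, mirror, mirror, dist_neg_conj,
      show k - (k - (j + 1)) = j + 1 by omega, show k - (k - j) = j by omega, dist_comm]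
  · have := h1 t ht
    rw [e1, e2, dist_neg_conj, dist_comm] at this
    beta_reduce
    rw [e1, e2, dist_neg_conj, dist_comm (P t k)]
    exact this
  · obtain ⟨r, hr, e⟩ := h3 (k - (j + 1)) (by omega)
    refine ⟨r, hr, ?_⟩
    rw [show k - (j + 1) + 1 = k - j by omega] at e
    beta_reduce
    rw [e1, e2, mirror, mirror]
    have := congrArg (starRingEnd ℂ) e
    simp only [Complex.real_smul, map_sub, map_mul, Complex.conj_ofReal] at this ⊢
    linear_combination this

theorem Openable.of_rigid {k : ℕ} {p : ℕ → ℂ} {u w : ℂ} (hu : ‖u‖ = 1)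
    (h : Openable k fun j => u * p j + w) : Openable k p := by
  obtain ⟨P, hP, h1, h2, h3⟩ := h
  have hu0 : u ≠ 0 := fun e => by simp [e] at hu
  have hv : ‖u⁻¹‖ = 1 := by rw [norm_inv, hu, inv_one]
  have hd : ∀ v : ℂ, ‖v‖ = 1 → ∀ w a b : ℂ, dist (v * a + w) (v * b + w) = dist a b := by
    intro v hv w a b
    rw [dist_add_right, dist_eq_norm, ← mul_sub, norm_mul, hv, one_mul, dist_eq_norm]
  refine ⟨fun t j => u⁻¹ * P t j + -(u⁻¹ * w), ⟨fun j hj => ?_, fun j hj => ?_, fun t ht j hj => ?_⟩,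
    fun t ht => ?_, fun t ht => (h2 t ht).rigid _ hv, fun j hj => ?_⟩
  · exact ((hP.cont j hj).const_smul u⁻¹).add continuousOn_const
  · simp only [hP.zero j hj]; field_simp; ring
  · rw [hd _ hv, hP.len t ht j hj, hd _ hu]
  · rw [hd _ hv]; have := h1 t ht; rwa [hd _ hu] at this
  · obtain ⟨r, hr, e⟩ := h3 j hj
    refine ⟨r, hr, ?_⟩
    simp only [Complex.real_smul] at e ⊢
    linear_combination u⁻¹ * e

end Arch
end

noncomputable section

namespace Arch

open Set

/-! ### Opening an arc with an acute base angle -/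

/-- Clockwise cross product. -/
def br (u v : ℂ) : ℝ := u.im * v.re - u.re * v.im

/-- Scalar product. -/
def dt (u v : ℂ) : ℝ := u.re * v.re + u.im * v.im

theorem cw_eq_br (a b c : ℂ) : cw a b c = br (b - a) (c - a) := rfl

theorem cw_eq_br' (a b c : ℂ) : cw a b c = br (b - a) (c - b) := by
  simp only [cw, br, Complex.sub_re, Complex.sub_im]; ring

theorem dt_self (u : ℂ) : dt u u = ‖u‖ ^ 2 := by
  rw [← Complex.normSq_eq_norm_sq, Complex.normSq_apply]; rfl

theorem dt_add_right (u v w : ℂ) : dt u (v + w) = dt u v + dt u w := by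
  simp only [dt, Complex.add_re, Complex.add_im]; ring

theorem dt_smul_left (r : ℝ) (u v : ℂ) : dt (r • u) v = r * dt u v := by
  simp only [dt, Complex.smul_re, Complex.smul_im, smul_eq_mul]; ring

theorem dt_smul_right (r : ℝ) (u v : ℂ) : dt u (r • v) = r * dt u v := by
  simp only [dt, Complex.smul_re, Complex.smul_im, smul_eq_mul]; ring

theorem br_smul_left (r : ℝ) (u v : ℂ) : br (r • u) v = r * br u v := by
  simp only [br, Complex.smul_re, Complex.smul_im, smul_eq_mul]; ring

theorem br_smul_right (r : ℝ) (u v : ℂ) : br u (r • v) = r * br u v := by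
  simp only [br, Complex.smul_re, Complex.smul_im, smul_eq_mul]; ring

theorem br_add_left (u v w : ℂ) : br (u + v) w = br u w + br v w := by
  simp only [br, Complex.add_re, Complex.add_im]; ring

theorem br_self (u : ℂ) : br u u = 0 := by simp only [br]; ring

/-- Turning `z` clockwise to `y`, of the same length, closer to `d`, increases the projection
to `d`. -/
theorem dt_lt_dt {z y d : ℂ} (hn : dt z z = dt y y) (hzd : 0 < br z d) (hyd : 0 ≤ br y d)
    (hzy : 0 < br z y) : dt z d < dt y d := by
  have hz : 0 < dt z z := by
    rcases (show 0 ≤ dt z z by rw [dt_self]; positivity).lt_or_eq with h | h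
    · exact h
    · rw [dt_self] at h
      have : z = 0 := by simpa using h.symm
      simp [this, br] at hzd
  set a := dt z z with ha
  have i1 : a * dt y d = dt z y * dt z d + br z y * br z d := by
    simp only [ha, dt, br]; ring
  have i2 : a * br y d = dt z y * br z d - br z y * dt z d := by
    simp only [ha, dt, br]; ring
  have i3 : dt z y ^ 2 + br z y ^ 2 = a * a := by
    nth_rewrite 2 [hn]; simp only [ha, dt, br]; ring
  -- `c` and `s` are `a` times the cosine and the sine of the angle from `z` to `y`; the identities
  -- above are the rotation formulas.
  set c := dt z y
  set s := br z y
  have hca : c < a := by nlinarith [sq_nonneg (c - a), sq_nonneg (c + a)]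
  by_contra! hle
  have j1 : s * br z d ≤ (a - c) * dt z d := by nlinarith
  have hD : 0 < dt z d := by
    by_contra! h
    nlinarith [mul_pos hzy hzd]
  have j2 : 0 ≤ c * br z d - s * dt z d := by rw [← i2]; positivity
  have hc : 0 < c := by
    by_contra! h
    nlinarith [mul_pos hzy hD]
  -- `c * s * S ≤ c (a - c) D` and `s² D ≤ s c S`, with `s² = (a - c) (a + c)`
  have j3 : s ^ 2 = (a - c) * (a + c) := by linarith
  have j4 : s ^ 2 * dt z d ≤ c * ((a - c) * dt z d) := by nlinarith
  have j5 : 0 < (a - c) * dt z d := mul_pos (by linarith) hD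
  nlinarith

/-- The base `z + d` turns clockwise together with `z`. After multiplication by `dt z z` the claim
is the sum of `br z y * dt z (z + d)`, nonnegative because the angle is not obtuse, and `(dt z z -
dt z y) * br z d`, positive because `z` and `y` have equal length and different directions. -/
theorem br_add_add_pos {z y d : ℂ} (hn : dt z z = dt y y) (hzd : 0 < br z d)
    (hzy : 0 < br z y) (hac : 0 ≤ dt z (z + d)) : 0 < br (z + d) (y + d) := by
  have hz : 0 < dt z z := by
    rcases (show 0 ≤ dt z z by rw [dt_self]; positivity).lt_or_eq with h | h
    · exact h
    · rw [dt_self] at h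
      have : z = 0 := by simpa using h.symm
      simp [this, br] at hzd
  set a := dt z z with ha
  have i2 : a * br y d = dt z y * br z d - br z y * dt z d := by
    simp only [ha, dt, br]; ring
  have i3 : dt z y ^ 2 + br z y ^ 2 = a * a := by
    nth_rewrite 2 [hn]; simp only [ha, dt, br]; ring
  have i4 : br (z + d) (y + d) = br z y + br z d - br y d := by
    simp only [br, Complex.add_re, Complex.add_im]; ring
  have hca : dt z y < a := by nlinarith [sq_nonneg (dt z y - a), sq_nonneg (dt z y + a)]
  rw [dt_add_right] at hac
  have : 0 < a * br (z + d) (y + d) := by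
    rw [i4, mul_sub, i2]
    nlinarith [mul_nonneg hzy.le hac, mul_pos (sub_pos.2 hca) hzd]
  exact (pos_iff_pos_of_mul_pos this).1 hz

/-- The Plücker relation for `v`, `z + d`, `y + d`, `d`. With `v = p (k - 1) - p k` it says that the
base angle at the far end stays convex while the first edge turns from `z` to `y`. -/
theorem br_pos_of_turn {v z y d : ℂ} (hn : dt z z = dt y y) (hzd : 0 < br z d) (hyd : 0 ≤ br y d)
    (hzy : 0 < br z y) (hac : 0 ≤ dt z (z + d)) (hv : 0 < br v (z + d)) (hvd : 0 ≤ br v d)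
    (hor : 0 < br y d ∨ 0 < br v d) : 0 < br v (y + d) := by
  have h := br_add_add_pos hn hzd hzy hac
  have e1 : br (z + d) d = br z d := by simp only [br, Complex.add_re, Complex.add_im]; ring
  have e2 : br z d * br v (y + d) = br v (z + d) * br y d + br v d * br (z + d) (y + d) := by
    simp only [br, Complex.add_re, Complex.add_im]; ring
  have : 0 < br z d * br v (y + d) := by
    rw [e2]
    rcases hor with h' | h' <;> positivity
  exact (pos_iff_pos_of_mul_pos this).1 hzd

theorem dt_add_self (z d : ℂ) : ‖z + d‖ ^ 2 = dt z z + 2 * dt z d + dt d d := by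
  rw [← dt_self]; simp only [dt, Complex.add_re, Complex.add_im]; ring

/-! ### Turning a vector at constant length -/

/-- The vector of the length of `z` that turns from the direction of `z` to that of `e`. -/
def turnTo (z e : ℂ) (t : ℝ) : ℂ :=
  (‖z‖ / ‖(1 - t) • z + t • e‖) • ((1 - t) • z + t • e)

section turnTo

variable {z e : ℂ}

/-- `z` and `e` are linearly independent, so no affine combination of them vanishes. This includes
negative `t`, for which the vector turns away from `e`. -/
theorem turnTo_aux (h : 0 < br z e) (t : ℝ) : (1 - t) • z + t • e ≠ 0 := by
  intro h0
  have h1 : br z ((1 - t) • z + t • e) = t * br z e := by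
    simp only [br, Complex.add_re, Complex.add_im, Complex.smul_re, Complex.smul_im, smul_eq_mul]
    ring
  have h2 : br ((1 - t) • z + t • e) e = (1 - t) * br z e := by
    simp only [br, Complex.add_re, Complex.add_im, Complex.smul_re, Complex.smul_im, smul_eq_mul]
    ring
  rw [h0] at h1 h2
  simp only [br, Complex.zero_re, Complex.zero_im] at h1 h2
  simp only [br] at h
  nlinarith

theorem norm_pos_of_br (h : 0 < br z e) : 0 < ‖z‖ := by
  rw [norm_pos_iff]; rintro rfl; simp [br] at h

theorem norm_pos_of_br' (h : 0 < br z e) : 0 < ‖e‖ := by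
  rw [norm_pos_iff]; rintro rfl; simp [br] at h

theorem turnTo_coeff (h : 0 < br z e) (t : ℝ) : 0 < ‖z‖ / ‖(1 - t) • z + t • e‖ :=
  div_pos (norm_pos_of_br h) (norm_pos_iff.2 (turnTo_aux h t))

theorem norm_turnTo (h : 0 < br z e) (t : ℝ) : ‖turnTo z e t‖ = ‖z‖ := by
  rw [turnTo, norm_smul, Real.norm_of_nonneg (turnTo_coeff h t).le,
    div_mul_cancel₀ _ (norm_ne_zero_iff.2 (turnTo_aux h t))]

theorem dt_turnTo (h : 0 < br z e) (t : ℝ) : dt z z = dt (turnTo z e t) (turnTo z e t) := by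
  rw [dt_self, dt_self, norm_turnTo h]

theorem turnTo_zero (h : 0 < br z e) : turnTo z e 0 = z := by
  simp [turnTo, (norm_pos_of_br h).ne']

theorem turnTo_one : turnTo z e 1 = (‖z‖ / ‖e‖) • e := by simp [turnTo]

theorem continuous_turnTo (h : 0 < br z e) : Continuous (turnTo z e) := by
  unfold turnTo
  have h1 : Continuous fun t : ℝ => (1 - t) • z + t • e := by fun_prop
  exact (continuous_const.div h1.norm fun t => norm_ne_zero_iff.2 (turnTo_aux h t)).smul h1

theorem br_turnTo (z e d : ℂ) (t : ℝ) : br (turnTo z e t) d =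
    ‖z‖ / ‖(1 - t) • z + t • e‖ * ((1 - t) * br z d + t * br e d) := by
  rw [turnTo, br_smul_left, br_add_left, br_smul_left, br_smul_left]

theorem br_self_turnTo (h : 0 < br z e) {t : ℝ} (ht : 0 < t) : 0 < br z (turnTo z e t) := by
  have : br z (turnTo z e t) = ‖z‖ / ‖(1 - t) • z + t • e‖ * (t * br z e) := by
    rw [turnTo, br_smul_right]
    congr 1
    simp only [br, Complex.add_re, Complex.add_im, Complex.smul_re, Complex.smul_im, smul_eq_mul]
    ring
  rw [this]
  exact mul_pos (turnTo_coeff h t) (mul_pos ht h)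

end turnTo

/-! ### Turning the first edge of an arc -/

/-- The chain `p` with its first vertex replaced. -/
def setFirst (q : ℂ) (p : ℕ → ℂ) : ℕ → ℂ := fun j => if j = 0 then q else p j

theorem setFirst_zero (q : ℂ) (p : ℕ → ℂ) : setFirst q p 0 = q := rfl

theorem setFirst_pos (q : ℂ) (p : ℕ → ℂ) {j : ℕ} (hj : 0 < j) : setFirst q p j = p j := if_neg hj.ne'

theorem cw_last_eq (q a b : ℂ) : cw q a b = br (a - b) (b - q) := by
  simp only [cw, br, Complex.sub_re, Complex.sub_im]; ring

/-- Turning the first edge of an arc with an acute base angle about its second vertex. -/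
theorem StrictArc.turn_first {k : ℕ} {p : ℕ → ℂ} (hk : 2 ≤ k) (h : StrictArc k p) {y : ℂ}
    (hn : dt (p 1 - p 0) (p 1 - p 0) = dt y y) (hy : 0 < br (p 1 - p 0) y)
    (hac : 0 ≤ dt (p 1 - p 0) (p k - p 0)) (hd : 0 ≤ br y (p k - p 1)) :
    (0 < br y (p k - p 1) ∨ 3 ≤ k → 0 < cw (p 1 - y) (p (k - 1)) (p k)) ∧ dist (p 0) (p k) < dist (p 1 - y) (p k) ∧
      0 ≤ dt (p 1 - (p 1 - y)) (p k - (p 1 - y)) := by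
  have hzd : 0 < br (p 1 - p 0) (p k - p 1) := by
    rw [← cw_eq_br']; exact h 0 1 k (by omega) (by omega) le_rfl
  have e1 : p k - p 0 = (p 1 - p 0) + (p k - p 1) := by ring
  rw [e1] at hac
  have hlt := dt_lt_dt hn hzd hd hy
  refine ⟨fun hor => ?_, ?_, ?_⟩
  · rw [cw_last_eq, show p k - (p 1 - y) = y + (p k - p 1) by ring]
    refine br_pos_of_turn hn hzd hd hy hac ?_ ?_ ?_
    · rw [← e1, ← cw_last_eq]; exact h 0 (k - 1) k (by omega) (by omega) le_rfl
    · rw [← cw_last_eq]; exact (h.weakArc hk).tri _ _ _ (by omega) (by omega) le_rfl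
    · refine hor.imp_right fun h3 => ?_
      rw [← cw_last_eq]; exact h 1 (k - 1) k (by omega) (by omega) le_rfl
  · rw [dist_comm, dist_comm (p 1 - y), dist_eq_norm, dist_eq_norm, e1,
      show p k - (p 1 - y) = y + (p k - p 1) by ring]
    apply lt_of_pow_lt_pow_left₀ 2 (norm_nonneg _)
    rw [dt_add_self, dt_add_self, ← hn]
    linarith
  · rw [show p 1 - (p 1 - y) = y by ring, show p k - (p 1 - y) = y + (p k - p 1) by ring,
      dt_add_right, ← hn]
    rw [dt_add_right] at hac
    linarith

theorem StrictArc.chainPath_turn {k : ℕ} {p : ℕ → ℂ} (hk : 2 ≤ k) (h : StrictArc k p) :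
    ChainPath k p fun t => setFirst (p 1 - turnTo (p 1 - p 0) (p 2 - p 1) t) p := by
  have hz : 0 < br (p 1 - p 0) (p 2 - p 1) := by
    rw [← cw_eq_br']; exact h 0 1 2 (by omega) (by omega) hk
  refine ⟨fun j hj => ?_, fun j hj => ?_, fun t ht j hj => ?_⟩
  · rcases Nat.eq_zero_or_pos j with rfl | hj
    · exact (continuous_const.sub (continuous_turnTo hz)).continuousOn
    · simp only [setFirst_pos _ _ hj]; exact continuousOn_const
  · rcases Nat.eq_zero_or_pos j with rfl | hj
    · rw [setFirst_zero, turnTo_zero hz]; ring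
    · rw [setFirst_pos _ _ hj]
  · rcases Nat.eq_zero_or_pos j with rfl | hj
    · rw [setFirst_zero, zero_add, setFirst_pos _ _ one_pos, dist_comm, dist_eq_norm, sub_sub_cancel,
        norm_turnTo hz, dist_comm, dist_eq_norm]
    · rw [setFirst_pos _ _ hj, setFirst_pos _ _ (by omega)]

/-- What is needed while the first edge turns: the two end triples that put the first vertex in
front of the resting tail, the longer base, and a non-obtuse angle for the next round. The
alternative `t < 1 ∨ 3 ≤ k` excludes only the moment at which a two-edge arc becomes straight. -/
theorem StrictArc.turn_first_facts {k : ℕ} {p : ℕ → ℂ} (hk : 2 ≤ k) (h : StrictArc k p)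
    (hac : 0 ≤ dt (p 1 - p 0) (p k - p 0)) {t : ℝ} (ht : t ∈ Icc (0 : ℝ) 1) (h0 : 0 < t)
    (hor : t < 1 ∨ 3 ≤ k) {q : ℂ} (hq : q = p 1 - turnTo (p 1 - p 0) (p 2 - p 1) t) :
    0 < cw q (p 1) (p k) ∧ 0 < cw q (p (k - 1)) (p k) ∧
    dist (p 0) (p k) < dist q (p k) ∧ 0 ≤ dt (p 1 - q) (p k - q) := by
  obtain ⟨ht0, ht1⟩ := ht
  have hz : 0 < br (p 1 - p 0) (p 2 - p 1) := by
    rw [← cw_eq_br']; exact h 0 1 2 (by omega) (by omega) hk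
  have hzd : 0 < br (p 1 - p 0) (p k - p 1) := by
    rw [← cw_eq_br']; exact h 0 1 k (by omega) (by omega) le_rfl
  have hed : 0 ≤ br (p 2 - p 1) (p k - p 1) := by
    rw [← cw_eq_br]; exact (h.weakArc hk).tri 1 2 k (by omega) hk le_rfl
  have hpos : 0 < br (turnTo (p 1 - p 0) (p 2 - p 1) t) (p k - p 1) := by
    rw [br_turnTo]
    refine mul_pos (turnTo_coeff hz t) ?_
    rcases hor with hor | hor
    · exact add_pos_of_pos_of_nonneg (mul_pos (by linarith) hzd) (mul_nonneg ht0 hed)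
    · refine add_pos_of_nonneg_of_pos (mul_nonneg (by linarith) hzd.le) (mul_pos h0 ?_)
      rw [← cw_eq_br]; exact h 1 2 k (by omega) (by omega) le_rfl
  have := h.turn_first hk (dt_turnTo hz t) (br_self_turnTo hz h0) hac hpos.le
  rw [← hq] at this
  refine ⟨?_, this.1 (.inl hpos), this.2⟩
  rw [cw_eq_br', hq, sub_sub_cancel]; exact hpos

theorem StrictArc.turn_first_arc {k : ℕ} {p : ℕ → ℂ} (hk : 2 ≤ k) (h : StrictArc k p)
    (hac : 0 ≤ dt (p 1 - p 0) (p k - p 0)) {t : ℝ} (ht : t ∈ Ico (0 : ℝ) 1) :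
    StrictArc k (setFirst (p 1 - turnTo (p 1 - p 0) (p 2 - p 1) t) p) := by
  obtain ⟨ht0, ht1⟩ := ht
  have hz : 0 < br (p 1 - p 0) (p 2 - p 1) := by
    rw [← cw_eq_br']; exact h 0 1 2 (by omega) (by omega) hk
  rcases ht0.lt_or_eq with h0 | rfl
  swap
  · refine h.congr fun j hj => ?_
    have := (h.chainPath_turn hk).zero j hj
    exact this
  obtain ⟨f1, f2, -, -⟩ := h.turn_first_facts hk hac ⟨ht0, ht1.le⟩ h0 (.inl ht1) rfl
  obtain ⟨m, rfl⟩ : ∃ m, k = m + 1 := ⟨k - 1, by omega⟩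
  refine StrictArc.front (by omega) ?_ ?_ ?_ ?_
  · exact h.shift
  · simpa [setFirst] using f1
  · have : 0 < cw (p 1 - turnTo (p 1 - p 0) (p 2 - p 1) t) (p 1) (p 2) := by
      rw [cw_eq_br', sub_sub_cancel, br_turnTo, br_self, mul_zero, add_zero]
      exact mul_pos (turnTo_coeff hz t) (mul_pos (by linarith) hz)
    simpa [setFirst] using this
  · simpa [setFirst, show m ≠ 0 by omega] using f2

/-- A vertex `p 1` in line with its neighbours can be dropped. -/
theorem StrictArc.drop_second {k : ℕ} {p : ℕ → ℂ} (hk : 3 ≤ k)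
    (h : StrictArc (k - 1) fun j => p (j + 1)) {ρ : ℝ} (hρ : 0 < ρ)
    (he : p 1 - p 0 = ρ • (p 2 - p 1)) (h2 : 0 < cw (p 0) (p (k - 1)) (p k)) :
    ∃ q : ℕ → ℂ, StrictArc (k - 1) q ∧ q 0 = p 0 ∧ (∀ j, 0 < j → q j = p (j + 1)) ∧
      ∃ r : ℝ, 0 < r ∧ r < 1 ∧ ∀ j, p j = insertAt 1 r q j := by
  -- `p 2 - p 0` is `1 + ρ` times `p 2 - p 1`, so replacing `p 1` by `p 0` preserves signs; the
  -- dropped vertex divides the new edge at `ρ / (1 + ρ)`.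
  have key : ∀ v, cw (p 0) (p 2) v = (1 + ρ) * cw (p 1) (p 2) v := by
    intro v
    rw [cw_eq_br', cw_eq_br', ← br_smul_left, show p 2 - p 0 = (p 2 - p 1) + (p 1 - p 0) by ring, he]
    congr 1; module
  obtain ⟨m, rfl⟩ : ∃ m, k = m + 2 := ⟨k - 2, by omega⟩
  refine ⟨setFirst (p 0) fun j => p (j + 1), ?_, rfl, fun j hj => setFirst_pos _ _ hj,
    ρ / (1 + ρ), by positivity, (div_lt_one (by positivity)).2 (by linarith), fun j => ?_⟩
  · have g : ∀ a b c, 0 < a → a < b → b < c → c ≤ m + 2 → 0 < cw (p a) (p b) (p c) := by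
      intro a b c ha hab hbc hc
      have := h (a - 1) (b - 1) (c - 1) (by omega) (by omega) (by omega)
      simpa only [show a - 1 + 1 = a by omega, show b - 1 + 1 = b by omega,
        show c - 1 + 1 = c by omega] using this
    refine StrictArc.front (k := m) (by omega) ?_ ?_ ?_ ?_
    · exact (show StrictArc (m + 1) fun j => p (j + 1) from h).shift.congr fun j _ =>
        setFirst_pos _ _ (Nat.succ_pos j)
    · have := key (p (m + 2))
      have h3 := g 1 2 (m + 2) (by omega) (by omega) (by omega) le_rfl
      have : 0 < cw (p 0) (p 2) (p (m + 2)) := by rw [this]; positivity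
      simpa [setFirst] using this
    · have := key (p 3)
      have h3 := g 1 2 3 (by omega) (by omega) (by omega) (by omega)
      have : 0 < cw (p 0) (p 2) (p 3) := by rw [this]; positivity
      simpa [setFirst] using this
    · simpa [setFirst, show m ≠ 0 by omega] using h2
  · rcases lt_trichotomy j 1 with hj | rfl | hj
    · obtain rfl : j = 0 := by omega
      rfl
    · rw [insertAt_self, Nat.sub_self, setFirst_zero, setFirst_pos _ _ one_pos,
        AffineMap.lineMap_apply, vsub_eq_sub, vadd_eq_add]
      have : p (1 + 1) - p 0 = (1 + ρ) • (p 2 - p 1) := by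
        rw [show p (1 + 1) - p 0 = (p 2 - p 1) + (p 1 - p 0) by ring_nf, he]; module
      rw [this, smul_smul, div_mul_cancel₀ _ (by positivity), ← he]; ring
    · rw [insertAt_gt _ _ hj, setFirst_pos _ _ (by omega), Nat.sub_add_cancel (by omega)]

/-- An arc whose first base angle is at most a right angle can be opened. -/
theorem StrictArc.openable_of_acute {k : ℕ} (hk : 2 ≤ k) : ∀ {p : ℕ → ℂ}, StrictArc k p →
    0 ≤ dt (p 1 - p 0) (p k - p 0) → Openable k p := by
  induction k, hk using Nat.le_induction with
  | base =>
    intro p h hac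
    have hz : 0 < br (p 1 - p 0) (p 2 - p 1) := by
      rw [← cw_eq_br']; exact h 0 1 2 (by omega) (by omega) le_rfl
    have hz1 := norm_pos_of_br hz
    have hz2 := norm_pos_of_br' hz
    refine ⟨_, h.chainPath_turn le_rfl, fun t ht => ?_, fun t ht =>
      .core le_rfl (h.turn_first_arc le_rfl hac ht), fun j hj => ?_⟩
    · obtain ⟨ht0, ht1⟩ := ht
      refine (h.turn_first le_rfl (dt_turnTo hz t) (br_self_turnTo hz ht0) hac ?_).2.1
      rw [br_turnTo, br_self, mul_zero, add_zero]
      exact mul_nonneg (turnTo_coeff hz t).le (mul_nonneg (by linarith) hz.le)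
    · set ρ := ‖p 1 - p 0‖ / ‖p 2 - p 1‖ with hρ
      have hρ0 : 0 < ρ := div_pos hz1 hz2
      rw [turnTo_one, ← hρ]
      have e : setFirst (p 1 - ρ • (p 2 - p 1)) p 2 - setFirst (p 1 - ρ • (p 2 - p 1)) p 0 =
          (1 + ρ) • (p 2 - p 1) := by
        rw [setFirst_zero, setFirst_pos _ _ two_pos]; module
      rw [e]
      interval_cases j
      · refine ⟨ρ / (1 + ρ), by positivity, ?_⟩
        rw [setFirst_zero, setFirst_pos _ _ (by omega), smul_smul, div_mul_cancel₀ _ (by positivity),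
          sub_sub_cancel]
      · refine ⟨1 / (1 + ρ), by positivity, ?_⟩
        rw [setFirst_pos _ _ (by omega), setFirst_pos _ _ one_pos, smul_smul,
          div_mul_cancel₀ _ (by positivity), one_smul]
  | succ k hk ih =>
    intro p h hac
    have hz : 0 < br (p 1 - p 0) (p 2 - p 1) := by
      rw [← cw_eq_br']; exact h 0 1 2 (by omega) (by omega) (by omega)
    have hz1 := norm_pos_of_br hz
    have hz2 := norm_pos_of_br' hz
    -- At time `1` the first edge is in line with the second. The joint at `p 1` is frozen, and the
    -- chain without it has one edge less. Its first edge has the same direction, so the angle there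
    -- is still not obtuse and the induction hypothesis applies.
    set q := p 1 - turnTo (p 1 - p 0) (p 2 - p 1) 1 with hq
    obtain ⟨f1, f2, f3, f4⟩ := h.turn_first_facts (by omega) hac (t := 1) (by norm_num) one_pos
      (.inr (by omega)) hq
    set ρ := ‖p 1 - p 0‖ / ‖p 2 - p 1‖ with hρ
    have hρ0 : 0 < ρ := div_pos hz1 hz2
    have e1 : p 1 - q = ρ • (p 2 - p 1) := by rw [hq, sub_sub_cancel, turnTo_one]
    obtain ⟨r, hr, hr0, hrj, s, hs0, hs1, hins⟩ := StrictArc.drop_second (k := k + 1)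
      (p := setFirst q p) (by omega) h.shift hρ0 e1
      (by simpa [setFirst, show k ≠ 0 by omega] using f2)
    have hr' : StrictArc k r := hr
    have hop : Openable k r := by
      refine ih hr' ?_
      rw [hr0, hrj 1 one_pos, hrj k (by omega), setFirst_zero, setFirst_pos _ _ (by omega),
        setFirst_pos _ _ (by omega)]
      have : p (1 + 1) - q = ((1 + ρ) / ρ) • (p 1 - q) := by
        rw [show p (1 + 1) - q = (p 2 - p 1) + (p 1 - q) by ring_nf, e1, smul_smul,
          div_mul_cancel₀ _ hρ0.ne']; module
      rw [this, dt_smul_left]; positivity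
    refine Openable.trans (h.chainPath_turn (by omega)) (fun t ht => ?_) (fun t ht => ?_)
      (fun j hj => hins j) (hop.insertAt le_rfl (by omega) hs0 hs1)
    · exact (h.turn_first_facts (by omega) hac ⟨ht.1.le, ht.2⟩ ht.1 (.inr (by omega)) rfl).2.2.1
    · rcases ht.2.lt_or_eq with ht1 | rfl
      · exact .core (by omega) (h.turn_first_arc (by omega) hac ⟨ht.1, ht1⟩)
      · exact .ins 1 s (.core hk hr') le_rfl (by omega) hs0 hs1 fun l _ => hins l

end Arch
end

noncomputable section

namespace Arch

open Set

/-! ### Straight joints next to the last vertex; first zeros -/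

/-- A vertex `p (k - 1)` in line with its neighbours can be dropped. -/
theorem StrictArc.drop_penult {k : ℕ} {p : ℕ → ℂ} (hk : 3 ≤ k) (h : StrictArc (k - 1) p) {ρ : ℝ}
    (hρ : 0 < ρ) (he : p k - p (k - 1) = ρ • (p (k - 1) - p (k - 2)))
    (h2 : 0 < cw (p 0) (p 1) (p k)) :
    ∃ q : ℕ → ℂ, StrictArc (k - 1) q ∧ (∀ j < k - 1, q j = p j) ∧ q (k - 1) = p k ∧
      ∃ r : ℝ, 0 < r ∧ r < 1 ∧ ∀ j ≤ k, p j = insertAt (k - 1) r q j := by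
  have key : ∀ v, cw v (p (k - 2)) (p k) = (1 + ρ) * cw v (p (k - 2)) (p (k - 1)) := by
    intro v
    rw [cw_eq_br', cw_eq_br', ← br_smul_right,
      show p k - p (k - 2) = (p (k - 1) - p (k - 2)) + (p k - p (k - 1)) by ring, he]
    congr 1; module
  obtain ⟨m, rfl⟩ : ∃ m, k = m + 2 := ⟨k - 2, by omega⟩
  simp only [show m + 2 - 1 = m + 1 by omega, show m + 2 - 2 = m by omega] at *
  have e1 : ∀ j, j < m + 1 → (if j < m + 1 then p j else p (m + 2)) = p j := fun j hj => if_pos hj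
  refine ⟨fun j => if j < m + 1 then p j else p (m + 2), ?_, fun j hj => if_pos hj,
    if_neg (lt_irrefl _), 1 / (1 + ρ), by positivity,
    (div_lt_one (by positivity)).2 (by linarith), fun j hj => ?_⟩
  · refine StrictArc.snoc (by omega) ((h.mono (by omega)).congr fun j hj => e1 j (by omega)) ?_ ?_ ?_
    · rw [e1 0 (by omega), e1 m (by omega), if_neg (lt_irrefl _), key]
      exact mul_pos (by positivity) (h 0 m (m + 1) (by omega) (by omega) le_rfl)
    · rw [e1 0 (by omega), e1 1 (by omega), if_neg (lt_irrefl _)]; exact h2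
    · rw [e1 (m - 1) (by omega), e1 m (by omega), if_neg (lt_irrefl _), key]
      exact mul_pos (by positivity) (h (m - 1) m (m + 1) (by omega) (by omega) le_rfl)
  · rcases lt_trichotomy j (m + 1) with hj1 | rfl | hj1
    · rw [insertAt_lt _ _ hj1, if_pos hj1]
    · rw [insertAt_self, Nat.add_sub_cancel, if_pos (by omega), if_neg (lt_irrefl _),
        AffineMap.lineMap_apply, vsub_eq_sub, vadd_eq_add]
      have : p (m + 2) - p m = (1 + ρ) • (p (m + 1) - p m) := by
        rw [show p (m + 2) - p m = (p (m + 1) - p m) + (p (m + 2) - p (m + 1)) by ring, he]; module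
      rw [this, smul_smul, div_mul_cancel₀ _ (by positivity), one_smul]; ring
    · obtain rfl : j = m + 2 := by omega
      rw [insertAt_gt _ _ hj1, if_neg (by omega)]

/-- The reflected and reversed chain has this angle at its first vertex. -/
theorem StrictArc.openable_of_acute_last {k : ℕ} (hk : 2 ≤ k) {p : ℕ → ℂ} (h : StrictArc k p)
    (hac : 0 ≤ dt (p (k - 1) - p k) (p 0 - p k)) : Openable k p := by
  refine Openable.of_mirror (h.mirror.openable_of_acute hk ?_)
  have e : dt (Arch.mirror k p 1 - Arch.mirror k p 0) (Arch.mirror k p k - Arch.mirror k p 0) =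
      dt (p (k - 1) - p k) (p 0 - p k) := by
    simp only [Arch.mirror, dt, Nat.sub_self, Nat.sub_zero, Complex.sub_re, Complex.sub_im,
      Complex.neg_re, Complex.neg_im, Complex.conj_re, Complex.conj_im]
    ring
  rw [e]; exact hac

/-- The first time at which a continuous function, positive at first, vanishes. -/
theorem exists_first_zero {f : ℝ → ℝ} {H : ℝ} (hH : 0 < H) (hf : ContinuousOn f (Icc 0 H))
    (h0 : 0 < f 0) :
    ∃ h, 0 < h ∧ h ≤ H ∧ (∀ s, 0 ≤ s → s < h → 0 < f s) ∧ 0 ≤ f h ∧ (h = H ∨ f h = 0) := by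
  by_cases hpos : ∀ s ∈ Icc 0 H, 0 < f s
  · exact ⟨H, hH, le_rfl, fun s hs hsH => hpos s ⟨hs, hsH.le⟩, (hpos H ⟨hH.le, le_rfl⟩).le, .inl rfl⟩
  push Not at hpos
  obtain ⟨s0, hs0, hfs0⟩ := hpos
  have hc : IsCompact (Icc 0 H ∩ f ⁻¹' Iic 0) :=
    isCompact_Icc.of_isClosed_subset (hf.preimage_isClosed_of_isClosed isClosed_Icc isClosed_Iic)
      inter_subset_left
  obtain ⟨h, ⟨⟨hh0, hhH⟩, hfh⟩, hmin⟩ := hc.exists_isLeast ⟨s0, hs0, hfs0⟩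
  have hh : 0 < h := by
    rcases hh0.lt_or_eq with h' | rfl
    · exact h'
    · exact absurd h0 (not_lt.2 hfh)
  have hlt : ∀ s, 0 ≤ s → s < h → 0 < f s := by
    intro s hs hsh
    by_contra! hle
    exact absurd (hmin ⟨⟨hs, by linarith⟩, hle⟩) (not_le.2 hsh)
  -- `f` is positive before `h`, so a negative value at `h` would force an earlier zero.
  have hz : f h = 0 := by
    refine le_antisymm hfh ?_
    by_contra! hneg
    have := intermediate_value_Icc' hh.le (hf.mono (Icc_subset_Icc_right hhH))
    obtain ⟨s, hs, hfs⟩ := this ⟨hneg.le, h0.le⟩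
    rcases hs.2.lt_or_eq with h' | rfl
    · exact absurd hfs (hlt s hs.1 h').ne'
    · linarith
  exact ⟨h, hh, hhH, hlt, hz.ge, .inr hz⟩

/-! ### Opening an arc with two obtuse base angles -/

/-- The horizontal distance covered by an edge with end height difference `y + h`. -/
def reach (x y h : ℝ) : ℝ := √(x ^ 2 + y ^ 2 - (y + h) ^ 2)

theorem reach_zero {x : ℝ} (y : ℝ) (hx : 0 ≤ x) : reach x y 0 = x := by
  rw [reach, add_zero, add_sub_cancel_right, Real.sqrt_sq hx]

theorem reach_nonneg (x y h : ℝ) : 0 ≤ reach x y h := Real.sqrt_nonneg _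

theorem reach_lt {x y h : ℝ} (hx : 0 < x) (hy : 0 < y) (hh : 0 < h) : reach x y h < x := by
  rw [reach, Real.sqrt_lt' hx]; nlinarith

theorem reach_le {x y h : ℝ} (hx : 0 < x) (hy : 0 < y) (hh : 0 ≤ h) : reach x y h ≤ x := by
  rw [reach, Real.sqrt_le_iff]; constructor <;> nlinarith

theorem reach_sq {x y h : ℝ} (hh : 0 ≤ y + h) (hH : h ≤ √(x ^ 2 + y ^ 2) - y) :
    reach x y h ^ 2 + (y + h) ^ 2 = x ^ 2 + y ^ 2 := by
  rw [reach, Real.sq_sqrt]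
  · ring
  · have h1 : y + h ≤ √(x ^ 2 + y ^ 2) := by linarith
    have := Real.le_sqrt' (x := y + h) (y := x ^ 2 + y ^ 2)
    have h2 : (y + h) ^ 2 ≤ √(x ^ 2 + y ^ 2) ^ 2 := by gcongr
    rw [Real.sq_sqrt (by positivity)] at h2
    linarith

/-- At this descent the end edge is vertical: the base angle has become a right angle. -/
theorem reach_top (x y : ℝ) : reach x y (√(x ^ 2 + y ^ 2) - y) = 0 := by
  rw [reach, show y + (√(x ^ 2 + y ^ 2) - y) = √(x ^ 2 + y ^ 2) by ring,
    Real.sq_sqrt (by positivity)]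
  simp

theorem continuous_reach (x y : ℝ) : Continuous (reach x y) := by
  unfold reach; fun_prop

/-- The first vertex when the base has descended by `h` and the second vertex is at rest at `z`,
to the left of the origin. -/
def leftFoot (z : ℂ) (h : ℝ) : ℂ := ⟨z.re + reach (-z.re) z.im h, -h⟩

/-- The last vertex when the base has descended by `h` and the vertex before it is at rest at `z`,
to the right of `b`. -/
def rightFoot (b : ℝ) (z : ℂ) (h : ℝ) : ℂ := ⟨z.re - reach (z.re - b) z.im h, -h⟩

/-- The chain `p 0, …, p k` with both ends replaced. -/
def setEnds (k : ℕ) (q x : ℂ) (p : ℕ → ℂ) : ℕ → ℂ := fun j =>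
  if j = 0 then q else if j = k then x else p j

theorem setEnds_zero (k : ℕ) (q x : ℂ) (p : ℕ → ℂ) : setEnds k q x p 0 = q := rfl

theorem setEnds_last {k : ℕ} (hk : 0 < k) (q x : ℂ) (p : ℕ → ℂ) : setEnds k q x p k = x := by
  simp [setEnds, hk.ne']

theorem setEnds_mid {k j : ℕ} (h0 : 0 < j) (hj : j < k) (q x : ℂ) (p : ℕ → ℂ) :
    setEnds k q x p j = p j := by
  simp [setEnds, h0.ne', hj.ne]

theorem continuous_leftFoot (z : ℂ) : Continuous (leftFoot z) := by
  have : leftFoot z = fun h => ((z.re + reach (-z.re) z.im h : ℝ) : ℂ) + ((-h : ℝ) : ℂ) * Complex.I := by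
    funext h; apply Complex.ext <;> simp [leftFoot]
  rw [this]
  have := continuous_reach (-z.re) z.im
  fun_prop

theorem continuous_rightFoot (b : ℝ) (z : ℂ) : Continuous (rightFoot b z) := by
  have : rightFoot b z =
      fun h => ((z.re - reach (z.re - b) z.im h : ℝ) : ℂ) + ((-h : ℝ) : ℂ) * Complex.I := by
    funext h; apply Complex.ext <;> simp [rightFoot]
  rw [this]
  have := continuous_reach (z.re - b) z.im
  fun_prop

theorem continuous_cw {f g h : ℝ → ℂ} (hf : Continuous f) (hg : Continuous g) (hh : Continuous h) :
    Continuous fun t => cw (f t) (g t) (h t) := by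
  unfold cw
  exact ((Complex.continuous_im.comp (hg.sub hf)).mul (Complex.continuous_re.comp (hh.sub hf))).sub
    ((Complex.continuous_re.comp (hg.sub hf)).mul (Complex.continuous_im.comp (hh.sub hf)))

/-- An arc with base from `0` to `b > 0` whose base angles are both obtuse. -/
structure ObtuseArc (k : ℕ) (b : ℝ) (p : ℕ → ℂ) : Prop where
  three_le : 3 ≤ k
  pos : 0 < b
  arc : StrictArc k p
  first : p 0 = 0
  last : p k = b
  left : (p 1).re < 0
  right : b < (p (k - 1)).re

namespace ObtuseArc

variable {k : ℕ} {b : ℝ} {p : ℕ → ℂ}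

theorem im_pos (o : ObtuseArc k b p) {j : ℕ} (h0 : 0 < j) (hj : j < k) : 0 < (p j).im := by
  have := o.arc 0 j k h0 hj le_rfl
  rw [o.first, o.last] at this
  simp only [cw, sub_zero, Complex.ofReal_re, Complex.ofReal_im, mul_zero] at this
  exact (pos_iff_pos_of_mul_pos this).2 o.pos

/-- The largest possible descent. -/
def depth (k : ℕ) (b : ℝ) (p : ℕ → ℂ) : ℝ :=
  min (√((-(p 1).re) ^ 2 + (p 1).im ^ 2) - (p 1).im)
    (√(((p (k - 1)).re - b) ^ 2 + (p (k - 1)).im ^ 2) - (p (k - 1)).im)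

theorem depth_pos (o : ObtuseArc k b p) : 0 < depth k b p := by
  have h3 := o.three_le
  have h1 := o.im_pos one_pos (by omega)
  have h2 := o.im_pos (j := k - 1) (by omega) (by omega)
  have := o.left
  have := o.right
  refine lt_min ?_ ?_ <;> rw [sub_pos] <;> apply Real.lt_sqrt_of_sq_lt <;> nlinarith

/-- The chain after the descent by `h`. -/
def descend (k : ℕ) (b : ℝ) (p : ℕ → ℂ) (h : ℝ) : ℕ → ℂ :=
  setEnds k (leftFoot (p 1) h) (rightFoot b (p (k - 1)) h) p

theorem descend_zero (o : ObtuseArc k b p) {j : ℕ} : descend k b p 0 j = p j := by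
  have h3 := o.three_le
  unfold descend setEnds
  have := o.left
  have := o.right
  split_ifs with h1 h2
  · rw [h1, o.first, leftFoot, reach_zero _ (by linarith)]
    apply Complex.ext <;> simp
  · rw [h2, o.last, rightFoot, reach_zero _ (by linarith)]
    apply Complex.ext <;> simp
  · rfl

variable {h : ℝ}

theorem width (o : ObtuseArc k b p) (hh : 0 ≤ h) :
    b ≤ (rightFoot b (p (k - 1)) h).re - (leftFoot (p 1) h).re := by
  have h3 := o.three_le
  have h1 := reach_le (x := -(p 1).re) (h := h) (by linarith [o.left]) (o.im_pos one_pos (by omega)) hh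
  have h2 := reach_le (x := (p (k - 1)).re - b) (h := h) (by linarith [o.right])
    (o.im_pos (j := k - 1) (by omega) (by omega)) hh
  simp only [rightFoot, leftFoot]; linarith

theorem width_lt (o : ObtuseArc k b p) (hh : 0 < h) :
    b < (rightFoot b (p (k - 1)) h).re - (leftFoot (p 1) h).re := by
  have h3 := o.three_le
  have h1 := reach_lt (x := -(p 1).re) (h := h) (by linarith [o.left]) (o.im_pos one_pos (by omega)) hh
  have h2 := reach_lt (x := (p (k - 1)).re - b) (h := h) (by linarith [o.right])
    (o.im_pos (j := k - 1) (by omega) (by omega)) hh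
  simp only [rightFoot, leftFoot]; linarith

/-- Both feet are at height `-h`, so twice the area is the height over the base times the width. -/
theorem cw_base (o : ObtuseArc k b p) (hh : 0 ≤ h) {j : ℕ} (h0 : 0 < j) (hj : j < k) :
    0 < cw (leftFoot (p 1) h) (p j) (rightFoot b (p (k - 1)) h) := by
  have e : cw (leftFoot (p 1) h) (p j) (rightFoot b (p (k - 1)) h) =
      ((p j).im + h) * ((rightFoot b (p (k - 1)) h).re - (leftFoot (p 1) h).re) := by
    simp only [cw, Complex.sub_re, Complex.sub_im, leftFoot, rightFoot]; ring
  rw [e]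
  have := o.width hh
  have := o.im_pos h0 hj
  have := o.pos
  exact mul_pos (by linarith) (by linarith)

/-- The bend at the second vertex. -/
def bend₁ (p : ℕ → ℂ) (h : ℝ) : ℝ := cw (leftFoot (p 1) h) (p 1) (p 2)

/-- The bend at the last but one vertex. -/
def bend₂ (k : ℕ) (b : ℝ) (p : ℕ → ℂ) (h : ℝ) : ℝ :=
  cw (p (k - 2)) (p (k - 1)) (rightFoot b (p (k - 1)) h)

theorem bend₁_eq (p : ℕ → ℂ) (h : ℝ) : bend₁ p h =
    ((p 1).im + h) * (p 2 - p 1).re + reach (-(p 1).re) (p 1).im h * (p 2 - p 1).im := by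
  simp only [bend₁, cw, leftFoot, Complex.sub_re, Complex.sub_im]; ring

theorem bend₂_eq (k : ℕ) (b : ℝ) (p : ℕ → ℂ) (h : ℝ) : bend₂ k b p h =
    ((p (k - 1)).im + h) * (p (k - 1) - p (k - 2)).re -
      reach ((p (k - 1)).re - b) (p (k - 1)).im h * (p (k - 1) - p (k - 2)).im := by
  simp only [bend₂, cw, rightFoot, Complex.sub_re, Complex.sub_im]; ring

theorem bend₁_zero (o : ObtuseArc k b p) : 0 < bend₁ p 0 := by
  have h3 := o.three_le
  have := o.descend_zero (j := 0)
  rw [descend, setEnds_zero] at this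
  rw [bend₁, this]
  exact o.arc 0 1 2 (by omega) (by omega) (by omega)

theorem bend₂_zero (o : ObtuseArc k b p) : 0 < bend₂ k b p 0 := by
  have h3 := o.three_le
  have := o.descend_zero (j := k)
  rw [descend, setEnds_last (by omega)] at this
  rw [bend₂, this]
  exact o.arc (k - 2) (k - 1) k (by omega) (by omega) le_rfl

/-- The first edge runs up to the left; if the second does not rise, the clockwise bend between them
makes it run to the right. -/
theorem re_pos_of_im_nonpos (o : ObtuseArc k b p) (he : (p 2 - p 1).im ≤ 0) :
    0 < (p 2 - p 1).re := by
  have h3 := o.three_le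
  have h1 := o.bend₁_zero
  rw [bend₁_eq, add_zero, reach_zero _ (by linarith [o.left])] at h1
  have h2 := o.im_pos one_pos (by omega)
  have := o.left
  by_contra! hle
  nlinarith

/-- If the second edge rises, moving the left foot horizontally to the right foot increases the
quantity, so it is larger than the bend at `p 1`. Otherwise that edge runs to the right; comparing
the right foot with `p (k - 1)`, which it lies below and not to the right of, gives only terms of
the right sign. -/
theorem cw_second (o : ObtuseArc k b p) (hh : 0 ≤ h) (h1 : 0 ≤ bend₁ p h) :
    0 < cw (p 1) (p 2) (rightFoot b (p (k - 1)) h) := by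
  have h3 := o.three_le
  have hw := o.width hh
  have hb := o.pos
  rcases lt_or_ge 0 (p 2 - p 1).im with he | he
  · have e : cw (p 1) (p 2) (rightFoot b (p (k - 1)) h) = bend₁ p h +
        (p 2 - p 1).im * ((rightFoot b (p (k - 1)) h).re - (leftFoot (p 1) h).re) := by
      simp only [bend₁, cw, Complex.sub_re, Complex.sub_im, leftFoot, rightFoot]; ring
    rw [e]
    have := mul_pos he (show 0 < (rightFoot b (p (k - 1)) h).re - (leftFoot (p 1) h).re by linarith)
    linarith
  · have hre := o.re_pos_of_im_nonpos he
    have e : cw (p 1) (p 2) (rightFoot b (p (k - 1)) h) = cw (p 1) (p 2) (p (k - 1)) -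
        (p 2 - p 1).im * reach ((p (k - 1)).re - b) (p (k - 1)).im h +
        (p 2 - p 1).re * ((p (k - 1)).im + h) := by
      simp only [cw, Complex.sub_re, Complex.sub_im, rightFoot]; ring
    rw [e]
    have i1 := (o.arc.weakArc (by omega)).tri 1 2 (k - 1) (by omega) (by omega) (by omega)
    have i2 := mul_pos hre (show 0 < (p (k - 1)).im + h by
      linarith [o.im_pos (j := k - 1) (by omega) (by omega)])
    have i3 := mul_nonneg (neg_nonneg.2 he) (reach_nonneg ((p (k - 1)).re - b) (p (k - 1)).im h)
    linarith

/-- The chord from `p 1` to `p (k - 1)` covers a greater horizontal distance than the last edge and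
rises by less than the last edge falls. -/
theorem cw_penult (o : ObtuseArc k b p) (hh : 0 ≤ h) :
    0 < cw (p 1) (p (k - 1)) (rightFoot b (p (k - 1)) h) := by
  have h3 := o.three_le
  have hb := o.pos
  have hl := o.left
  have hr := o.right
  have y1 := o.im_pos one_pos (by omega)
  have y2 := o.im_pos (j := k - 1) (by omega) (by omega)
  have r1 := reach_le (h := h) (sub_pos.2 hr) y2 hh
  have r0 := reach_nonneg ((p (k - 1)).re - b) (p (k - 1)).im h
  have e : cw (p 1) (p (k - 1)) (rightFoot b (p (k - 1)) h) =
      ((p (k - 1)).re - (p 1).re) * ((p (k - 1)).im + h) -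
      ((p (k - 1)).im - (p 1).im) * reach ((p (k - 1)).re - b) (p (k - 1)).im h := by
    simp only [cw, Complex.sub_re, Complex.sub_im, rightFoot]; ring
  rw [e]
  have i1 : ((p (k - 1)).im - (p 1).im) * reach ((p (k - 1)).re - b) (p (k - 1)).im h ≤
      (p (k - 1)).im * ((p (k - 1)).re - b) := by
    refine (mul_le_mul_of_nonneg_right (by linarith : _ ≤ (p (k - 1)).im) r0).trans ?_
    exact mul_le_mul_of_nonneg_left r1 y2.le
  nlinarith [mul_pos y2 (show 0 < b - (p 1).re by linarith),
    mul_nonneg hh (show 0 ≤ (p (k - 1)).re - (p 1).re by linarith)]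

/-- A vanishing bend could also mean a fold. This is excluded because the second edge must rise:
otherwise the bend would never drop below its positive initial value. -/
theorem straight₁ (o : ObtuseArc k b p) (hh : 0 ≤ h) (h1 : bend₁ p h = 0) :
    ∃ ρ : ℝ, 0 < ρ ∧ p 1 - leftFoot (p 1) h = ρ • (p 2 - p 1) := by
  have h3 := o.three_le
  have y1 := o.im_pos one_pos (by omega)
  have he : 0 < (p 2 - p 1).im := by
    by_contra! he
    have hre := o.re_pos_of_im_nonpos he
    have h0 := o.bend₁_zero
    rw [bend₁_eq, add_zero, reach_zero _ (by linarith [o.left])] at h0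
    have hr := reach_le (x := -(p 1).re) (h := h) (by linarith [o.left]) y1 hh
    rw [bend₁_eq] at h1
    nlinarith
  rw [bend₁_eq] at h1
  refine ⟨((p 1).im + h) / (p 2 - p 1).im, by positivity, ?_⟩
  apply Complex.ext
  · rw [Complex.smul_re, smul_eq_mul]
    simp only [leftFoot, Complex.sub_re] at h1 ⊢
    field_simp
    linarith
  · rw [Complex.smul_im, smul_eq_mul, div_mul_cancel₀ _ he.ne']
    simp [leftFoot]

/-- As on the left: the last inner edge must fall, since otherwise the bend could not decrease to
zero. -/
theorem straight₂ (o : ObtuseArc k b p) (hh : 0 ≤ h) (h2 : bend₂ k b p h = 0) :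
    ∃ ρ : ℝ, 0 < ρ ∧
      rightFoot b (p (k - 1)) h - p (k - 1) = ρ • (p (k - 1) - p (k - 2)) := by
  have h3 := o.three_le
  have y2 := o.im_pos (j := k - 1) (by omega) (by omega)
  have h0 := o.bend₂_zero
  have hrt := o.right
  have hr := reach_le (h := h) (sub_pos.2 hrt) y2 hh
  rw [bend₂_eq, add_zero, reach_zero _ (by linarith)] at h0
  rw [bend₂_eq] at h2
  have he : (p (k - 1) - p (k - 2)).im < 0 := by
    by_contra! he
    have hre : 0 < (p (k - 1) - p (k - 2)).re := by
      by_contra! hle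
      nlinarith
    nlinarith
  refine ⟨((p (k - 1)).im + h) / -(p (k - 1) - p (k - 2)).im, div_pos (by linarith) (by linarith), ?_⟩
  apply Complex.ext
  · rw [Complex.smul_re, smul_eq_mul]
    simp only [rightFoot, Complex.sub_re] at h2 ⊢
    have := he.ne
    field_simp
    linarith
  · rw [Complex.smul_im, smul_eq_mul, div_neg, neg_mul, div_mul_cancel₀ _ he.ne]
    simp [rightFoot]; ring

theorem chainPath (o : ObtuseArc k b p) {H : ℝ} (hH : 0 ≤ H) (hHd : H ≤ depth k b p) :
    ChainPath k p fun t => descend k b p (t * H) := by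
  have h3 := o.three_le
  have hc : Continuous fun t : ℝ => t * H := by fun_prop
  refine ⟨fun j hj => ?_, fun j hj => ?_, fun t ht j hj => ?_⟩
  · rcases Nat.eq_zero_or_pos j with rfl | h0
    · exact ((continuous_leftFoot _).comp hc).continuousOn
    · rcases hj.lt_or_eq with hj | rfl
      · simp only [descend, setEnds_mid h0 hj]; exact continuousOn_const
      · simp only [descend, setEnds_last h0]
        exact ((continuous_rightFoot _ _).comp hc).continuousOn
  · rw [zero_mul]; exact o.descend_zero
  · have hs : 0 ≤ t * H := mul_nonneg ht.1 hH
    have hsd : t * H ≤ depth k b p := (mul_le_of_le_one_left hH ht.2).trans hHd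
    have d1 := hsd.trans (min_le_left _ _)
    have d2 := hsd.trans (min_le_right _ _)
    unfold descend
    generalize t * H = s at *
    rcases Nat.eq_zero_or_pos j with rfl | h0
    · rw [setEnds_zero, zero_add, setEnds_mid one_pos (by omega), o.first, dist_eq_norm,
        dist_eq_norm]
      have := reach_sq (x := -(p 1).re) (h := s) (by linarith [o.im_pos one_pos (by omega)]) d1
      rw [← sq_eq_sq₀ (norm_nonneg _) (norm_nonneg _), ← dt_self, ← dt_self]
      simp only [dt, leftFoot, Complex.sub_re, Complex.sub_im, Complex.zero_re, Complex.zero_im]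
      nlinarith
    · rcases (show j + 1 ≤ k by omega).lt_or_eq with hj1 | rfl
      · rw [setEnds_mid h0 hj, setEnds_mid (by omega) hj1]
      · rw [setEnds_mid h0 hj, setEnds_last (by omega), o.last, dist_eq_norm, dist_eq_norm]
        simp only [Nat.add_sub_cancel] at d2 ⊢
        have := reach_sq (h := s) (by linarith [o.im_pos h0 (by omega)]) d2
        rw [← sq_eq_sq₀ (norm_nonneg _) (norm_nonneg _), ← dt_self, ← dt_self]
        simp only [dt, rightFoot, Complex.sub_re, Complex.sub_im, Complex.ofReal_re,
          Complex.ofReal_im]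
        nlinarith

end ObtuseArc

end Arch
end

noncomputable section

namespace Arch

open Set

/-! ### The induction for arcs with two obtuse base angles -/

/-- Closing a strictly convex arc in front with a vertex at which it may be straight. -/
theorem StrictArc.front_or_drop {k : ℕ} {c : ℕ → ℂ} (hk : 2 ≤ k)
    (h : StrictArc (k - 1) fun j => c (j + 1)) (h0 : 0 < cw (c 0) (c 1) (c k))
    (h1 : 0 ≤ cw (c 0) (c 1) (c 2)) (h2 : 0 < cw (c 0) (c (k - 1)) (c k))
    (hs : cw (c 0) (c 1) (c 2) = 0 → ∃ ρ : ℝ, 0 < ρ ∧ c 1 - c 0 = ρ • (c 2 - c 1)) :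
    StrictArc k c ∨ ∃ q : ℕ → ℂ, 3 ≤ k ∧ StrictArc (k - 1) q ∧
      ∃ r : ℝ, 0 < r ∧ r < 1 ∧ ∀ j, c j = insertAt 1 r q j := by
  rcases h1.lt_or_eq with h1 | h1
  · left
    obtain ⟨m, rfl⟩ : ∃ m, k = m + 1 := ⟨k - 1, by omega⟩
    exact StrictArc.front (by omega) h h0 h1 h2
  · right
    obtain ⟨ρ, hρ, he⟩ := hs h1.symm
    have hk3 : 3 ≤ k := by
      by_contra hlt
      obtain rfl : k = 2 := by omega
      rw [← h1] at h0; exact h0.false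
    obtain ⟨q, hq, -, -, r, hr0, hr1, hr⟩ := StrictArc.drop_second hk3 h hρ he h2
    exact ⟨q, hk3, hq, r, hr0, hr1, hr⟩

theorem openable_of_strict_or {k : ℕ} {c : ℕ → ℂ} (hk : 2 ≤ k)
    (ih : ∀ m ≤ k, 2 ≤ m → ∀ q : ℕ → ℂ, StrictArc m q → Openable m q)
    (h : StrictArc k c ∨ ∃ q : ℕ → ℂ, 3 ≤ k ∧ StrictArc (k - 1) q ∧
      ∃ r : ℝ, 0 < r ∧ r < 1 ∧ ∀ j, c j = insertAt 1 r q j) : WArc k c ∧ Openable k c := by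
  rcases h with h | ⟨q, hk3, hq, r, hr0, hr1, hr⟩
  · exact ⟨.core hk h, ih k le_rfl hk c h⟩
  · obtain ⟨m, rfl⟩ : ∃ m, k = m + 1 := ⟨k - 1, by omega⟩
    rw [Nat.add_sub_cancel] at hq
    exact ⟨.ins 1 r (.core (by omega) hq) le_rfl (by omega) hr0 hr1 fun l _ => hr l,
      ((ih m (by omega) (by omega) q hq).insertAt le_rfl (by omega) hr0 hr1).congr fun l _ => hr l⟩

namespace ObtuseArc

variable {k : ℕ} {b : ℝ} {p : ℕ → ℂ} {h : ℝ}

theorem middle (o : ObtuseArc k b p) : StrictArc (k - 2) fun j => p (j + 1) :=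
  fun a b c hab hbc hc => o.arc _ _ _ (by omega) (by omega) (by have := o.three_le; omega)

/-- The inner vertices are at rest, so only the triples that contain the right foot are new. At the
left, `bend₁` may vanish already, because the left foot is not part of this tail. -/
theorem descend_tail (o : ObtuseArc k b p) (hh : 0 ≤ h) (h1 : 0 ≤ bend₁ p h)
    (h2 : 0 < bend₂ k b p h) : StrictArc (k - 1) fun j => descend k b p h (j + 1) := by
  have h3 := o.three_le
  obtain ⟨m, rfl⟩ : ∃ m, k = m + 3 := ⟨k - 3, by omega⟩
  have em : ∀ j, j ≤ m + 1 → descend (m + 3) b p h (j + 1) = p (j + 1) := fun j hj =>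
    setEnds_mid (by omega) (by omega) _ _ _
  have el : descend (m + 3) b p h (m + 1 + 1 + 1) = rightFoot b (p (m + 2)) h :=
    setEnds_last (by omega) _ _ _
  refine StrictArc.snoc (k := m + 1) (by omega) (o.middle.congr fun j hj => em j (by omega)) ?_ ?_ ?_
  · rw [em 0 (by omega), em (m + 1) le_rfl, el]; exact o.cw_penult hh
  · rw [em 0 (by omega), em 1 (by omega), el]; exact o.cw_second hh h1
  · rw [em (m + 1 - 1) (by omega), em (m + 1) le_rfl, el]; exact h2

theorem descend_second (o : ObtuseArc k b p) : descend k b p h 1 = p 1 :=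
  setEnds_mid one_pos (by have := o.three_le; omega) _ _ _

theorem descend_strict_or (o : ObtuseArc k b p) (hh : 0 ≤ h) (h1 : 0 ≤ bend₁ p h)
    (h2 : 0 < bend₂ k b p h) :
    StrictArc k (descend k b p h) ∨ ∃ q : ℕ → ℂ, 3 ≤ k ∧ StrictArc (k - 1) q ∧
      ∃ r : ℝ, 0 < r ∧ r < 1 ∧ ∀ j, descend k b p h j = insertAt 1 r q j := by
  have h3 := o.three_le
  have e0 : descend k b p h 0 = leftFoot (p 1) h := rfl
  have e1 : descend k b p h 1 = p 1 := setEnds_mid (by omega) (by omega) _ _ _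
  have e2 : descend k b p h 2 = p 2 := setEnds_mid (by omega) (by omega) _ _ _
  have e3 : descend k b p h (k - 1) = p (k - 1) := setEnds_mid (by omega) (by omega) _ _ _
  have e4 : descend k b p h k = rightFoot b (p (k - 1)) h := setEnds_last (by omega) _ _ _
  refine StrictArc.front_or_drop (by omega) (o.descend_tail hh h1 h2) ?_ ?_ ?_ ?_
  · rw [e0, e1, e4]; exact o.cw_base hh one_pos (by omega)
  · rw [e0, e1, e2]; exact h1
  · rw [e0, e3, e4]; exact o.cw_base hh (by omega) (by omega)
  · rw [e0, e1, e2]; exact o.straight₁ hh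

theorem descend_strict (o : ObtuseArc k b p) (hh : 0 ≤ h) (h1 : 0 < bend₁ p h)
    (h2 : 0 < bend₂ k b p h) : StrictArc k (descend k b p h) := by
  have h3 := o.three_le
  obtain ⟨m, rfl⟩ : ∃ m, k = m + 1 := ⟨k - 1, by omega⟩
  have e0 : descend (m + 1) b p h 0 = leftFoot (p 1) h := rfl
  have e1 : descend (m + 1) b p h 1 = p 1 := setEnds_mid (by omega) (by omega) _ _ _
  have e2 : descend (m + 1) b p h 2 = p 2 := setEnds_mid (by omega) (by omega) _ _ _
  have e3 : descend (m + 1) b p h m = p m := setEnds_mid (by omega) (by omega) _ _ _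
  have e4 : descend (m + 1) b p h (m + 1) = rightFoot b (p m) h := setEnds_last (by omega) _ _ _
  refine StrictArc.front (by omega) (o.descend_tail hh h1.le h2) ?_ ?_ ?_
  · rw [e0, e1, e4]; exact o.cw_base hh one_pos (by omega)
  · rw [e0, e1, e2]; exact h1
  · rw [e0, e3, e4]; exact o.cw_base hh (by omega) (by omega)

/-- The straight joint before the last vertex is dropped. The joint at `p 1` may become straight at
the same moment, which `StrictArc.front_or_drop` allows for. -/
theorem openable_descend_of_straight₂ (o : ObtuseArc k b p) (hh : 0 ≤ h) (h1 : 0 ≤ bend₁ p h)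
    (h2 : bend₂ k b p h = 0)
    (ih : ∀ m < k, 2 ≤ m → ∀ q : ℕ → ℂ, StrictArc m q → Openable m q) :
    WArc k (descend k b p h) ∧ Openable k (descend k b p h) := by
  have h3 := o.three_le
  -- For `k = 3` the second bend is the triple that `cw_second` shows to be positive.
  have hk4 : 4 ≤ k := by
    by_contra hlt
    obtain rfl : k = 3 := by omega
    have := o.cw_second hh h1
    rw [bend₂] at h2
    simp only [show 3 - 2 = 1 by norm_num, show 3 - 1 = 2 by norm_num] at h2 this
    rw [h2] at this; exact this.false
  obtain ⟨m, rfl⟩ : ∃ m, k = m + 4 := ⟨k - 4, by omega⟩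
  set x := rightFoot b (p (m + 3)) h with hx
  set c := descend (m + 4) b p h with hc
  have e0 : c 0 = leftFoot (p 1) h := rfl
  have em : ∀ j, 0 < j → j < m + 4 → c j = p j := fun j h0 hj => setEnds_mid h0 hj _ _ _
  have el : c (m + 4) = x := setEnds_last (by omega) _ _ _
  obtain ⟨ρ, hρ, hst⟩ := o.straight₂ hh h2
  obtain ⟨q, hq, hqm, hql, r, hr0, hr1, hr⟩ := StrictArc.drop_penult (k := m + 3)
    (p := fun j => c (j + 1)) (by omega)
    (o.middle.congr fun j hj => em (j + 1) (by omega) (by omega)) hρ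
    (by
      simp only [show m + 3 - 1 + 1 = m + 3 by omega, show m + 3 - 2 + 1 = m + 2 by omega]
      rw [el, em (m + 3) (by omega) (by omega), em (m + 2) (by omega) (by omega)]; exact hst)
    (by
      rw [el, em (0 + 1) (by omega) (by omega), em (1 + 1) (by omega) (by omega)]
      exact o.cw_second hh h1)
  simp only [show m + 3 - 1 = m + 2 by omega] at hq hqm hql hr
  -- The joint was dropped from the tail only, because the full chain need not be strict; here the
  -- first vertex is put back, which shifts the positions by one.
  set d : ℕ → ℂ := fun j => if j = 0 then c 0 else q (j - 1) with hd
  have d0 : d 0 = leftFoot (p 1) h := rfl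
  have dm : ∀ j, 0 < j → j < m + 3 → d j = p j := by
    intro j h0 hj
    simp only [hd, h0.ne', if_false]
    rw [hqm _ (by omega), Nat.sub_add_cancel h0, em j h0 (by omega)]
  have dl : d (m + 3) = x := by
    simp only [hd, Nat.succ_ne_zero, if_false]
    rw [show m + 3 - 1 = m + 2 by omega, hql, el]
  have hcd : ∀ l ≤ m + 4, c l = insertAt (m + 3) r d l := by
    intro l hl
    rcases Nat.eq_zero_or_pos l with rfl | hl0
    · rw [insertAt_lt _ _ (by omega)]; rfl
    · have := hr (l - 1) (by omega)
      simp only [Nat.sub_add_cancel hl0] at this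
      rw [this]
      simp only [insertAt, hd]
      rcases lt_trichotomy l (m + 3) with h' | h' | h'
      · rw [if_pos (by omega), if_pos h', if_neg (by omega)]
      · rw [if_neg (by omega), if_pos (by omega), if_neg (by omega), if_pos h', if_neg (by omega),
          if_neg (by omega)]
        rfl
      · rw [if_neg (by omega), if_neg (by omega), if_neg (by omega), if_neg (by omega),
          if_neg (by omega)]
  have hdc := StrictArc.front_or_drop (k := m + 3) (c := d) (by omega)
    (hq.congr fun j hj => by simp [hd])
    (by rw [d0, dl, dm 1 one_pos (by omega)]; exact o.cw_base hh one_pos (by omega))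
    (by rw [d0, dm 1 one_pos (by omega), dm 2 two_pos (by omega)]; exact h1)
    (by
      rw [d0, dl, dm (m + 3 - 1) (by omega) (by omega)]
      exact o.cw_base hh (by omega) (by omega))
    (by rw [d0, dm 1 one_pos (by omega), dm 2 two_pos (by omega)]; exact o.straight₁ hh)
  obtain ⟨w1, w2⟩ := openable_of_strict_or (by omega)
    (fun m' hm' h2 q hq => ih m' (by omega) h2 q hq) hdc
  exact ⟨.ins (m + 3) r w1 (by omega) le_rfl hr0 hr1 hcd,
    (w2.insertAt (by omega) le_rfl hr0 hr1).congr hcd⟩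

/-- The foot that limits `depth` is then vertically below its neighbour, so one base angle is a
right angle and the acute case applies. -/
theorem openable_descend_depth (o : ObtuseArc k b p)
    (h : StrictArc k (descend k b p (depth k b p))) : Openable k (descend k b p (depth k b p)) := by
  have h3 := o.three_le
  have e1 : descend k b p (depth k b p) 1 = p 1 := setEnds_mid (by omega) (by omega) _ _ _
  have e3 : descend k b p (depth k b p) (k - 1) = p (k - 1) := setEnds_mid (by omega) (by omega) _ _ _
  have e4 : descend k b p (depth k b p) k = rightFoot b (p (k - 1)) (depth k b p) :=
    setEnds_last (by omega) _ _ _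
  have e0 : descend k b p (depth k b p) 0 = leftFoot (p 1) (depth k b p) := rfl
  rcases le_total (√((-(p 1).re) ^ 2 + (p 1).im ^ 2) - (p 1).im)
    (√(((p (k - 1)).re - b) ^ 2 + (p (k - 1)).im ^ 2) - (p (k - 1)).im) with hle | hle
  · refine h.openable_of_acute (by omega) ?_
    rw [e0, e1, e4]
    have := reach_top (-(p 1).re) (p 1).im
    rw [← show depth k b p = _ from min_eq_left hle] at this
    simp [dt, leftFoot, rightFoot, this]
  · refine h.openable_of_acute_last (by omega) ?_
    rw [e0, e3, e4]
    have := reach_top ((p (k - 1)).re - b) (p (k - 1)).im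
    rw [← show depth k b p = _ from min_eq_right hle] at this
    simp [dt, leftFoot, rightFoot, this]

/-- The base descends until a bend vanishes or the full depth is reached. Before that both bends are
positive, the chain is strictly convex and the base is wider than `b`. A vanished bend leaves a core
with fewer edges; full depth gives a right angle. -/
theorem openable (o : ObtuseArc k b p)
    (ih : ∀ m < k, 2 ≤ m → ∀ q : ℕ → ℂ, StrictArc m q → Openable m q) : Openable k p := by
  have h3 := o.three_le
  have c1 : Continuous (bend₁ p) := continuous_cw (continuous_leftFoot _) continuous_const continuous_const
  have c2 : Continuous (bend₂ k b p) :=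
    continuous_cw continuous_const continuous_const (continuous_rightFoot _ _)
  obtain ⟨H, hH0, hHd, hpos, hnn, hor⟩ := exists_first_zero (f := fun h => min (bend₁ p h) (bend₂ k b p h))
    o.depth_pos (c1.min c2).continuousOn (lt_min o.bend₁_zero o.bend₂_zero)
  have hn1 := hnn.trans (min_le_left _ _)
  have hn2 := hnn.trans (min_le_right _ _)
  have hend : WArc k (descend k b p H) ∧ Openable k (descend k b p H) := by
    rcases hn2.lt_or_eq with h2 | h2
    · rcases hn1.lt_or_eq with h1 | h1
      · rcases hor with rfl | h0
        · have := o.descend_strict hH0.le h1 h2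
          exact ⟨.core (by omega) this, o.openable_descend_depth this⟩
        · exact absurd h0 (lt_min h1 h2).ne'
      · have := o.descend_strict_or hH0.le hn1 h2
        rcases this with hs | ⟨q, -, hq, r, hr0, hr1, hr⟩
        · have := hs 0 1 2 (by omega) (by omega) (by omega)
          rw [o.descend_second, show descend k b p H 0 = leftFoot (p 1) H from rfl,
            show descend k b p H 2 = p 2 from setEnds_mid (by omega) (by omega) _ _ _] at this
          exact absurd h1 this.ne
        · obtain ⟨m, rfl⟩ : ∃ m, k = m + 1 := ⟨k - 1, by omega⟩
          rw [Nat.add_sub_cancel] at hq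
          exact ⟨.ins 1 r (.core (by omega) hq) le_rfl (by omega) hr0 hr1 fun l _ => hr l,
            ((ih m (by omega) (by omega) q hq).insertAt le_rfl (by omega) hr0 hr1).congr
              fun l _ => hr l⟩
    · exact o.openable_descend_of_straight₂ hH0.le hn1 h2.symm ih
  refine Openable.trans (o.chainPath hH0.le hHd) (fun t ht => ?_) (fun t ht => ?_)
    (fun j _ => by rw [one_mul]) hend.2
  · have hs : 0 < t * H := mul_pos ht.1 hH0
    have hw := o.width_lt hs
    rw [o.first, o.last, descend, setEnds_zero, setEnds_last (by omega), dist_comm, dist_eq_norm,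
      sub_zero, Complex.norm_of_nonneg o.pos.le, dist_comm, dist_eq_norm]
    refine hw.trans_le ?_
    rw [← Complex.sub_re]
    exact Complex.re_le_norm _
  · rcases ht.2.lt_or_eq with ht1 | rfl
    · have hs : t * H < H := by nlinarith
      have := hpos (t * H) (mul_nonneg ht.1 hH0.le) hs
      exact .core (by omega) (o.descend_strict (mul_nonneg ht.1 hH0.le)
        (this.trans_le (min_le_left _ _)) (this.trans_le (min_le_right _ _)))
    · rw [one_mul]; exact hend.1

end ObtuseArc

/-- Every strictly convex arc can be opened. -/
theorem StrictArc.openable {k : ℕ} (hk : 2 ≤ k) {p : ℕ → ℂ} (h : StrictArc k p) : Openable k p := by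
  induction k using Nat.strong_induction_on generalizing p with
  | _ k ih =>
  have hne : p k - p 0 ≠ 0 := sub_ne_zero.2 ((h.weakArc hk).ends_ne hk)
  set b := ‖p k - p 0‖ with hb
  have hb0 : 0 < b := norm_pos_iff.2 hne
  -- The rotation that carries the base to the positive real axis.
  set u : ℂ := (starRingEnd ℂ) (p k - p 0) / b with hu
  have hu1 : ‖u‖ = 1 := by
    rw [hu, norm_div, Complex.norm_conj, ← hb, Complex.norm_of_nonneg hb0.le, div_self hb0.ne']
  refine Openable.of_rigid (w := -(u * p 0)) hu1 ?_
  have h' : StrictArc k fun j => u * p j + -(u * p 0) := h.rigid _ hu1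
  have e0 : u * p 0 + -(u * p 0) = 0 := by ring
  have ek : u * p k + -(u * p 0) = b := by
    have : (starRingEnd ℂ) (p k - p 0) * (p k - p 0) = (b : ℂ) ^ 2 := by
      rw [mul_comm, Complex.mul_conj, Complex.normSq_eq_norm_sq, ← hb]; push_cast; ring
    have hbc : (b : ℂ) ≠ 0 := by exact_mod_cast hb0.ne'
    rw [← sub_eq_add_neg, ← mul_sub, hu, div_mul_eq_mul_div, this]
    field_simp
  set q : ℕ → ℂ := fun j => u * p j + -(u * p 0) with hq
  by_cases ha : 0 ≤ dt (q 1 - q 0) (q k - q 0)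
  · exact h'.openable_of_acute hk ha
  by_cases ha' : 0 ≤ dt (q (k - 1) - q k) (q 0 - q k)
  · exact h'.openable_of_acute_last hk ha'
  have q0 : q 0 = 0 := e0
  have qk : q k = b := ek
  rw [q0, qk] at ha ha'
  simp only [dt, sub_zero, zero_sub, Complex.sub_re, Complex.neg_re, Complex.neg_im, Complex.ofReal_re,
    Complex.ofReal_im, neg_zero, mul_zero, add_zero, not_le] at ha ha'
  have hl : (q 1).re < 0 := by nlinarith
  have hr : b < (q (k - 1)).re := by nlinarith
  have hk3 : 3 ≤ k := by
    by_contra hlt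
    obtain rfl : k = 2 := by omega
    simp only [show 2 - 1 = 1 by norm_num] at hr
    linarith
  exact ObtuseArc.openable ⟨hk3, hb0, h', q0, qk, hl, hr⟩ fun m hm h2 q hq => ih m hm h2 hq

theorem WArc.openable {k : ℕ} {p : ℕ → ℂ} (h : WArc k p) : Openable k p := by
  induction h with
  | core hk h => exact h.openable hk
  | ins j r h h1 h2 h3 h4 h5 ih => exact (ih.insertAt h1 h2 h3 h4).congr h5

end Arch
end

noncomputable section

namespace Arch

open Set Filter Topology

/-! ### Closing an arc slightly -/

/-- The chain can be deformed, through convex arcs, to shorter bases. -/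
def Closable (k : ℕ) (p : ℕ → ℂ) : Prop :=
  ∃ P : ℝ → ℕ → ℂ, ChainPath k p P ∧
    (∀ t ∈ Ioc (0 : ℝ) 1, dist (P t 0) (P t k) < dist (p 0) (p k)) ∧
    ∀ t ∈ Icc (0 : ℝ) 1, WArc k (P t)

theorem Closable.congr {k : ℕ} {p q : ℕ → ℂ} (h : Closable k p) (e : ∀ j ≤ k, q j = p j) :
    Closable k q := by
  obtain ⟨P, hP, h1, h2⟩ := h
  refine ⟨P, ⟨hP.cont, fun j hj => (hP.zero j hj).trans (e j hj).symm, fun t ht j hj => ?_⟩,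
    fun t ht => ?_, h2⟩
  · rw [e j (by omega), e (j + 1) (by omega)]; exact hP.len t ht j hj
  · rw [e 0 (by omega), e k le_rfl]; exact h1 t ht

theorem Closable.insertAt {k : ℕ} {p : ℕ → ℂ} (h : Closable k p) {j : ℕ} {r : ℝ} (hj : 1 ≤ j)
    (hjk : j ≤ k) (hr : 0 < r) (hr1 : r < 1) : Closable (k + 1) (insertAt j r p) := by
  obtain ⟨P, hP, h1, h2⟩ := h
  have e0 : ∀ p, Arch.insertAt j r p 0 = p 0 := fun p => insertAt_lt _ _ (by omega)
  have ek : ∀ p, Arch.insertAt j r p (k + 1) = p k := fun p => insertAt_gt _ _ (by omega)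
  refine ⟨fun t => Arch.insertAt j r (P t), ⟨fun l hl => continuousOn_insertAt hP.cont hjk hl,
    fun l hl => ?_, fun t ht l hl => dist_insertAt r hj (hP.len t ht) hjk hl⟩, fun t ht => ?_,
    fun t ht => .ins j r (h2 t ht) hj hjk hr hr1 fun _ _ => rfl⟩
  · simp only [Arch.insertAt, hP.zero j hjk, hP.zero (j - 1) (by omega)]
    split_ifs
    · exact hP.zero l (by omega)
    · rfl
    · exact hP.zero (l - 1) (by omega)
  · beta_reduce; rw [e0, ek, e0, ek]; exact h1 t ht

/-- The first edge turns slightly away from the second, by `turnTo` at a small negative parameter.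
The triples that make the chain strictly convex stay positive by continuity, and `dt_lt_dt` with the
two positions exchanged shows that the base shrinks. -/
theorem StrictArc.closable {k : ℕ} (hk : 2 ≤ k) {p : ℕ → ℂ} (h : StrictArc k p) : Closable k p := by
  have hz : 0 < br (p 1 - p 0) (p 2 - p 1) := by
    rw [← cw_eq_br']; exact h 0 1 2 (by omega) (by omega) hk
  set q : ℝ → ℂ := fun t => p 1 - turnTo (p 1 - p 0) (p 2 - p 1) (-t) with hq
  have hqc : Continuous q := continuous_const.sub ((continuous_turnTo hz).comp continuous_neg)
  have hq0 : q 0 = p 0 := by simp only [hq, neg_zero, turnTo_zero hz]; ring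
  have ev : ∀ a b, 0 < cw (p 0) a b → ∀ᶠ t in 𝓝 (0 : ℝ), 0 < cw (q t) a b := by
    intro a b hab
    have := (continuous_cw hqc (continuous_const (y := a)) (continuous_const (y := b))).tendsto 0
    rw [hq0] at this
    exact this.eventually (lt_mem_nhds hab)
  have hev := ((ev _ _ (h 0 1 2 (by omega) (by omega) hk)).and
    (ev _ _ (h 0 1 k (by omega) (by omega) le_rfl))).and
    (ev _ _ (h 0 (k - 1) k (by omega) (by omega) le_rfl))
  obtain ⟨ε, hε, hb⟩ := Metric.eventually_nhds_iff.1 hev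
  set η := ε / 2 with hη
  have hη0 : 0 < η := by positivity
  have hin : ∀ t ∈ Icc (0 : ℝ) 1, dist (t * η) 0 < ε := by
    intro t ht
    rw [Real.dist_eq, sub_zero, abs_of_nonneg (mul_nonneg ht.1 hη0.le)]
    nlinarith [ht.2]
  refine ⟨fun t => setFirst (q (t * η)) p, ⟨fun j hj => ?_, fun j hj => ?_, fun t ht j hj => ?_⟩,
    fun t ht => ?_, fun t ht => .core hk ?_⟩
  · rcases Nat.eq_zero_or_pos j with rfl | hj
    · exact (hqc.comp (continuous_id.mul continuous_const)).continuousOn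
    · simp only [setFirst_pos _ _ hj]; exact continuousOn_const
  · rcases Nat.eq_zero_or_pos j with rfl | hj
    · rw [setFirst_zero, zero_mul, hq0]
    · rw [setFirst_pos _ _ hj]
  · rcases Nat.eq_zero_or_pos j with rfl | hj
    · rw [setFirst_zero, zero_add, setFirst_pos _ _ one_pos, dist_comm, dist_eq_norm, sub_sub_cancel,
        norm_turnTo hz, dist_comm, dist_eq_norm]
    · rw [setFirst_pos _ _ hj, setFirst_pos _ _ (by omega)]
  · have hs : 0 < t * η := mul_pos ht.1 hη0
    have hf := (hb (hin t ⟨ht.1.le, ht.2⟩)).1.2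
    beta_reduce
    rw [setFirst_zero, setFirst_pos _ _ (by omega)]
    set s := t * η
    set y := turnTo (p 1 - p 0) (p 2 - p 1) (-s) with hy
    have hqs : q s = p 1 - y := rfl
    rw [hqs] at hf ⊢
    rw [cw_eq_br', sub_sub_cancel] at hf
    have hzd : 0 < br (p 1 - p 0) (p k - p 1) := by
      rw [← cw_eq_br']; exact h 0 1 k (by omega) (by omega) le_rfl
    have hyz : 0 < br y (p 1 - p 0) := by
      rw [hy, br_turnTo, br_self, mul_zero, zero_add]
      refine mul_pos (turnTo_coeff hz _) ?_
      have : br (p 2 - p 1) (p 1 - p 0) = -br (p 1 - p 0) (p 2 - p 1) := by simp only [br]; ring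
      rw [this]; nlinarith
    have hn := dt_turnTo hz (-s)
    have hlt := dt_lt_dt hn.symm hf hzd.le hyz
    rw [dist_comm, dist_comm (p 0), dist_eq_norm, dist_eq_norm,
      show p k - p 0 = (p 1 - p 0) + (p k - p 1) by ring,
      show p k - (p 1 - y) = y + (p k - p 1) by ring]
    apply lt_of_pow_lt_pow_left₀ 2 (norm_nonneg _)
    rw [dt_add_self, dt_add_self, ← hn]
    linarith
  · obtain ⟨⟨f1, f2⟩, f3⟩ := hb (hin t ht)
    obtain ⟨m, rfl⟩ : ∃ m, k = m + 1 := ⟨k - 1, by omega⟩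
    refine StrictArc.front (by omega) h.shift ?_ ?_ ?_
    · simpa [setFirst] using f2
    · simpa [setFirst] using f1
    · simpa [setFirst, show m ≠ 0 by omega] using f3

theorem WArc.closable {k : ℕ} {p : ℕ → ℂ} (h : WArc k p) : Closable k p := by
  induction h with
  | core hk h => exact h.closable hk
  | ins j r h h1 h2 h3 h4 h5 ih => exact (ih.insertAt h1 h2 h3 h4).congr h5

/-! ### The triangle below the base -/

/-- Along the base: position of the foot of the apex of a triangle with sides `D`, `l` over
the base `b`. -/
def footPos (D l b : ℝ) : ℝ := (D ^ 2 + b ^ 2 - l ^ 2) / (2 * b)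

/-- The apex, clockwise after the base `a z`, of the triangle over `a z` with sides `D`, `l`. -/
def apex (D l : ℝ) (a z : ℂ) : ℂ :=
  a + (z - a) / ‖z - a‖ * (⟨footPos D l ‖z - a‖, -√(D ^ 2 - footPos D l ‖z - a‖ ^ 2)⟩ : ℂ)

/-- The strict triangle inequalities make the radicand in `apex` positive, so that the triangle has
positive height. -/
theorem footPos_sq_lt {D l b : ℝ} (hD : 0 < D) (hb : 0 < b) (h1 : |D - l| < b)
    (h2 : b < D + l) : footPos D l b ^ 2 < D ^ 2 := by
  obtain ⟨h3, h4⟩ := abs_lt.1 h1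
  rw [sq_lt_sq, abs_of_pos hD, footPos, abs_div, abs_of_pos (show 0 < 2 * b by positivity),
    div_lt_iff₀ (by positivity), abs_lt]
  constructor <;> nlinarith

theorem footPos_sq_le {D l b : ℝ} (hD : 0 < D) (hb : 0 < b) (h1 : |D - l| ≤ b)
    (h2 : b ≤ D + l) : footPos D l b ^ 2 ≤ D ^ 2 := by
  obtain ⟨h3, h4⟩ := abs_le.1 h1
  rw [sq_le_sq, abs_of_pos hD, footPos, abs_div, abs_of_pos (show 0 < 2 * b by positivity),
    div_le_iff₀ (by positivity), abs_le]
  constructor <;> nlinarith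

theorem footPos_add {D l : ℝ} (h : D + l ≠ 0) : footPos D l (D + l) = D := by
  rw [footPos]; field_simp; ring

theorem norm_unit {w : ℂ} (hw : w ≠ 0) : ‖w / (‖w‖ : ℂ)‖ = 1 := by
  rw [norm_div, Complex.norm_real, norm_norm, div_self (norm_ne_zero_iff.2 hw)]

theorem norm_mk_sq (a b : ℝ) : ‖(⟨a, b⟩ : ℂ)‖ ^ 2 = a ^ 2 + b ^ 2 := by
  rw [← Complex.normSq_eq_norm_sq, Complex.normSq_apply]; ring

section apex

variable {D l : ℝ} {a z : ℂ}

theorem dist_apex_left (hD : 0 < D) (hz : z ≠ a) (h1 : |D - l| ≤ dist a z)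
    (h2 : dist a z ≤ D + l) : dist a (apex D l a z) = D := by
  have hb : 0 < ‖z - a‖ := norm_pos_iff.2 (sub_ne_zero.2 hz)
  rw [dist_comm, dist_eq_norm] at h1 h2
  rw [dist_comm, dist_eq_norm, apex, add_sub_cancel_left, norm_mul, norm_unit (sub_ne_zero.2 hz),
    one_mul, ← sq_eq_sq₀ (norm_nonneg _) hD.le, norm_mk_sq, neg_sq,
    Real.sq_sqrt (by linarith [footPos_sq_le hD hb h1 h2])]
  ring

theorem dist_apex_right (hD : 0 < D) (hl : 0 < l) (hz : z ≠ a) (h1 : |D - l| ≤ dist a z)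
    (h2 : dist a z ≤ D + l) : dist z (apex D l a z) = l := by
  have hb : 0 < ‖z - a‖ := norm_pos_iff.2 (sub_ne_zero.2 hz)
  rw [dist_comm a, dist_eq_norm] at h1 h2
  have hs := footPos_sq_le hD hb h1 h2
  have hbc : (‖z - a‖ : ℂ) ≠ 0 := by exact_mod_cast hb.ne'
  have e : apex D l a z - z = (z - a) / ‖z - a‖ *
      (⟨footPos D l ‖z - a‖ - ‖z - a‖, -√(D ^ 2 - footPos D l ‖z - a‖ ^ 2)⟩ : ℂ) := by
    have : (⟨footPos D l ‖z - a‖ - ‖z - a‖, -√(D ^ 2 - footPos D l ‖z - a‖ ^ 2)⟩ : ℂ) =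
        (⟨footPos D l ‖z - a‖, -√(D ^ 2 - footPos D l ‖z - a‖ ^ 2)⟩ : ℂ) - (‖z - a‖ : ℂ) := by
      apply Complex.ext <;> simp
    rw [this, apex]
    field_simp
    ring
  rw [dist_comm, dist_eq_norm, e, norm_mul, norm_unit (sub_ne_zero.2 hz), one_mul,
    ← sq_eq_sq₀ (norm_nonneg _) hl.le, norm_mk_sq, neg_sq, Real.sq_sqrt (by linarith)]
  have : footPos D l ‖z - a‖ * (2 * ‖z - a‖) = D ^ 2 + ‖z - a‖ ^ 2 - l ^ 2 := by
    rw [footPos, div_mul_cancel₀ _ (by positivity)]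
  nlinarith

theorem cw_apex (hz : z ≠ a) :
    cw a z (apex D l a z) = ‖z - a‖ * √(D ^ 2 - footPos D l ‖z - a‖ ^ 2) := by
  have hb : 0 < ‖z - a‖ := norm_pos_iff.2 (sub_ne_zero.2 hz)
  have hn : ‖z - a‖ ^ 2 = (z - a).re ^ 2 + (z - a).im ^ 2 := norm_mk_sq (z - a).re (z - a).im
  rw [cw_eq_br, apex, add_sub_cancel_left]
  have e : (z - a) / (‖z - a‖ : ℂ) = (‖z - a‖⁻¹ : ℝ) • (z - a) := by
    rw [Complex.real_smul]; push_cast; field_simp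
  rw [e]
  set w := z - a
  set s := √(D ^ 2 - footPos D l ‖w‖ ^ 2)
  set X := footPos D l ‖w‖
  have : br w (((‖w‖⁻¹ : ℝ) • w) * (⟨X, -s⟩ : ℂ)) = ‖w‖⁻¹ * ((w.re ^ 2 + w.im ^ 2) * s) := by
    simp only [br, Complex.mul_re, Complex.mul_im, Complex.smul_re, Complex.smul_im, smul_eq_mul]
    ring
  rw [this, ← hn]
  field_simp

theorem cw_apex_pos (hD : 0 < D) (hz : z ≠ a) (h1 : |D - l| < dist a z) (h2 : dist a z < D + l) :
    0 < cw a z (apex D l a z) := by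
  have hb : 0 < ‖z - a‖ := norm_pos_iff.2 (sub_ne_zero.2 hz)
  rw [dist_comm, dist_eq_norm] at h1 h2
  rw [cw_apex hz]
  exact mul_pos hb (Real.sqrt_pos.2 (by linarith [footPos_sq_lt hD hb h1 h2]))

/-- The flat triangle. -/
theorem apex_of_flat (hD : 0 < D) (hl : 0 < l) (h : dist a z = D + l) :
    apex D l a z = AffineMap.lineMap a z (D / (D + l)) := by
  rw [dist_comm, dist_eq_norm] at h
  rw [apex, h, footPos_add (by positivity), sub_self, Real.sqrt_zero, neg_zero,
    AffineMap.lineMap_apply, vsub_eq_sub, vadd_eq_add, Complex.real_smul,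
    show (⟨D, 0⟩ : ℂ) = (D : ℂ) from rfl]
  push_cast
  ring

/-- A point on or below the base is the apex of the triangle with its own distances from the ends;
so the completed chain starts in the given position. -/
theorem apex_eq {x : ℂ} {b : ℝ} (hb : 0 < b) (hx : x.im ≤ 0) : apex ‖x‖ ‖x - b‖ 0 b = x := by
  have h1 : ‖x‖ ^ 2 = x.re ^ 2 + x.im ^ 2 := norm_mk_sq x.re x.im
  have h2 : ‖x - b‖ ^ 2 = (x.re - b) ^ 2 + x.im ^ 2 := by
    rw [show ‖x - b‖ ^ 2 = (x - b).re ^ 2 + (x - b).im ^ 2 from norm_mk_sq _ _]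
    simp
  have e : footPos ‖x‖ ‖x - b‖ b = x.re := by
    rw [footPos, h1, h2]; field_simp; ring
  have hbn : ‖(b : ℂ) - 0‖ = b := by rw [sub_zero, Complex.norm_of_nonneg hb.le]
  rw [apex, hbn, e, h1, show x.re ^ 2 + x.im ^ 2 - x.re ^ 2 = (-x.im) ^ 2 by ring,
    Real.sqrt_sq (by linarith), neg_neg, sub_zero, div_self (by exact_mod_cast hb.ne'), one_mul,
    zero_add]

theorem continuousOn_apex {f g : ℝ → ℂ} {s : Set ℝ} (hf : ContinuousOn f s) (hg : ContinuousOn g s)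
    (h : ∀ t ∈ s, g t ≠ f t) : ContinuousOn (fun t => apex D l (f t) (g t)) s := by
  have hb : ContinuousOn (fun t => ‖g t - f t‖) s := (hg.sub hf).norm
  have hb0 : ∀ t ∈ s, ‖g t - f t‖ ≠ 0 := fun t ht => norm_ne_zero_iff.2 (sub_ne_zero.2 (h t ht))
  have hX : ContinuousOn (fun t => footPos D l ‖g t - f t‖) s := by
    unfold footPos
    exact ContinuousOn.div (by fun_prop) (by fun_prop) fun t ht => mul_ne_zero two_ne_zero (hb0 t ht)
  have hY : ContinuousOn (fun t => -√(D ^ 2 - footPos D l ‖g t - f t‖ ^ 2)) s :=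
    (Real.continuous_sqrt.comp_continuousOn (continuousOn_const.sub (hX.pow 2))).neg
  have hXY : ContinuousOn (fun t => (⟨footPos D l ‖g t - f t‖,
      -√(D ^ 2 - footPos D l ‖g t - f t‖ ^ 2)⟩ : ℂ)) s := by
    have : ContinuousOn (fun t => ((footPos D l ‖g t - f t‖ : ℝ) : ℂ) +
        ((-√(D ^ 2 - footPos D l ‖g t - f t‖ ^ 2) : ℝ) : ℂ) * Complex.I) s :=
      (Complex.continuous_ofReal.comp_continuousOn hX).add
        ((Complex.continuous_ofReal.comp_continuousOn hY).mul continuousOn_const)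
    refine this.congr fun t _ => ?_
    apply Complex.ext <;> simp
  unfold apex
  refine hf.add (ContinuousOn.mul (ContinuousOn.div (hg.sub hf)
    (Complex.continuous_ofReal.comp_continuousOn hb) fun t ht => ?_) hXY)
  exact Complex.ofReal_ne_zero.2 (hb0 t ht)

end apex

end Arch
end

noncomputable section

namespace Arch

open Set Filter Topology

/-! ### Convexifying an arc with one more vertex -/

/-- The chain `p 0, …, p k` extended by the vertex `x`. -/
def extend (k : ℕ) (p : ℕ → ℂ) (x : ℂ) : ℕ → ℂ := fun j => if j ≤ k then p j else x

theorem extend_le {k j : ℕ} (p : ℕ → ℂ) (x : ℂ) (h : j ≤ k) : extend k p x j = p j := if_pos h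

theorem extend_last (k : ℕ) (p : ℕ → ℂ) (x : ℂ) : extend k p x (k + 1) = x :=
  if_neg (by omega)

theorem PlanarSimple.rigid {N : ℕ} {p : ℕ → ℂ} (h : PlanarSimple N p) {u w : ℂ} (hu : u ≠ 0) :
    PlanarSimple N fun j => u * p j + w := by
  refine ⟨fun j hj e => h.1 j hj ?_, fun i j hij hj s hs t ht e => h.2 i j hij hj s hs t ht ?_⟩
  · exact mul_left_cancel₀ hu (add_right_cancel e)
  · rw [← lineMap_rigid, ← lineMap_rigid] at e
    exact mul_left_cancel₀ hu (add_right_cancel e)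

/-- The motion of an arc over a variable base, completed by a triangle below the base, and
normalised such that the first and the last vertex stay where they are. -/
theorem exists_fold_of_path {k : ℕ} {c : ℕ → ℂ} {b : ℝ} (hk : 2 ≤ k) (hc0 : c 0 = 0) (hck : c k = b)
    (hb : 0 < b) (hx : (c (k + 1)).im ≤ 0) (hx0 : c (k + 1) ≠ 0) (hxk : c (k + 1) ≠ c k)
    {P : ℝ → ℕ → ℂ} (hP : ChainPath k c P) (hW : ∀ t ∈ Ioc (0 : ℝ) 1, WArc k (P t))
    (hD : ∀ t ∈ Ioc (0 : ℝ) 1, |‖c (k + 1)‖ - ‖c (k + 1) - b‖| < dist (P t 0) (P t k) ∧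
      dist (P t 0) (P t k) < ‖c (k + 1)‖ + ‖c (k + 1) - b‖)
    (h1 : 0 < cw (P 1 0) (P 1 1) (apex ‖c (k + 1)‖ ‖c (k + 1) - b‖ (P 1 0) (P 1 k)))
    (h2 : 0 < cw (P 1 (k - 1)) (P 1 k) (apex ‖c (k + 1)‖ ‖c (k + 1) - b‖ (P 1 0) (P 1 k))) :
    ∃ C : ℝ → ℕ → ℂ, ChainPath (k + 1) c C ∧ (∀ t ∈ Icc (0 : ℝ) 1, C t 0 = c 0) ∧
      (∀ t ∈ Icc (0 : ℝ) 1, C t (k + 1) = c (k + 1)) ∧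
      (∀ t ∈ Ioc (0 : ℝ) 1, PlanarSimple (k + 1) (C t)) ∧ WArc (k + 1) (C 1) := by
  set x := c (k + 1) with hxdef
  set D := ‖x‖ with hDdef
  set l := ‖x - b‖ with hldef
  have hD0 : 0 < D := norm_pos_iff.2 hx0
  have hl0 : 0 < l := norm_pos_iff.2 (sub_ne_zero.2 (by rwa [hck] at hxk))
  set y : ℝ → ℂ := fun t => apex D l (P t 0) (P t k) with hy
  have hy0 : y 0 = x := by
    simp only [hy]; rw [hP.zero 0 (by omega), hP.zero k le_rfl, hc0, hck, apex_eq hb hx]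
  have hne : ∀ t ∈ Icc (0 : ℝ) 1, P t k ≠ P t 0 := by
    intro t ht
    rcases ht.1.lt_or_eq with h0 | rfl
    · exact (hW t ⟨h0, ht.2⟩).weakArc.ends_ne hk
    · rw [hP.zero 0 (by omega), hP.zero k le_rfl, hc0, hck]; exact_mod_cast hb.ne'
  have hyc : ContinuousOn y (Icc 0 1) := continuousOn_apex (hP.cont 0 (by omega)) (hP.cont k le_rfl) hne
  -- At time `0` only the weak inequalities hold: the new vertex may lie on the line of the base.
  have hbl : ∀ t ∈ Icc (0 : ℝ) 1, |D - l| ≤ dist (P t 0) (P t k) ∧ dist (P t 0) (P t k) ≤ D + l := by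
    intro t ht
    rcases ht.1.lt_or_eq with h0 | rfl
    · exact ⟨(hD t ⟨h0, ht.2⟩).1.le, (hD t ⟨h0, ht.2⟩).2.le⟩
    · rw [hP.zero 0 (by omega), hP.zero k le_rfl, hc0, hck, dist_comm, dist_zero_right]
      constructor
      · have := abs_norm_sub_norm_le x (x - b)
        rwa [sub_sub_cancel] at this
      · have := norm_sub_le x (x - b)
        rwa [sub_sub_cancel] at this
  have hyl : ∀ t ∈ Icc (0 : ℝ) 1, dist (P t 0) (y t) = D := fun t ht =>
    dist_apex_left hD0 (hne t ht) (hbl t ht).1 (hbl t ht).2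
  have hyr : ∀ t ∈ Icc (0 : ℝ) 1, dist (P t k) (y t) = l := fun t ht =>
    dist_apex_right hD0 hl0 (hne t ht) (hbl t ht).1 (hbl t ht).2
  have hy_ne : ∀ t ∈ Icc (0 : ℝ) 1, y t - P t 0 ≠ 0 := by
    intro t ht e
    have := hyl t ht
    rw [sub_eq_zero.1 e, dist_self] at this
    linarith
  -- The rotation that takes the side `y t - P t 0`, of constant length `D`, to `x`; together with a
  -- translation it keeps the first and the last vertex at rest.
  set u : ℝ → ℂ := fun t => x / (y t - P t 0) with hu
  have hun : ∀ t ∈ Icc (0 : ℝ) 1, ‖u t‖ = 1 := by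
    intro t ht
    have := hyl t ht
    rw [dist_comm, dist_eq_norm] at this
    simp only [hu]
    rw [norm_div, this, ← hDdef, div_self hD0.ne']
  have hu0 : ∀ t ∈ Icc (0 : ℝ) 1, u t ≠ 0 := fun t ht e => by
    have := hun t ht; rw [e, norm_zero] at this; norm_num at this
  have huc : ContinuousOn u (Icc 0 1) :=
    continuousOn_const.div (hyc.sub (hP.cont 0 (by omega))) hy_ne
  have hu00 : u 0 = 1 := by
    simp only [hu]; rw [hy0, hP.zero 0 (by omega), hc0, sub_zero, div_self hx0]
  have hdist : ∀ t ∈ Icc (0 : ℝ) 1, ∀ w a a' : ℂ, dist (u t * a + w) (u t * a' + w) = dist a a' := by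
    intro t ht w a a'
    rw [dist_add_right, dist_eq_norm, ← mul_sub, norm_mul, hun t ht, one_mul, dist_eq_norm]
  refine ⟨fun t j => u t * extend k (P t) (y t) j + -(u t * P t 0),
    ⟨fun j hj => ?_, fun j hj => ?_, fun t ht j hj => ?_⟩, fun t ht => ?_, fun t ht => ?_,
    fun t ht => ?_, ?_⟩
  · refine (huc.mul ?_).add (huc.mul (hP.cont 0 (by omega))).neg
    rcases hj.lt_or_eq with hj | rfl
    · simp only [extend_le _ _ (show j ≤ k by omega)]; exact hP.cont j (by omega)
    · simp only [extend_last]; exact hyc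
  · rw [hu00, hP.zero 0 (by omega), hc0, one_mul, mul_zero, neg_zero, add_zero]
    rcases hj.lt_or_eq with hj | rfl
    · rw [extend_le _ _ (by omega), hP.zero j (by omega)]
    · rw [extend_last, hy0]
  · rw [hdist t ht]
    rcases (show j ≤ k by omega).lt_or_eq with hj | rfl
    · rw [extend_le _ _ (by omega), extend_le _ _ (by omega), hP.len t ht j hj]
    · rw [extend_le _ _ le_rfl, extend_last, hyr t ht, ← hxdef, hck, dist_comm, dist_eq_norm]
  · beta_reduce; rw [extend_le _ _ (by omega), hc0]; ring
  · beta_reduce; rw [extend_last, ← sub_eq_add_neg, ← mul_sub]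
    exact div_mul_cancel₀ _ (hy_ne t ht)
  · refine PlanarSimple.rigid (WeakArc.planarSimple_succ (k := k) ?_ hk ?_) (hu0 t ⟨ht.1.le, ht.2⟩)
    · exact (hW t ht).weakArc.congr fun j hj => extend_le _ _ hj
    · rw [extend_le _ _ (by omega), extend_le _ _ le_rfl, extend_last]
      exact cw_apex_pos hD0 (hne t ⟨ht.1.le, ht.2⟩) (hD t ht).1 (hD t ht).2
  · have h1I : (1 : ℝ) ∈ Ioc (0 : ℝ) 1 := ⟨one_pos, le_rfl⟩
    have h1I' : (1 : ℝ) ∈ Icc (0 : ℝ) 1 := ⟨zero_le_one, le_rfl⟩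
    refine WArc.rigid (WArc.exists_snoc ((hW 1 h1I).congr fun j hj => extend_le _ _ hj) ?_ ?_ ?_) _
      (hun 1 h1I')
    · rw [extend_le _ _ (by omega), extend_le _ _ le_rfl, extend_last]
      exact cw_apex_pos hD0 (hne 1 h1I') (hD 1 h1I).1 (hD 1 h1I).2
    · rw [extend_le _ _ (by omega), extend_le _ _ (by omega), extend_last]; exact h1
    · rw [extend_le _ _ (by omega), extend_le _ _ le_rfl, extend_last]; exact h2

theorem ChainPath.reparam {k : ℕ} {p : ℕ → ℂ} {P : ℝ → ℕ → ℂ} (h : ChainPath k p P) {τ : ℝ}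
    (h0 : 0 ≤ τ) (h1 : τ ≤ 1) : ChainPath k p fun t => P (t * τ) := by
  have hm : ∀ t ∈ Icc (0 : ℝ) 1, t * τ ∈ Icc (0 : ℝ) 1 := fun t ht =>
    ⟨mul_nonneg ht.1 h0, mul_le_one₀ ht.2 h0 h1⟩
  refine ⟨fun j hj => (h.cont j hj).comp (by fun_prop) hm, fun j hj => ?_, fun t ht => h.len _ (hm t ht)⟩
  rw [zero_mul]; exact h.zero j hj

theorem continuousOn_cw {f g h : ℝ → ℂ} {s : Set ℝ} (hf : ContinuousOn f s) (hg : ContinuousOn g s)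
    (hh : ContinuousOn h s) : ContinuousOn (fun t => cw (f t) (g t) (h t)) s := by
  unfold cw
  exact ((Complex.continuous_im.comp_continuousOn (hg.sub hf)).mul
    (Complex.continuous_re.comp_continuousOn (hh.sub hf))).sub
    ((Complex.continuous_re.comp_continuousOn (hg.sub hf)).mul
      (Complex.continuous_im.comp_continuousOn (hh.sub hf)))

theorem continuousOn_dt {f g : ℝ → ℂ} {s : Set ℝ} (hf : ContinuousOn f s) (hg : ContinuousOn g s) :
    ContinuousOn (fun t => dt (f t) (g t)) s := by
  unfold dt
  exact ((Complex.continuous_re.comp_continuousOn hf).mul (Complex.continuous_re.comp_continuousOn hg)).add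
    ((Complex.continuous_im.comp_continuousOn hf).mul (Complex.continuous_im.comp_continuousOn hg))

theorem eventually_left {f : ℝ → ℝ} (hf : ContinuousOn f (Icc 0 1)) {τ : ℝ} (h0 : 0 < τ)
    (h1 : τ ≤ 1) (hpos : 0 < f τ) : ∀ᶠ t in 𝓝[<] τ, 0 < f t := by
  have : Ioo 0 τ ∈ 𝓝[<] τ := Ioo_mem_nhdsLT h0
  have h2 : 𝓝[<] τ ≤ 𝓝[Icc 0 1] τ := by
    rw [← nhdsWithin_inter_of_mem this]
    exact nhdsWithin_mono _ fun t ht => ⟨ht.1.1.le, ht.1.2.le.trans h1⟩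
  exact ((hf τ ⟨h0.le, h1⟩).mono_left h2).eventually (lt_mem_nhds hpos)

theorem eventually_right {f : ℝ → ℝ} (hf : ContinuousOn f (Icc 0 1)) (hpos : 0 < f 0) :
    ∀ᶠ t in 𝓝[>] (0 : ℝ), 0 < f t := by
  have : Ioc (0 : ℝ) 1 ∈ 𝓝[>] (0 : ℝ) := Ioc_mem_nhdsGT one_pos
  have h2 : 𝓝[>] (0 : ℝ) ≤ 𝓝[Icc 0 1] 0 := by
    rw [← nhdsWithin_inter_of_mem this]
    exact nhdsWithin_mono _ fun t ht => ⟨ht.1.1.le, ht.1.2⟩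
  exact ((hf 0 ⟨le_rfl, zero_le_one⟩).mono_left h2).eventually (lt_mem_nhds hpos)

/-- Two clockwise turns by less than a right angle add up to less than a straight angle. -/
theorem br_pos_of_acute {u v w : ℂ} (h1 : 0 < br u v) (h2 : 0 < br v w) (h3 : 0 < dt u v)
    (h4 : 0 < dt v w) : 0 < br u w := by
  have e : dt v v * br u w = br u v * dt v w + dt u v * br v w := by simp only [br, dt]; ring
  have hv : 0 ≤ dt v v := by rw [dt_self]; positivity
  by_contra! hle
  nlinarith [mul_pos h1 h4, mul_pos h3 h2]

/-- An arc with one more vertex, below its base or on it, can be moved to a convex arc, with the first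
and the last vertex at rest, through simple polygons. -/
theorem WArc.exists_fold {k : ℕ} {c : ℕ → ℂ} {b : ℝ} (h : WArc k c) (hc0 : c 0 = 0) (hck : c k = b)
    (hb : 0 < b) (hx : (c (k + 1)).im ≤ 0) (hx0 : c (k + 1) ≠ 0) (hxk : c (k + 1) ≠ c k) :
    ∃ C : ℝ → ℕ → ℂ, ChainPath (k + 1) c C ∧ (∀ t ∈ Icc (0 : ℝ) 1, C t 0 = c 0) ∧
      (∀ t ∈ Icc (0 : ℝ) 1, C t (k + 1) = c (k + 1)) ∧
      (∀ t ∈ Ioc (0 : ℝ) 1, PlanarSimple (k + 1) (C t)) ∧ WArc (k + 1) (C 1) := by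
  have hk := h.two_le
  set x := c (k + 1) with hxdef
  set D := ‖x‖ with hDdef
  set l := ‖x - b‖ with hldef
  have hD0 : 0 < D := norm_pos_iff.2 hx0
  have hl0 : 0 < l := norm_pos_iff.2 (sub_ne_zero.2 (by rwa [hck] at hxk))
  have hb0 : dist (c 0) (c k) = b := by
    rw [hc0, hck, dist_comm, dist_zero_right, Complex.norm_of_nonneg hb.le]
  have hbD : |D - l| ≤ b := by
    have := abs_norm_sub_norm_le x (x - b)
    rwa [sub_sub_cancel, Complex.norm_of_nonneg hb.le] at this
  have hbD' : b ≤ D + l := by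
    have := norm_sub_le x (x - b)
    rwa [sub_sub_cancel, Complex.norm_of_nonneg hb.le] at this
  have hDl : 0 < D + l := by positivity
  have hq0 : 0 < D / (D + l) := by positivity
  have hq1 : 0 < 1 - D / (D + l) := by
    rw [sub_pos, div_lt_one hDl]; linarith
  -- the end conditions when the triangle is flat
  have flat : ∀ p : ℕ → ℂ, WeakArc k p → dist (p 0) (p k) = D + l →
      0 < cw (p 0) (p 1) (apex D l (p 0) (p k)) ∧ 0 < cw (p (k - 1)) (p k) (apex D l (p 0) (p k)) := by
    intro p hp hd
    rw [apex_of_flat hD0 hl0 hd, cw_lineMap_right, cw_lineMap_right, cw_self_outer, cw_self_right]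
    have e1 := hp.base 1 one_pos (by omega)
    have e2 := hp.base (k - 1) (by omega) (by omega)
    constructor
    · rw [mul_zero, zero_add]; exact mul_pos hq0 e1
    · rw [mul_zero, add_zero]; exact mul_pos hq1 (cw_pos_rotate e2)
  -- If `b < D + l`, the new vertex is not on the base, and opening the arc flattens the triangle.
  -- If `b = D + l`, it is on the base; the triangle is flat already and the arc is closed a little
  -- instead.
  rcases hbD'.lt_or_eq with hlt | heq
  · obtain ⟨P, hP, h1, h2, h3⟩ := h.openable
    have hne : ∀ t ∈ Icc (0 : ℝ) 1, P t k ≠ P t 0 := by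
      intro t ht e
      rcases ht.1.lt_or_eq with h0 | rfl
      · have := h1 t ⟨h0, ht.2⟩
        rw [e, dist_self, hb0] at this; linarith
      · rw [hP.zero 0 (by omega), hP.zero k le_rfl, hc0, hck] at e; exact hb.ne' (by exact_mod_cast e)
    have c0 := hP.cont 0 (by omega)
    have c1 := hP.cont 1 (by omega)
    have ck := hP.cont k le_rfl
    have ck1 := hP.cont (k - 1) (by omega)
    have ca : ContinuousOn (fun t => apex D l (P t 0) (P t k)) (Icc 0 1) := continuousOn_apex c0 ck hne
    obtain ⟨τ, hτ0, hτ1, hpos, hnn, hor⟩ := exists_first_zero (f := fun t => D + l - dist (P t 0) (P t k))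
      one_pos (continuousOn_const.sub (continuous_dist.comp_continuousOn (c0.prodMk ck) : ContinuousOn (fun t => dist (P t 0) (P t k)) _))
      (by rw [hP.zero 0 (by omega), hP.zero k le_rfl, hb0]; linarith)
    have hbase : ∀ t, 0 < t → t < τ → |D - l| < dist (P t 0) (P t k) ∧ dist (P t 0) (P t k) < D + l := by
      intro t h0 ht
      refine ⟨hbD.trans_lt ?_, by linarith [hpos t h0.le ht]⟩
      have := h1 t ⟨h0, by linarith⟩
      rwa [hb0] at this
    -- The motion is to stop slightly before `τ`, the time at which the triangle becomes flat or the
    -- arc straight. There neither is degenerate yet, while the joints at both ends of the base are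
    -- already convex.
    have hev : ∀ᶠ t in 𝓝[<] τ, 0 < cw (P t 0) (P t 1) (apex D l (P t 0) (P t k)) ∧
        0 < cw (P t (k - 1)) (P t k) (apex D l (P t 0) (P t k)) := by
      have of_pos : 0 < cw (P τ 0) (P τ 1) (apex D l (P τ 0) (P τ k)) ∧
          0 < cw (P τ (k - 1)) (P τ k) (apex D l (P τ 0) (P τ k)) →
          ∀ᶠ t in 𝓝[<] τ, 0 < cw (P t 0) (P t 1) (apex D l (P t 0) (P t k)) ∧
          0 < cw (P t (k - 1)) (P t k) (apex D l (P t 0) (P t k)) := fun hh =>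
        (eventually_left (continuousOn_cw c0 c1 ca) hτ0 hτ1 hh.1).and
          (eventually_left (continuousOn_cw ck1 ck ca) hτ0 hτ1 hh.2)
      rcases hτ1.lt_or_eq with hτ | rfl
      · have hz := hor.resolve_left hτ.ne
        exact of_pos (flat (P τ) (h2 τ ⟨hτ0.le, hτ⟩).weakArc (by linarith))
      · obtain ⟨r, hr, er⟩ := h3 0 (by omega)
        obtain ⟨r', hr', er'⟩ := h3 (k - 1) (by omega)
        rw [zero_add] at er
        rw [Nat.sub_add_cancel (by omega)] at er'
        have hI : (1 : ℝ) ∈ Icc (0 : ℝ) 1 := ⟨zero_le_one, le_rfl⟩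
        have hge : |D - l| < dist (P 1 0) (P 1 k) := by
          refine hbD.trans_lt ?_
          have := h1 1 ⟨one_pos, le_rfl⟩
          rwa [hb0] at this
        rcases hnn.lt_or_eq with hn | hn
        · have hc := cw_apex_pos hD0 (hne 1 hI) hge (by linarith)
          refine of_pos ⟨?_, ?_⟩
          · rw [cw_eq_br, er, br_smul_left]; exact mul_pos hr hc
          · rw [cw_eq_br', er', br_smul_left, ← cw_eq_br']; exact mul_pos hr' hc
        -- Arc and triangle become flat at the same time, so the values at the limit are zero and
        -- give no sign. Just before, the end edges and the triangle sides are on opposite sides of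
        -- the base and make acute angles with it, and these angles add up by `br_pos_of_acute`.
        · have hd : dist (P 1 0) (P 1 k) = D + l := by linarith
          have hB : 0 < dt (P 1 k - P 1 0) (P 1 k - P 1 0) := by
            rw [dt_self]; exact pow_pos (norm_pos_iff.2 (sub_ne_zero.2 (hne 1 hI))) 2
          have ea := apex_of_flat hD0 hl0 hd
          have ea0 : apex D l (P 1 0) (P 1 k) - P 1 0 = (D / (D + l)) • (P 1 k - P 1 0) := by
            rw [ea, AffineMap.lineMap_apply, vsub_eq_sub, vadd_eq_add, add_sub_cancel_right]
          have eak : P 1 k - apex D l (P 1 0) (P 1 k) = (1 - D / (D + l)) • (P 1 k - P 1 0) := by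
            rw [ea, AffineMap.lineMap_apply, vsub_eq_sub, vadd_eq_add]; module
          have v1 := eventually_left (f := fun t => dt (P t 1 - P t 0) (P t k - P t 0)) (continuousOn_dt (c1.sub c0) (ck.sub c0)) one_pos le_rfl
            (by rw [er, dt_smul_left]; exact mul_pos hr hB)
          have v2 := eventually_left (f := fun t => dt (P t k - P t 0) (apex D l (P t 0) (P t k) - P t 0)) (continuousOn_dt (ck.sub c0) (ca.sub c0)) one_pos le_rfl
            (by rw [ea0, dt_smul_right]; exact mul_pos hq0 hB)
          have v3 := eventually_left (f := fun t => dt (P t k - P t 0) (P t k - P t (k - 1))) (continuousOn_dt (ck.sub c0) (ck.sub ck1)) one_pos le_rfl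
            (by rw [er', dt_smul_right]; exact mul_pos hr' hB)
          have v4 := eventually_left (f := fun t => dt (P t k - apex D l (P t 0) (P t k)) (P t k - P t 0)) (continuousOn_dt (ck.sub ca) (ck.sub c0)) one_pos le_rfl
            (by rw [eak, dt_smul_left]; exact mul_pos hq1 hB)
          filter_upwards [v1, v2, v3, v4, Ioo_mem_nhdsLT one_pos] with t w1 w2 w3 w4 ht
          have hw := (h2 t ⟨ht.1.le, ht.2⟩).weakArc
          have hc := cw_apex_pos hD0 (hne t ⟨ht.1.le, ht.2.le⟩) (hbase t ht.1 ht.2).1 (hbase t ht.1 ht.2).2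
          constructor
          · rw [cw_eq_br]
            refine br_pos_of_acute (v := P t k - P t 0) ?_ hc w1 w2
            exact hw.base 1 one_pos (by omega)
          · have e1 : cw (P t (k - 1)) (P t k) (apex D l (P t 0) (P t k)) =
                br (P t k - apex D l (P t 0) (P t k)) (P t k - P t (k - 1)) := by
              simp only [cw, br, Complex.sub_re, Complex.sub_im]; ring
            rw [e1]
            refine br_pos_of_acute (v := P t k - P t 0) ?_ ?_ w4 w3
            · have : br (P t k - apex D l (P t 0) (P t k)) (P t k - P t 0) =
                  cw (P t 0) (P t k) (apex D l (P t 0) (P t k)) := by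
                simp only [cw, br, Complex.sub_re, Complex.sub_im]; ring
              rw [this]; exact hc
            · have : br (P t k - P t 0) (P t k - P t (k - 1)) = cw (P t 0) (P t (k - 1)) (P t k) := by
                simp only [cw, br, Complex.sub_re, Complex.sub_im]; ring
              rw [this]; exact hw.base (k - 1) (by omega) (by omega)
    obtain ⟨σ, ⟨g1, g2⟩, hσ0, hσ⟩ := (hev.and (Ioo_mem_nhdsLT hτ0)).exists
    refine exists_fold_of_path hk hc0 hck hb hx hx0 hxk (hP.reparam hσ0.le (by linarith))
      (fun t ht => h2 _ ⟨mul_nonneg ht.1.le hσ0.le, ?_⟩) (fun t ht => hbase _ (mul_pos ht.1 hσ0) ?_) ?_ ?_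
    · nlinarith [ht.2]
    · nlinarith [ht.2]
    · rw [one_mul]; exact g1
    · rw [one_mul]; exact g2
  · obtain ⟨P, hP, h1, h2⟩ := h.closable
    have hne : ∀ t ∈ Icc (0 : ℝ) 1, P t k ≠ P t 0 := fun t ht => (h2 t ht).weakArc.ends_ne hk
    have c0 := hP.cont 0 (by omega)
    have c1 := hP.cont 1 (by omega)
    have ck := hP.cont k le_rfl
    have ck1 := hP.cont (k - 1) (by omega)
    have ca : ContinuousOn (fun t => apex D l (P t 0) (P t k)) (Icc 0 1) := continuousOn_apex c0 ck hne
    have hd0 : dist (P 0 0) (P 0 k) = D + l := by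
      rw [hP.zero 0 (by omega), hP.zero k le_rfl, hb0, heq]
    obtain ⟨f1, f2⟩ := flat (P 0) (h2 0 ⟨le_rfl, zero_le_one⟩).weakArc hd0
    have hDl' : |D - l| < D + l := by rw [abs_lt]; constructor <;> linarith
    have hev := ((eventually_right (continuousOn_cw c0 c1 ca) f1).and
      (eventually_right (continuousOn_cw ck1 ck ca) f2)).and
      (eventually_right (f := fun t => dist (P t 0) (P t k) - |D - l|)
        ((continuous_dist.comp_continuousOn (c0.prodMk ck) : ContinuousOn (fun t => dist (P t 0) (P t k)) _).sub continuousOn_const) (by rw [hd0]; linarith))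
    obtain ⟨σ, hσ0, hσ⟩ := mem_nhdsGT_iff_exists_Ioc_subset.1 hev
    have hσ0 : 0 < σ := hσ0
    set ρ := min σ 1 with hρ
    have hρ0 : 0 < ρ := lt_min hσ0 one_pos
    have hρ1 : ρ ≤ 1 := min_le_right _ _
    have hIoc : ∀ t ∈ Ioc (0 : ℝ) 1, t * ρ ∈ Ioc 0 σ := fun t ht =>
      ⟨mul_pos ht.1 hρ0, (mul_le_of_le_one_left hρ0.le ht.2).trans (min_le_left _ _)⟩
    have hIoc' : ∀ t ∈ Ioc (0 : ℝ) 1, t * ρ ∈ Ioc (0 : ℝ) 1 := fun t ht =>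
      ⟨mul_pos ht.1 hρ0, (mul_le_of_le_one_left hρ0.le ht.2).trans hρ1⟩
    refine exists_fold_of_path hk hc0 hck hb hx hx0 hxk (hP.reparam hρ0.le hρ1)
      (fun t ht => h2 _ ⟨(hIoc' t ht).1.le, (hIoc' t ht).2⟩) (fun t ht => ⟨?_, ?_⟩) ?_ ?_
    · have := (hσ (hIoc t ht)).2
      linarith
    · have := h1 _ (hIoc' t ht)
      rw [hb0] at this; linarith
    · exact (hσ (hIoc 1 ⟨one_pos, le_rfl⟩)).1.1
    · exact (hσ (hIoc 1 ⟨one_pos, le_rfl⟩)).1.2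

end Arch
end

noncomputable section

namespace Arch

open Set Filter Topology

/-! ### Simple polygons in space -/

theorem val_add_one {n : ℕ} [NeZero n] (j : Fin n) :
    ((j + 1 : Fin n) : ℕ) = if (j : ℕ) + 1 = n then 0 else (j : ℕ) + 1 := by
  rw [Fin.val_add, Fin.val_one', Nat.add_mod_mod]
  split_ifs with h
  · rw [h, Nat.mod_self]
  · exact Nat.mod_eq_of_lt (by omega)

theorem add_one_ne {n : ℕ} [NeZero n] (hn : 2 ≤ n) (j : Fin n) : j + 1 ≠ j := by
  intro e
  have h := val_add_one j
  rw [e] at h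
  split_ifs at h <;> omega

theorem add_two_ne {n : ℕ} [NeZero n] (hn : 3 ≤ n) (j : Fin n) : j + 1 + 1 ≠ j := by
  intro e
  have h := val_add_one (j + 1)
  rw [e, val_add_one j] at h
  split_ifs at h <;> omega

/-- The point of the edge `e_i` at the parameter `s`. -/
def edgePt {n : ℕ} [NeZero n] (p : Conf n) (i : Fin n) (s : ℝ) : E3 :=
  AffineMap.lineMap (p i) (p (i + 1)) s

theorem edgePt_zero {n : ℕ} [NeZero n] (p : Conf n) (i : Fin n) : edgePt p i 0 = p i :=
  AffineMap.lineMap_apply_zero _ _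

theorem edgePt_one {n : ℕ} [NeZero n] (p : Conf n) (i : Fin n) : edgePt p i 1 = p (i + 1) :=
  AffineMap.lineMap_apply_one _ _

theorem mem_edge {n : ℕ} [NeZero n] {p : Conf n} {i : Fin n} {x : E3} :
    x ∈ edge p i ↔ ∃ s ∈ Icc (0 : ℝ) 1, edgePt p i s = x := by
  rw [edge, segment_eq_image_lineMap]; rfl

/-- Simplicity amounts to disjointness of the half-open edges, each without its final vertex. In
this form adjacent and distant edges need no distinction. -/
theorem IsSimplePolygon.edgePt_ne {n : ℕ} [NeZero n] {p : Conf n} (h : IsSimplePolygon p)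
    {i j : Fin n} (hij : i ≠ j) {s t : ℝ} (hs : s ∈ Ico (0 : ℝ) 1) (ht : t ∈ Ico (0 : ℝ) 1) :
    edgePt p i s ≠ edgePt p j t := by
  obtain ⟨hn, hne, hadj, hdis⟩ := h
  have key : ∀ i : Fin n, ∀ s ∈ Ico (0 : ℝ) 1, ∀ t ∈ Ico (0 : ℝ) 1,
      edgePt p i s ≠ edgePt p (i + 1) t := by
    intro i s hs t ht e
    have hm : edgePt p i s ∈ edge p i ∩ edge p (i + 1) :=
      ⟨mem_edge.2 ⟨s, ⟨hs.1, hs.2.le⟩, rfl⟩, mem_edge.2 ⟨t, ⟨ht.1, ht.2.le⟩, e.symm⟩⟩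
    rw [hadj i, mem_singleton_iff, ← edgePt_one p i] at hm
    exact hs.2.ne (AffineMap.lineMap_injective ℝ (hne i) hm)
  intro e
  by_cases h1 : j = i + 1
  · subst h1; exact key i s hs t ht e
  by_cases h2 : i = j + 1
  · subst h2; exact key j t ht s hs e.symm
  · exact (disjoint_left.1 (hdis i j hij.symm h1 h2)) (mem_edge.2 ⟨s, ⟨hs.1, hs.2.le⟩, rfl⟩)
      (mem_edge.2 ⟨t, ⟨ht.1, ht.2.le⟩, e.symm⟩)

theorem IsSimplePolygon.injective {n : ℕ} [NeZero n] {p : Conf n} (h : IsSimplePolygon p) :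
    Function.Injective p := by
  intro i j e
  by_contra hij
  refine h.edgePt_ne hij (s := 0) (t := 0) ⟨le_rfl, one_pos⟩ ⟨le_rfl, one_pos⟩ ?_
  rw [edgePt_zero, edgePt_zero, e]

theorem isSimplePolygon_of_edgePt {n : ℕ} [NeZero n] {p : Conf n} (hn : 3 ≤ n)
    (h1 : ∀ i, p i ≠ p (i + 1))
    (h2 : ∀ i j : Fin n, i < j → ∀ s ∈ Ico (0 : ℝ) 1, ∀ t ∈ Ico (0 : ℝ) 1,
      edgePt p i s ≠ edgePt p j t) : IsSimplePolygon p := by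
  have h3 : ∀ i j : Fin n, i ≠ j → ∀ s ∈ Ico (0 : ℝ) 1, ∀ t ∈ Ico (0 : ℝ) 1,
      edgePt p i s ≠ edgePt p j t := by
    intro i j hij s hs t ht
    rcases lt_or_gt_of_ne hij with h | h
    · exact h2 i j h s hs t ht
    · exact (h2 j i h t ht s hs).symm
  have hz : (0 : ℝ) ∈ Ico (0 : ℝ) 1 := ⟨le_rfl, one_pos⟩
  refine ⟨hn, h1, fun i => ?_, fun i j hij hji hij' => ?_⟩
  · refine Subset.antisymm (fun x hx => ?_) (singleton_subset_iff.2
      ⟨mem_edge.2 ⟨1, ⟨zero_le_one, le_rfl⟩, edgePt_one p i⟩,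
        mem_edge.2 ⟨0, ⟨le_rfl, zero_le_one⟩, edgePt_zero p _⟩⟩)
    obtain ⟨s, hs, e⟩ := mem_edge.1 hx.1
    obtain ⟨t, ht, e'⟩ := mem_edge.1 hx.2
    rcases hs.2.lt_or_eq with hs1 | rfl
    · rcases ht.2.lt_or_eq with ht1 | rfl
      · exact absurd (e.trans e'.symm) (h3 _ _ (add_one_ne (by omega) i).symm s ⟨hs.1, hs1⟩ t ⟨ht.1, ht1⟩)
      · rw [edgePt_one, ← edgePt_zero p] at e'
        exact absurd (e.trans e'.symm) (h3 _ _ (add_two_ne hn i).symm s ⟨hs.1, hs1⟩ 0 hz)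
    · rw [edgePt_one] at e; exact e.symm
  · rw [disjoint_left]
    intro x hx hx'
    -- The final vertex of a closed edge is the initial point of the next half-open edge.
    have key : ∀ i : Fin n, x ∈ edge p i → ∃ k, (k = i ∨ k = i + 1) ∧ ∃ s ∈ Ico (0 : ℝ) 1, edgePt p k s = x := by
      intro i hx
      obtain ⟨s, hs, e⟩ := mem_edge.1 hx
      rcases hs.2.lt_or_eq with hs1 | rfl
      · exact ⟨i, .inl rfl, s, ⟨hs.1, hs1⟩, e⟩
      · exact ⟨i + 1, .inr rfl, 0, hz, by rw [edgePt_zero, ← e, edgePt_one]⟩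
    obtain ⟨k, hk, s, hs, e⟩ := key i hx
    obtain ⟨l, hl, t, ht, e'⟩ := key j hx'
    refine h3 k l ?_ s hs t ht (e.trans e'.symm)
    rcases hk with rfl | rfl <;> rcases hl with rfl | rfl
    · exact hij.symm
    · exact hij'
    · exact hji.symm
    · exact fun e => hij (add_right_cancel e).symm

/-! ### Planes in space -/

/-- The plane through `o` spanned by `f` and `g`, with complex coordinates. -/
def emb (o f g : E3) (z : ℂ) : E3 := o + z.re • f + z.im • g

/-- An orthonormal pair. -/
structure Orth (f g : E3) : Prop where
  left : ‖f‖ = 1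
  right : ‖g‖ = 1
  inner : inner ℝ f g = 0

theorem emb_zero (o f g : E3) : emb o f g 0 = o := by simp [emb]

theorem emb_ofReal (o f g : E3) (r : ℝ) : emb o f g r = o + r • f := by simp [emb]

theorem emb_sub (o f g : E3) (z w : ℂ) :
    emb o f g z - emb o f g w = (z - w).re • f + (z - w).im • g := by
  simp only [emb, Complex.sub_re, Complex.sub_im]; module

theorem lineMap_emb (o f g : E3) (z w : ℂ) (s : ℝ) :
    AffineMap.lineMap (emb o f g z) (emb o f g w) s = emb o f g (AffineMap.lineMap z w s) := by
  simp only [emb, AffineMap.lineMap_apply, vsub_eq_sub, vadd_eq_add, Complex.add_re, Complex.add_im,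
    Complex.real_smul, Complex.mul_re, Complex.mul_im, Complex.ofReal_re, Complex.ofReal_im,
    Complex.sub_re, Complex.sub_im]
  module

theorem Orth.inner_comb {f g : E3} (h : Orth f g) (a b c d : ℝ) :
    Inner.inner ℝ (a • f + b • g) (c • f + d • g) = a * c + b * d := by
  have hf : Inner.inner ℝ f f = (1 : ℝ) := by rw [real_inner_self_eq_norm_sq, h.left]; norm_num
  have hg : Inner.inner ℝ g g = (1 : ℝ) := by rw [real_inner_self_eq_norm_sq, h.right]; norm_num
  have hgf : Inner.inner ℝ g f = (0 : ℝ) := by rw [real_inner_comm, h.inner]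
  simp only [inner_add_left, inner_add_right, real_inner_smul_left, real_inner_smul_right, hf, hg,
    hgf, h.inner]
  ring

theorem Orth.dist_emb {f g : E3} (h : Orth f g) (o : E3) (z w : ℂ) :
    dist (emb o f g z) (emb o f g w) = dist z w := by
  rw [dist_eq_norm, dist_eq_norm, emb_sub]
  refine (sq_eq_sq₀ (norm_nonneg _) (norm_nonneg _)).1 ?_
  rw [← real_inner_self_eq_norm_sq, h.inner_comb, Complex.sq_norm, Complex.normSq_apply]

theorem Orth.emb_injective {f g : E3} (h : Orth f g) (o : E3) : Function.Injective (emb o f g) := by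
  intro z w e
  have := h.dist_emb o z w
  rw [e, dist_self] at this
  exact dist_eq_zero.1 this.symm

theorem continuous_emb (o f g : E3) : Continuous (emb o f g) := by
  unfold emb; fun_prop

/-- A planar simple polygon, in a plane in space. -/
theorem PlanarSimple.isSimplePolygon {N n : ℕ} [NeZero n] (hn : N + 1 = n) (hN : 2 ≤ N) {c : ℕ → ℂ}
    (hc : PlanarSimple N c) {o f g : E3} (hfg : Orth f g) {p : Conf n}
    (hp : ∀ j : Fin n, p j = emb o f g (c j)) : IsSimplePolygon p := by
  subst hn
  have hs : ∀ j : Fin (N + 1), p (j + 1) = emb o f g (c (if (j : ℕ) = N then 0 else j + 1)) := by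
    intro j
    rw [hp, val_add_one]
    simp only [add_left_inj]
  refine isSimplePolygon_of_edgePt (by omega) (fun i e => ?_) fun i j hij s hs' t ht e => ?_
  · rw [hs, hp] at e
    exact hc.1 i (by omega) (hfg.emb_injective o e)
  · rw [edgePt, edgePt, hs, hs, hp, hp, lineMap_emb, lineMap_emb] at e
    have e := hfg.emb_injective o e
    rw [if_neg (by omega)] at e
    exact hc.2 i j hij (by omega) s hs' t ht e

/-- The closed polygon of a convex arc is strictly on one side of each edge for some vertex. -/
theorem WeakArc.exists_side {k : ℕ} {c : ℕ → ℂ} (h : WeakArc k c) (hk : 2 ≤ k) {i : ℕ} (hi : i ≤ k) :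
    ∃ j ≤ k, 0 < cw (c i) (c (if i = k then 0 else i + 1)) (c j) := by
  rcases hi.lt_or_eq with hi | rfl
  · rw [if_neg hi.ne]
    rcases Nat.eq_zero_or_pos i with rfl | hi0
    · exact ⟨k, le_rfl, h.base 1 one_pos (by omega)⟩
    · by_contra! hh
      have a1 := hh 0 (by omega)
      have a2 := hh k le_rfl
      have b1 : 0 ≤ cw (c i) (c (i + 1)) (c 0) := by rw [cw_rotate]; exact h.tri 0 i (i + 1) (by omega) (by omega) hi
      have b2 := h.tri i (i + 1) k (by omega) hi le_rfl
      have e1 : cw (c i) (c (i + 1)) (c 0) = 0 := le_antisymm a1 b1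
      have e2 : cw (c i) (c (i + 1)) (c k) = 0 := le_antisymm a2 b2
      have hb := h.base i hi0 hi
      have hne := h.ne i hi
      apply hne
      have hb' : cw (c i) (c k) (c 0) ≠ 0 := by rw [cw_rotate]; exact hb.ne'
      simp only [cw, Complex.sub_re, Complex.sub_im] at e1 e2 hb'
      refine Complex.ext ?_ ?_
      · by_contra hx
        apply hb'
        have : ((c i).re - (c (i+1)).re) ≠ 0 := sub_ne_zero.2 hx
        apply mul_left_cancel₀ this
        linear_combination ((c 0).re - (c i).re) * e2 - ((c k).re - (c i).re) * e1
      · by_contra hx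
        apply hb'
        have : ((c i).im - (c (i+1)).im) ≠ 0 := sub_ne_zero.2 hx
        apply mul_left_cancel₀ this
        linear_combination ((c 0).im - (c i).im) * e2 - ((c k).im - (c i).im) * e1
  · rw [if_pos rfl]
    exact ⟨1, by omega, by rw [cw_rotate, cw_rotate]; exact h.base 1 one_pos (by omega)⟩

theorem WeakArc.side_nonneg {k : ℕ} {c : ℕ → ℂ} (h : WeakArc k c) {i j : ℕ} (hi : i ≤ k)
    (hj : j ≤ k) : 0 ≤ cw (c i) (c (if i = k then 0 else i + 1)) (c j) := by
  split_ifs with e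
  · subst e; rw [cw_rotate, cw_rotate]; exact h.tri 0 j i (by omega) hj le_rfl
  · rcases le_or_gt j i with hji | hij
    · rw [cw_rotate]; exact h.tri j i (i + 1) hji (by omega) (by omega)
    · exact h.tri i (i + 1) j (by omega) (by omega) hj

theorem coplanar_emb {ι : Type*} {o f g : E3} {p : ι → E3} {c : ι → ℂ} (hp : ∀ j, p j = emb o f g (c j)) :
    Coplanar ℝ (range p) := by
  rw [coplanar_iff_finrank_le_two]
  have hle : vectorSpan ℝ (range p) ≤ Submodule.span ℝ {f, g} := by
    rw [vectorSpan_def, Submodule.span_le]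
    rintro _ ⟨_, ⟨i, rfl⟩, _, ⟨j, rfl⟩, rfl⟩
    simp only [hp, vsub_eq_sub, emb_sub]
    exact Submodule.add_mem _ (Submodule.smul_mem _ _ (Submodule.subset_span (by simp)))
      (Submodule.smul_mem _ _ (Submodule.subset_span (by simp)))
  have : FiniteDimensional ℝ (Submodule.span ℝ ({f, g} : Set E3)) := inferInstance
  refine (Submodule.finrank_mono hle).trans ?_
  have := finrank_span_finset_le_card (R := ℝ) (M := E3) ({f, g} : Finset E3)
  rw [Set.finrank, Finset.coe_pair] at this
  exact this.trans Finset.card_le_two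

theorem WeakArc.isConvexPolygon {N n : ℕ} [NeZero n] (hn : N + 1 = n) (hN : 2 ≤ N) {c : ℕ → ℂ}
    (hc : WeakArc N c) {o f g : E3} (hfg : Orth f g) {p : Conf n}
    (hp : ∀ j : Fin n, p j = emb o f g (c j)) : IsConvexPolygon p := by
  refine ⟨(hc.planarSimple hN).isSimplePolygon hn hN hfg hp, coplanar_emb hp, fun i => ?_⟩
  subst hn
  have hs : p (i + 1) = emb o f g (c (if (i : ℕ) = N then 0 else i + 1)) := by
    rw [hp, val_add_one]
    simp only [add_left_inj]
  set e := c (if (i : ℕ) = N then 0 else i + 1) - c i with he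
  have hin : ∀ z : ℂ, inner ℝ (e.im • f + (-e.re) • g) (emb o f g z - p i) =
      cw (c i) (c (if (i : ℕ) = N then 0 else i + 1)) z := by
    intro z
    rw [hp, emb_sub, hfg.inner_comb, cw]
    ring
  refine ⟨e.im • f + (-e.re) • g, ?_, fun j => ?_, ?_⟩
  · rw [hs, hin, cw_self_right]
  · rw [hp j, hin]; exact hc.side_nonneg (by omega) (by omega)
  · obtain ⟨j, hj, h⟩ := hc.exists_side hN (i := i) (by omega)
    exact ⟨⟨j, by omega⟩, by rw [hp ⟨j, _⟩, hin]; exact h⟩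

theorem isStraight_iff {n : ℕ} [NeZero n] {p : Conf n} {j : Fin n} : IsStraight p j ↔
    p (j - 1) - p j ≠ 0 ∧ ∃ r < (0 : ℝ), p (j + 1) - p j = r • (p (j - 1) - p j) :=
  InnerProductGeometry.angle_eq_pi_iff

theorem not_isStraight_of_cw {n : ℕ} [NeZero n] {o f g : E3} (hfg : Orth f g) {p : Conf n}
    {a b c : ℂ} {j : Fin n} (h1 : p (j - 1) = emb o f g a) (h2 : p j = emb o f g b)
    (h3 : p (j + 1) = emb o f g c) (h : cw a b c ≠ 0) : ¬ IsStraight p j := by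
  rw [isStraight_iff]
  rintro ⟨-, r, -, e⟩
  rw [h1, h2, h3, emb_sub, emb_sub] at e
  have e1 : (0 : E3) = emb 0 f g 0 := (emb_zero _ _ _).symm
  have : emb 0 f g (c - b) = emb 0 f g (r • (a - b)) := by
    simp only [emb, zero_add, Complex.smul_re, Complex.smul_im, smul_eq_mul]
    rw [e]; module
  have := hfg.emb_injective 0 this
  apply h
  have e2 := congrArg Complex.re this
  have e3 := congrArg Complex.im this
  simp only [Complex.sub_re, Complex.sub_im, Complex.smul_re, Complex.smul_im, smul_eq_mul] at e2 e3
  simp only [cw, Complex.sub_re, Complex.sub_im]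
  linear_combination ((b).im - (a).im) * e2 - ((b).re - (a).re) * e3

/-! ### Projection to the base plane -/

/-- The projection to `Π_xy`. -/
def flat (x : E3) : E3 := !₂[x 0, x 1, 0]

theorem height_flat (x : E3) : height (flat x) = 0 := by simp [height, flat]

theorem hdist_eq (x y : E3) : hdist x y = dist (flat x) (flat y) := by
  rw [EuclideanSpace.dist_eq, hdist, Fin.sum_univ_three]
  simp [flat, Real.dist_eq, sq_abs]

theorem flat_of_height {x : E3} (h : height x = 0) : flat x = x := by
  ext i; fin_cases i <;> simp_all [flat, height]

theorem flat_lineMap (x y : E3) (s : ℝ) :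
    flat (AffineMap.lineMap x y s) = AffineMap.lineMap (flat x) (flat y) s := by
  ext i; fin_cases i <;> simp [flat, AffineMap.lineMap_apply]

theorem height_lineMap (x y : E3) (s : ℝ) :
    height (AffineMap.lineMap x y s) = (1 - s) * height x + s * height y := by
  simp [height, AffineMap.lineMap_apply]; ring

theorem hdist_self (x : E3) : hdist x x = 0 := by rw [hdist_eq, dist_self]

theorem hdist_comm (x y : E3) : hdist x y = hdist y x := by rw [hdist_eq, hdist_eq, dist_comm]

theorem hdist_triangle (x y z : E3) : hdist x z ≤ hdist x y + hdist y z := by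
  simp only [hdist_eq]; exact dist_triangle _ _ _

/-! ### Low chains: simplicity from the projection -/

/-- The part of the chain from the vertex `m` on, and `v_0`, are low and close to the original
position. -/
structure LowChain {n : ℕ} [NeZero n] (ε δ : ℝ) (p₀ p : Conf n) (m : ℕ) : Prop where
  le : ∀ j : Fin n, j = 0 ∨ m ≤ j → height (p j) ≤ ε
  near : ∀ j : Fin n, j = 0 ∨ m ≤ j → hdist (p j) (p₀ j) ≤ δ

theorem succ_low {n : ℕ} [NeZero n] {m : ℕ} {j : Fin n} (h : m ≤ (j : ℕ)) :
    j + 1 = 0 ∨ m ≤ ((j + 1 : Fin n) : ℕ) := by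
  have := val_add_one j
  split_ifs at this with e
  · exact .inl (Fin.ext this)
  · exact .inr (by omega)

section

variable {n : ℕ} [NeZero n] {ε δ : ℝ} {p₀ p : Conf n} {m : ℕ}

/-- Vertices outside the low part are put into their original positions, so that the condition on
entire displaced polygons can be applied to a part of the chain. -/
theorem LowChain.exists_displaced (h : LowChain ε δ p₀ p m) (hδ : 0 ≤ δ) (h0 : ∀ j, height (p₀ j) = 0) :
    ∃ q ∈ Displaced p₀ δ, (∀ j : Fin n, j = 0 ∨ m ≤ j → q j = flat (p j)) := by
  classical
  refine ⟨fun j => if j = 0 ∨ m ≤ j then flat (p j) else p₀ j, fun j => ?_, fun j hj => if_pos hj⟩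
  dsimp only
  split_ifs with hj
  · refine ⟨height_flat _, ?_⟩
    have := h.near j hj
    rwa [hdist_eq, flat_of_height (h0 j)] at this
  · exact ⟨h0 j, by rwa [dist_self]⟩

/-- A common point would project to a common point of two edges of a displaced polygon, which is
simple by the choice of `δ`. -/
theorem LowChain.edgePt_ne (h : LowChain ε δ p₀ p m) (hδ : DeltaOK p₀ δ) (h0 : ∀ j, height (p₀ j) = 0)
    {i j : Fin n} (hi : m ≤ i) (hj : m ≤ j) (hij : i ≠ j) {s t : ℝ} (hs : s ∈ Ico (0 : ℝ) 1)
    (ht : t ∈ Ico (0 : ℝ) 1) : edgePt p i s ≠ edgePt p j t := by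
  obtain ⟨q, hq, e⟩ := h.exists_displaced hδ.1.le h0
  intro e'
  refine (hδ.2.2.2 q hq).1.edgePt_ne hij hs ht ?_
  rw [edgePt, edgePt, e i (.inr hi), e j (.inr hj), e _ (succ_low hi), e _ (succ_low hj),
    ← flat_lineMap, ← flat_lineMap]
  exact congrArg flat e'

theorem LowChain.edgePt_ne_zero (h : LowChain ε δ p₀ p m) (hδ : DeltaOK p₀ δ)
    (h0 : ∀ j, height (p₀ j) = 0) (hm : 0 < m)
    {j : Fin n} (hj : m ≤ j) {t : ℝ} (ht : t ∈ Ico (0 : ℝ) 1) : edgePt p j t ≠ p 0 := by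
  obtain ⟨q, hq, e⟩ := h.exists_displaced hδ.1.le h0
  intro e'
  have hj0 : j ≠ 0 := by rintro rfl; simp at hj; omega
  refine (hδ.2.2.2 q hq).1.edgePt_ne hj0 ht (t := 0) ⟨le_rfl, one_pos⟩ ?_
  rw [edgePt_zero, edgePt, e j (.inr hj), e _ (succ_low hj), e 0 (.inl rfl), ← flat_lineMap]
  exact congrArg flat e'

theorem LowChain.ne_succ (h : LowChain ε δ p₀ p m) (hδ : DeltaOK p₀ δ)
    (h0 : ∀ j, height (p₀ j) = 0) {j : Fin n} (hj : m ≤ j) : p j ≠ p (j + 1) := by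
  obtain ⟨q, hq, e⟩ := h.exists_displaced hδ.1.le h0
  intro e'
  apply (hδ.2.2.2 q hq).1.2.1 j
  rw [e j (.inr hj), e _ (succ_low hj), e']

theorem LowChain.edgePt_le (h : LowChain ε δ p₀ p m) {j : Fin n} (hj : m ≤ j) {t : ℝ}
    (ht : t ∈ Icc (0 : ℝ) 1) : height (edgePt p j t) ≤ ε := by
  rw [edgePt, height_lineMap]
  have h1 := h.le j (.inr hj)
  have h2 := h.le _ (succ_low hj)
  nlinarith [ht.1, ht.2]

theorem LowChain.isSimplePolygon (h : LowChain ε δ p₀ p 0) (hδ : DeltaOK p₀ δ)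
    (h0 : ∀ j, height (p₀ j) = 0) (hn : 3 ≤ n) : IsSimplePolygon p :=
  isSimplePolygon_of_edgePt hn (fun _ => h.ne_succ hδ h0 (by omega))
    fun i j hij _ hs _ ht => h.edgePt_ne hδ h0 (by omega) (by omega) hij.ne hs ht

theorem val_succ_of_lt {n : ℕ} [NeZero n] {j : Fin n} {m : ℕ} (hm : m < n) (h : (j : ℕ) < m) :
    ((j + 1 : Fin n) : ℕ) = j + 1 := by rw [val_add_one, if_neg (by omega)]

/-- A low chain together with a simple planar chain that it avoids. -/
theorem LowChain.isSimplePolygon_of_planar (h : LowChain ε δ p₀ p m) (hδ : DeltaOK p₀ δ)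
    (h0 : ∀ j, height (p₀ j) = 0) (hn : 3 ≤ n) (hm : m < n) {o f g : E3} (hfg : Orth f g) {c : ℕ → ℂ}
    (hp : ∀ j : Fin n, (j : ℕ) ≤ m → p j = emb o f g (c j))
    (h1 : ∀ j < m, c j ≠ c (j + 1))
    (h2 : ∀ i j, i < j → j < m → ∀ s ∈ Ico (0 : ℝ) 1, ∀ t ∈ Ico (0 : ℝ) 1,
      AffineMap.lineMap (c i) (c (i + 1)) s ≠ AffineMap.lineMap (c j) (c (j + 1)) t)
    (h3 : ∀ i < m, ∀ s ∈ Ico (0 : ℝ) 1, ∀ j : Fin n, m ≤ j → ∀ t ∈ Ico (0 : ℝ) 1,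
      emb o f g (AffineMap.lineMap (c i) (c (i + 1)) s) ≠ edgePt p j t) : IsSimplePolygon p := by
  have hpt : ∀ i : Fin n, (i : ℕ) < m → ∀ s, edgePt p i s =
      emb o f g (AffineMap.lineMap (c i) (c (i + 1)) s) := by
    intro i hi s
    rw [edgePt, hp i hi.le, hp (i + 1) (by rw [val_succ_of_lt hm hi]; omega), val_succ_of_lt hm hi,
      lineMap_emb]
  refine isSimplePolygon_of_edgePt hn (fun i => ?_) fun i j hij s hs t ht => ?_
  · rcases lt_or_ge (i : ℕ) m with hi | hi
    · rw [hp i hi.le, hp (i + 1) (by rw [val_succ_of_lt hm hi]; omega), val_succ_of_lt hm hi]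
      exact fun e => h1 i hi (hfg.emb_injective o e)
    · exact h.ne_succ hδ h0 hi
  · rcases lt_or_ge (i : ℕ) m with hi | hi
    · rcases lt_or_ge (j : ℕ) m with hj | hj
      · rw [hpt i hi, hpt j hj]
        exact fun e => h2 i j hij hj s hs t ht (hfg.emb_injective o e)
      · rw [hpt i hi]; exact h3 i hi s hs j hj t ht
    · exact h.edgePt_ne hδ h0 hi (hi.trans hij.le) hij.ne hs ht

/-- A low chain together with a convex arc over the segment from `v_0` to `v_m`. -/
theorem LowChain.isSimplePolygon_of_arc (h : LowChain ε δ p₀ p m) (hδ : DeltaOK p₀ δ)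
    (h0 : ∀ j, height (p₀ j) = 0) (hn : 3 ≤ n) (hm : m < n) {f g : E3} (hfg : Orth f g) {c : ℕ → ℂ}
    (hp : ∀ j : Fin n, (j : ℕ) ≤ m → p j = emb (p 0) f g (c j)) (hm2 : 2 ≤ m) (hc : WeakArc m c)
    (hc0 : c 0 = 0) {b : ℝ} (hcm : c m = b) (hb : 0 < b)
    (h3 : ∀ z : ℂ, 0 < z.im → ∀ j : Fin n, m ≤ j → ∀ t ∈ Ico (0 : ℝ) 1,
      emb (p 0) f g z ≠ edgePt p j t) : IsSimplePolygon p := by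
  refine h.isSimplePolygon_of_planar hδ h0 hn hm hfg hp hc.ne
    (fun i j hij hj s hs t ht => hc.disjoint_edges hij hj hs ht) fun i hi s hs j hj t ht => ?_
  rcases hc.above_or hm2 hi hs with h4 | ⟨rfl, rfl⟩
  · refine h3 _ ?_ j hj t ht
    rw [hc0, hcm, cw] at h4
    simp only [sub_zero, Complex.ofReal_im, Complex.ofReal_re, mul_zero] at h4
    exact pos_of_mul_pos_left h4 hb.le
  · rw [AffineMap.lineMap_apply_zero, hc0, emb_zero]
    exact (h.edgePt_ne_zero hδ h0 (by omega) hj ht).symm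

end

end Arch
end

noncomputable section

namespace Arch

open Set Filter Topology

/-! ### Small displacements -/

theorem turn_rotate (a b c : E3) : turn b c a = turn a b c := by simp only [turn]; ring

theorem turn_flat (a b c : E3) : turn (flat a) (flat b) (flat c) = turn a b c := by simp [turn, flat]

theorem turn_lineMap (a b x y : E3) (s : ℝ) :
    turn a b (AffineMap.lineMap x y s) = (1 - s) * turn a b x + s * turn a b y := by
  simp [turn, AffineMap.lineMap_apply]; ring

theorem turn_self_left (a b : E3) : turn a b a = 0 := by simp [turn]

theorem turn_self_right (a b : E3) : turn a b b = 0 := by simp only [turn]; ring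

theorem continuous_turn : Continuous fun x : E3 × E3 × E3 => turn x.1 x.2.1 x.2.2 := by
  unfold turn; fun_prop

theorem ext_of_height {x y : E3} (hx : height x = height y) (h0 : x 0 = y 0) (h1 : x 1 = y 1) : x = y := by
  ext i; fin_cases i
  · exact h0
  · exact h1
  · exact hx

theorem exists_smul_of_turn {a b c : E3} (ha : height a = 0) (hb : height b = 0) (hc : height c = 0)
    (hab : a ≠ b) (h : turn a b c = 0) : ∃ r : ℝ, c - b = r • (a - b) := by
  simp only [turn] at h
  have hS : 0 < (a 0 - b 0) ^ 2 + (a 1 - b 1) ^ 2 := by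
    by_contra! hle
    apply hab
    refine ext_of_height (ha.trans hb.symm) ?_ ?_ <;> nlinarith [sq_nonneg (a 0 - b 0), sq_nonneg (a 1 - b 1)]
  refine ⟨((c 0 - b 0) * (a 0 - b 0) + (c 1 - b 1) * (a 1 - b 1)) / ((a 0 - b 0) ^ 2 + (a 1 - b 1) ^ 2), ?_⟩
  simp only [height] at ha hb hc
  refine ext_of_height ?_ ?_ ?_
  · simp [height, ha, hb, hc]
  · simp only [PiLp.sub_apply, PiLp.smul_apply, smul_eq_mul]
    rw [div_mul_eq_mul_div, eq_div_iff hS.ne']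
    linear_combination (a 1 - b 1) * h
  · simp only [PiLp.sub_apply, PiLp.smul_apply, smul_eq_mul]
    rw [div_mul_eq_mul_div, eq_div_iff hS.ne']
    linear_combination -(a 0 - b 0) * h

theorem isCompact_displaced {n : ℕ} (p : Conf n) (δ : ℝ) : IsCompact (Displaced p δ) := by
  have : Displaced p δ = univ.pi fun j => {x : E3 | height x = 0} ∩ Metric.closedBall (p j) δ := by
    ext q; simp [Displaced]
  rw [this]
  refine isCompact_univ_pi fun j => (isCompact_closedBall _ _).inter_left ?_
  exact isClosed_eq (by unfold height; fun_prop) continuous_const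

section

variable {n : ℕ} [NeZero n] {δ : ℝ} {p₀ p : Conf n}

/-- A collinear joint that is not straight folds back; then the far end of the shorter edge lies on
the other edge, against simplicity. -/
theorem IsSimplePolygon.turn_ne_zero (h : IsSimplePolygon p) (h0 : ∀ j, height (p j) = 0) {j : Fin n}
    (hj : ¬ IsStraight p j) : turn (p (j - 1)) (p j) (p (j + 1)) ≠ 0 := by
  intro ht
  have hinj := h.injective
  have hn := h.1
  have h1 : p (j - 1) ≠ p j := fun e => by
    have e := hinj e
    exact add_one_ne (by omega) (j - 1) (by rw [sub_add_cancel]; exact e.symm)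
  have h2 : p (j + 1) ≠ p j := fun e => add_one_ne (by omega) j (hinj e)
  obtain ⟨r, hr⟩ := exists_smul_of_turn (h0 _) (h0 _) (h0 _) h1 ht
  rcases lt_or_ge r 0 with hr0 | hr0
  · exact hj (isStraight_iff.2 ⟨sub_ne_zero.2 h1, r, hr0, hr⟩)
  have hr0 : 0 < r := hr0.lt_of_ne fun e => by
    rw [← e, zero_smul] at hr; exact h2 (sub_eq_zero.1 hr)
  have hadj := h.2.2.1 (j - 1)
  rw [sub_add_cancel] at hadj
  rcases le_or_gt r 1 with hr1 | hr1
  · have : p (j + 1) ∈ edge p (j - 1) ∩ edge p j := by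
      refine ⟨mem_edge.2 ⟨1 - r, ⟨by linarith, by linarith⟩, ?_⟩, mem_edge.2 ⟨1, ⟨zero_le_one, le_rfl⟩, edgePt_one p j⟩⟩
      rw [edgePt, sub_add_cancel, AffineMap.lineMap_apply, vsub_eq_sub, vadd_eq_add,
        sub_eq_iff_eq_add.1 hr]
      module
    rw [hadj] at this
    exact h2 this
  · have : p (j - 1) ∈ edge p (j - 1) ∩ edge p j := by
      refine ⟨mem_edge.2 ⟨0, ⟨le_rfl, zero_le_one⟩, edgePt_zero _ _⟩, mem_edge.2 ⟨r⁻¹, ⟨by positivity, inv_le_one_of_one_le₀ hr1.le⟩, ?_⟩⟩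
      rw [edgePt, AffineMap.lineMap_apply, vsub_eq_sub, vadd_eq_add, hr, smul_smul,
        inv_mul_cancel₀ hr0.ne', one_smul, sub_add_cancel]
    rw [hadj] at this
    exact h1 this

theorem not_isStraight_of_turn {j : Fin n} (h : turn (p (j - 1)) (p j) (p (j + 1)) ≠ 0) :
    ¬ IsStraight p j := by
  rw [isStraight_iff]
  rintro ⟨-, r, -, e⟩
  apply h
  have e0 := congrFun (congrArg WithLp.ofLp e) 0
  have e1 := congrFun (congrArg WithLp.ofLp e) 1
  simp only [PiLp.sub_apply, PiLp.smul_apply, smul_eq_mul] at e0 e1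
  simp only [turn]
  linear_combination (p j 0 - p (j - 1) 0) * e1 - (p j 1 - p (j - 1) 1) * e0

/-- Non-collinear adjacent edges meet only in their common vertex. Simplicity thus follows from
conditions that are stable under small displacements. -/
theorem isSimplePolygon_of_turn (hn : 3 ≤ n)
    (h1 : ∀ j, turn (p (j - 1)) (p j) (p (j + 1)) ≠ 0)
    (h2 : ∀ i j, j ≠ i → j ≠ i + 1 → i ≠ j + 1 → Disjoint (edge p i) (edge p j)) :
    IsSimplePolygon p := by
  have hne : ∀ i, p i ≠ p (i + 1) := fun i e => h1 i (by rw [← e, turn_self_right])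
  refine ⟨hn, hne, fun i => ?_, h2⟩
  refine Subset.antisymm (fun x hx => ?_) (singleton_subset_iff.2
      ⟨mem_edge.2 ⟨1, ⟨zero_le_one, le_rfl⟩, edgePt_one p i⟩,
        mem_edge.2 ⟨0, ⟨le_rfl, zero_le_one⟩, edgePt_zero p _⟩⟩)
  obtain ⟨s, hs, e⟩ := mem_edge.1 hx.1
  obtain ⟨t, ht, e'⟩ := mem_edge.1 hx.2
  have h := h1 (i + 1)
  rw [add_sub_cancel_right] at h
  have e2 : turn (p i) (p (i + 1)) x = 0 := by
    rw [← e, edgePt, turn_lineMap, turn_self_left, turn_self_right, mul_zero, mul_zero, add_zero]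
  rw [← e', edgePt, turn_lineMap, turn_self_right, mul_zero, zero_add] at e2
  have := (mul_eq_zero.1 e2).resolve_right h
  rw [← e', this, edgePt_zero]; rfl

theorem continuous_edgePt {X : Type*} [TopologicalSpace X] {f : X → Conf n} {g : X → ℝ}
    (hf : Continuous f) (hg : Continuous g) (i : Fin n) : Continuous fun x => edgePt (f x) i (g x) := by
  unfold edgePt
  simp only [AffineMap.lineMap_apply, vsub_eq_sub, vadd_eq_add]
  fun_prop

theorem isOpen_edgePt_ne (i j : Fin n) :
    IsOpen {z : Conf n × ℝ × ℝ | edgePt z.1 i z.2.1 ≠ edgePt z.1 j z.2.2} := by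
  have h1 : Continuous fun z : Conf n × ℝ × ℝ => edgePt z.1 i z.2.1 :=
    continuous_edgePt continuous_fst (continuous_fst.comp continuous_snd) i
  have h2 : Continuous fun z : Conf n × ℝ × ℝ => edgePt z.1 j z.2.2 :=
    continuous_edgePt continuous_fst (continuous_snd.comp continuous_snd) j
  exact isOpen_ne_fun h1 h2

/-- The tube lemma over the compact square of edge parameters. -/
theorem eventually_edgePt_ne {i j : Fin n} (h : Disjoint (edge p i) (edge p j)) :
    ∀ᶠ q in 𝓝 p, ∀ x ∈ Icc (0 : ℝ) 1 ×ˢ Icc (0 : ℝ) 1, edgePt q i x.1 ≠ edgePt q j x.2 := by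
  have hK : IsCompact (Icc (0 : ℝ) 1 ×ˢ Icc (0 : ℝ) 1) := isCompact_Icc.prod isCompact_Icc
  refine hK.eventually_forall_of_forall_eventually
    (P := fun q x => edgePt q i x.1 ≠ edgePt q j x.2) fun x hx => ?_
  refine (isOpen_edgePt_ne i j).mem_nhds ?_
  intro e
  exact disjoint_left.1 h (mem_edge.2 ⟨x.1, (mem_prod.1 hx).1, rfl⟩)
    (mem_edge.2 ⟨x.2, (mem_prod.1 hx).2, e.symm⟩)

theorem eventually_disjoint {i j : Fin n} (h : Disjoint (edge p i) (edge p j)) :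
    ∀ᶠ q in 𝓝 p, Disjoint (edge q i) (edge q j) := by
  refine (eventually_edgePt_ne h).mono fun q hq => ?_
  rw [disjoint_left]
  intro x hx hx'
  obtain ⟨s, hs, e⟩ := mem_edge.1 hx
  obtain ⟨t, ht, e'⟩ := mem_edge.1 hx'
  exact hq (s, t) (mk_mem_prod hs ht) (e.trans e'.symm)

theorem IsSimplePolygon.eventually (h : IsSimplePolygon p) (h0 : ∀ j, height (p j) = 0)
    (hs : ∀ j, ¬ IsStraight p j) :
    ∀ᶠ q in 𝓝 p, IsSimplePolygon q ∧ ∀ j, ¬ IsStraight q j := by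
  have h1 : ∀ᶠ q in 𝓝 p, ∀ j : Fin n, turn (q (j - 1)) (q j) (q (j + 1)) ≠ 0 := by
    rw [eventually_all]
    intro j
    have : Continuous fun q : Conf n => turn (q (j - 1)) (q j) (q (j + 1)) :=
      continuous_turn.comp (by fun_prop : Continuous fun q : Conf n => (q (j - 1), q j, q (j + 1)))
    exact this.continuousAt.eventually_ne (h.turn_ne_zero h0 (hs j))
  have h2 : ∀ᶠ q in 𝓝 p, ∀ i j : Fin n, j ≠ i → j ≠ i + 1 → i ≠ j + 1 → Disjoint (edge q i) (edge q j) := by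
    simp only [eventually_all]
    exact fun i j a b c => eventually_disjoint (h.2.2.2 i j a b c)
  filter_upwards [h1, h2] with q h1 h2
  exact ⟨isSimplePolygon_of_turn h.1 h1 h2, fun j => not_isStraight_of_turn (h1 j)⟩

theorem IsSimplePolygon.notMem_edge (h : IsSimplePolygon p) {j k : Fin n} (h1 : k ≠ j) (h2 : k + 1 ≠ j) :
    p j ∉ edge p k := by
  intro hm
  obtain ⟨s, hs, e⟩ := mem_edge.1 hm
  rcases hs.2.lt_or_eq with hs1 | rfl
  · exact h.edgePt_ne h1 ⟨hs.1, hs1⟩ (t := 0) ⟨le_rfl, one_pos⟩ (by rw [e, edgePt_zero])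
  · rw [edgePt_one] at e; exact h2 (h.injective e)

theorem exists_deltaOK (h : IsSimplePolygon p) (h0 : ∀ j, height (p j) = 0)
    (hs : ∀ j, ¬ IsStraight p j) : ∃ δ, DeltaOK p δ := by
  obtain ⟨r, hr, hball⟩ := Metric.eventually_nhds_iff.1 (h.eventually h0 hs)
  have lt : ∀ c : ℝ, 0 < c → ∀ᶠ d in 𝓝[>] (0 : ℝ), d < c := fun c hc =>
    mem_of_superset (Ioo_mem_nhdsGT hc) fun d hd => hd.2
  have h1 : ∀ᶠ d in 𝓝[>] (0 : ℝ), ∀ j k, k ≠ j → d < dist (p k) (p j) := by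
    simp only [eventually_all]
    exact fun j k hjk => lt _ (dist_pos.2 (h.injective.ne hjk))
  have h2 : ∀ᶠ d in 𝓝[>] (0 : ℝ), ∀ j k, k ≠ j → k + 1 ≠ j → ∀ x ∈ edge p k, d < dist x (p j) := by
    simp only [eventually_all]
    intro j k a b
    have hc : IsClosed (edge p k) := by
      rw [edge, segment_eq_image_lineMap]
      exact (isCompact_Icc.image (by fun_prop)).isClosed
    have hne : (edge p k).Nonempty := ⟨_, left_mem_segment _ _ _⟩
    have hpos := (hc.notMem_iff_infDist_pos hne).1 (h.notMem_edge a b)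
    filter_upwards [lt _ hpos] with d hd x hx
    rw [dist_comm]
    exact hd.trans_le (Metric.infDist_le_dist_of_mem hx)
  obtain ⟨d, ⟨h1, h2⟩, hd, hdr⟩ := ((h1.and h2).and (Ioo_mem_nhdsGT hr)).exists
  refine ⟨d, hd, h1, h2, fun q hq => hball ?_⟩
  exact ((dist_pi_le_iff hd.le).2 fun j => (hq j).2).trans_lt hdr

theorem DeltaOK.self_mem (h : DeltaOK p δ) (h0 : ∀ j, height (p j) = 0) : p ∈ Displaced p δ :=
  fun j => ⟨h0 j, by rw [dist_self]; exact h.1.le⟩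

theorem IsCompact.sInf_pos {S : Set ℝ} (hS : IsCompact S) (hne : S.Nonempty) (h : ∀ x ∈ S, 0 < x) : 0 < sInf S :=
  h _ (hS.sInf_mem hne)

/-- The set of separations is a finite union of continuous images of the compact set of displaced
polygons, so its infimum is attained by an actual displaced polygon. -/
theorem DeltaOK.sigma_pos (h : DeltaOK p δ) (h0 : ∀ j, height (p j) = 0) (hn : 2 ≤ n) :
    0 < sigma p δ := by
  have e : {s | ∃ q ∈ Displaced p δ, ∃ j k, j ≠ k ∧ s = dist (q j) (q k)} =
      ⋃ x : {x : Fin n × Fin n // x.1 ≠ x.2}, (fun q => dist (q x.1.1) (q x.1.2)) '' Displaced p δ := by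
    ext s
    simp only [mem_ofPred_eq, mem_iUnion, mem_image, Subtype.exists, Prod.exists]
    constructor
    · rintro ⟨q, hq, j, k, hjk, rfl⟩; exact ⟨j, k, hjk, q, hq, rfl⟩
    · rintro ⟨j, k, hjk, q, hq, rfl⟩; exact ⟨q, hq, j, k, hjk, rfl⟩
  rw [sigma]
  refine IsCompact.sInf_pos ?_ ⟨_, p, h.self_mem h0, 0, 0 + 1, (add_one_ne hn 0).symm, rfl⟩ ?_
  · rw [e]
    exact isCompact_iUnion fun x => (isCompact_displaced p δ).image (by fun_prop)
  · rintro s ⟨q, hq, j, k, hjk, rfl⟩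
    exact dist_pos.2 ((h.2.2.2 q hq).1.injective.ne hjk)

theorem DeltaOK.beta_pos (h : DeltaOK p δ) (h0 : ∀ j, height (p j) = 0) : 0 < beta p δ := by
  have e : {s | ∃ q ∈ Displaced p δ, ∃ j, s = Real.pi - jointAngle q j} =
      ⋃ j : Fin n, (fun q => Real.pi - jointAngle q j) '' Displaced p δ := by
    ext s
    simp only [mem_ofPred_eq, mem_iUnion, mem_image]
    constructor
    · rintro ⟨q, hq, j, rfl⟩; exact ⟨j, q, hq, rfl⟩
    · rintro ⟨j, q, hq, rfl⟩; exact ⟨q, hq, j, rfl⟩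
  rw [beta]
  refine IsCompact.sInf_pos ?_ ⟨_, p, h.self_mem h0, 0, rfl⟩ ?_
  · rw [e]
    refine isCompact_iUnion fun j => (isCompact_displaced p δ).image_of_continuousOn ?_
    intro q hq
    have hs := (h.2.2.2 q hq).1
    have h1 : q (j - 1) ≠ q j := by
      have := hs.2.1 (j - 1)
      rwa [sub_add_cancel] at this
    have := (EuclideanGeometry.continuousAt_angle (x := (q (j - 1), q j, q (j + 1))) h1 (hs.2.1 j).symm)
    have h2 : ContinuousAt (fun q : Conf n => (q (j - 1), q j, q (j + 1))) q := by fun_prop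
    exact (continuousAt_const.sub (this.comp_of_eq h2 rfl)).continuousWithinAt
  · rintro s ⟨q, hq, j, rfl⟩
    have h1 : jointAngle q j ≤ Real.pi := EuclideanGeometry.angle_le_pi _ _ _
    have h2 : jointAngle q j ≠ Real.pi := (h.2.2.2 q hq).2 j
    exact sub_pos.2 (h1.lt_of_ne h2)

/-- Replacing three consecutive vertices of `p₀` by the projections of the three points gives a
displaced polygon, which has no straight joint. -/
theorem DeltaOK.turn_ne_zero (h : DeltaOK p₀ δ) (h0 : ∀ j, height (p₀ j) = 0) (hn : 3 ≤ n) {k : Fin n}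
    {a v b : E3} (ha : hdist a (p₀ (k - 1)) ≤ δ) (hv : hdist v (p₀ k) ≤ δ)
    (hb : hdist b (p₀ (k + 1)) ≤ δ) : turn a v b ≠ 0 := by
  classical
  set q : Conf n := Function.update (Function.update (Function.update p₀ (k - 1) (flat a)) k (flat v))
    (k + 1) (flat b) with hq
  have e1 : k - 1 ≠ k := fun e => add_one_ne (by omega) (k - 1) (by rw [sub_add_cancel]; exact e.symm)
  have e2 : k + 1 ≠ k := add_one_ne (by omega) k
  have e3 : k - 1 ≠ k + 1 := fun e => add_two_ne hn (k - 1) (by rw [sub_add_cancel]; exact e.symm)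
  have q1 : q (k + 1) = flat b := by simp [hq]
  have q2 : q k = flat v := by simp [hq, e2.symm]
  have q3 : q (k - 1) = flat a := by simp [hq, e1, e3]
  have hm : q ∈ Displaced p₀ δ := by
    intro j
    by_cases h1 : j = k + 1
    · subst h1
      rw [q1]; exact ⟨height_flat _, by rwa [hdist_eq, flat_of_height (h0 _)] at hb⟩
    by_cases h2 : j = k
    · subst h2
      rw [q2]; exact ⟨height_flat _, by rwa [hdist_eq, flat_of_height (h0 _)] at hv⟩
    by_cases h3 : j = k - 1
    · subst h3
      rw [q3]; exact ⟨height_flat _, by rwa [hdist_eq, flat_of_height (h0 _)] at ha⟩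
    have : q j = p₀ j := by simp [hq, h1, h2, h3]
    rw [this]; exact ⟨h0 j, by rw [dist_self]; exact h.1.le⟩
  have := (h.2.2.2 q hm).1.turn_ne_zero (fun j => (hm j).1) ((h.2.2.2 q hm).2 k)
  rwa [q1, q2, q3, turn_flat] at this

end

/-- `|turn v b a|` is the length of `vb` times the altitude from `a`, in projection. If the altitude
were less than `η`, its foot, which is the witness in the proof, would be a point within `η` of `a`
on the line `vb`. -/
theorem le_abs_turn {v b a : E3} {η : ℝ} (h : ∀ a', hdist a' a ≤ η → turn v b a' ≠ 0) :
    η * hdist v b ≤ |turn v b a| := by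
  by_contra! hlt
  set T := turn v b a with hT
  set L := hdist v b with hL
  have hL0 : 0 ≤ L := Real.sqrt_nonneg _
  have hLp : 0 < L := hL0.lt_of_ne fun e => by
    rw [← e, mul_zero] at hlt; exact (abs_nonneg T).not_gt hlt
  have hL2 : (v 0 - b 0) ^ 2 + (v 1 - b 1) ^ 2 = L ^ 2 := (Real.sq_sqrt (by positivity)).symm
  refine h !₂[a 0 + T / L ^ 2 * (b 1 - v 1), a 1 - T / L ^ 2 * (b 0 - v 0), 0] ?_ ?_
  · have e : hdist !₂[a 0 + T / L ^ 2 * (b 1 - v 1), a 1 - T / L ^ 2 * (b 0 - v 0), 0] a = |T| / L := by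
      rw [hdist]
      simp only [Matrix.cons_val_zero, Matrix.cons_val_one]
      rw [show |T| / L = |T / L| by rw [abs_div, abs_of_pos hLp], ← Real.sqrt_sq_eq_abs]
      congr 1
      field_simp
      linear_combination T ^ 2 * hL2
    rw [e, div_le_iff₀ hLp]
    exact hlt.le
  · have : (b 0 - v 0) ^ 2 + (b 1 - v 1) ^ 2 = L ^ 2 := by rw [← hL2]; ring
    simp only [turn, Matrix.cons_val_zero, Matrix.cons_val_one] at hT ⊢
    have : T - T / L ^ 2 * ((b 0 - v 0) ^ 2 + (b 1 - v 1) ^ 2) = 0 := by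
      rw [this]; field_simp; ring
    rw [← this]
    linear_combination -hT

/-- The altitudes of the triangle of three consecutive vertices are bounded below. -/
theorem DeltaOK.le_turn {n : ℕ} [NeZero n] {δ : ℝ} {p₀ : Conf n} (h : DeltaOK p₀ δ)
    (h0 : ∀ j, height (p₀ j) = 0) (hn : 3 ≤ n) {k : Fin n} {a v b : E3}
    (ha : hdist a (p₀ (k - 1)) ≤ δ / 2) (hv : hdist v (p₀ k) ≤ δ / 2) (hb : hdist b (p₀ (k + 1)) ≤ δ / 2) :
    δ / 2 * hdist a v ≤ |turn a v b| ∧ δ / 2 * hdist v b ≤ |turn a v b| ∧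
      δ / 2 * hdist b a ≤ |turn a v b| := by
  have hδ := h.1
  refine ⟨le_abs_turn fun x hx => h.turn_ne_zero h0 hn (by linarith) (by linarith) ?_, ?_, ?_⟩
  · linarith [hdist_triangle x b (p₀ (k + 1))]
  · rw [← turn_rotate]
    refine le_abs_turn fun x hx => ?_
    rw [turn_rotate]
    exact h.turn_ne_zero h0 hn (by linarith [hdist_triangle x a (p₀ (k - 1))]) (by linarith) (by linarith)
  · rw [← turn_rotate, ← turn_rotate]
    refine le_abs_turn fun x hx => ?_
    rw [turn_rotate, turn_rotate]
    exact h.turn_ne_zero h0 hn (by linarith) (by linarith [hdist_triangle x v (p₀ k)]) (by linarith)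

end Arch
end

noncomputable section

namespace Arch

open Set Filter Topology

/-! ### Coordinates and rotations -/

theorem inner_eq (x y : E3) : inner ℝ x y = x 0 * y 0 + x 1 * y 1 + x 2 * y 2 := by
  rw [PiLp.inner_apply, Fin.sum_univ_three]
  simp only [RCLike.inner_apply, conj_trivial]
  ring

theorem norm_sq_eq (x : E3) : ‖x‖ ^ 2 = x 0 ^ 2 + x 1 ^ 2 + x 2 ^ 2 := by
  rw [← real_inner_self_eq_norm_sq, inner_eq]; ring

theorem cross_zero_apply (u v : E3) : cross u v 0 = u 1 * v 2 - u 2 * v 1 := by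
  simp [cross, cross_apply]

theorem cross_one_apply (u v : E3) : cross u v 1 = u 2 * v 0 - u 0 * v 2 := by
  simp [cross, cross_apply]

theorem cross_two_apply (u v : E3) : cross u v 2 = u 0 * v 1 - u 1 * v 0 := by
  simp [cross, cross_apply]

theorem E3.ext {x y : E3} (h0 : x 0 = y 0) (h1 : x 1 = y 1) (h2 : x 2 = y 2) : x = y :=
  ext_of_height h2 h0 h1

theorem inner_cross_left (u v : E3) : inner ℝ u (cross u v) = 0 := by
  rw [inner_eq, cross_zero_apply, cross_one_apply, cross_two_apply]; ring

theorem inner_cross_right (u v : E3) : inner ℝ v (cross u v) = 0 := by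
  rw [inner_eq, cross_zero_apply, cross_one_apply, cross_two_apply]; ring

theorem norm_cross_sq (u v : E3) : ‖cross u v‖ ^ 2 = ‖u‖ ^ 2 * ‖v‖ ^ 2 - (inner ℝ u v) ^ 2 := by
  rw [norm_sq_eq, norm_sq_eq, norm_sq_eq, inner_eq, cross_zero_apply, cross_one_apply, cross_two_apply]
  ring

theorem cross_add (u v w : E3) : cross u (v + w) = cross u v + cross u w := by
  refine E3.ext ?_ ?_ ?_ <;>
    simp only [PiLp.add_apply, cross_zero_apply, cross_one_apply, cross_two_apply] <;> ring

theorem cross_smul (u v : E3) (r : ℝ) : cross u (r • v) = r • cross u v := by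
  refine E3.ext ?_ ?_ ?_ <;>
    simp only [PiLp.smul_apply, smul_eq_mul, cross_zero_apply, cross_one_apply, cross_two_apply] <;> ring

theorem cross_self (u : E3) : cross u u = 0 := by
  refine E3.ext ?_ ?_ ?_ <;>
    simp only [PiLp.zero_apply, cross_zero_apply, cross_one_apply, cross_two_apply] <;> ring

theorem cross_sub (u v w : E3) : cross u (v - w) = cross u v - cross u w := by
  refine E3.ext ?_ ?_ ?_ <;>
    simp only [PiLp.sub_apply, cross_zero_apply, cross_one_apply, cross_two_apply] <;> ring

/-- The direction of the line from `a` to `b`. -/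
def dir (a b : E3) : E3 := ‖b - a‖⁻¹ • (b - a)

theorem norm_dir {a b : E3} (h : a ≠ b) : ‖dir a b‖ = 1 := by
  have : ‖b - a‖ ≠ 0 := norm_ne_zero_iff.2 (sub_ne_zero.2 h.symm)
  rw [dir, norm_smul, norm_inv, norm_norm, inv_mul_cancel₀ this]

theorem norm_smul_dir {a b : E3} (h : a ≠ b) : ‖b - a‖ • dir a b = b - a := by
  have : ‖b - a‖ ≠ 0 := norm_ne_zero_iff.2 (sub_ne_zero.2 h.symm)
  rw [dir, smul_smul, mul_inv_cancel₀ this, one_smul]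

theorem rotateAbout_eq (a b : E3) (θ : ℝ) (x : E3) : rotateAbout a b θ x =
    a + Real.cos θ • (x - a) + Real.sin θ • cross (dir a b) (x - a)
      + ((1 - Real.cos θ) * inner ℝ (dir a b) (x - a)) • dir a b := rfl

theorem rotateAbout_zero (a b x : E3) : rotateAbout a b 0 x = x := by
  rw [rotateAbout_eq, Real.cos_zero, Real.sin_zero]; simp

theorem rotateAbout_left (a b : E3) (θ : ℝ) : rotateAbout a b θ a = a := by
  have : cross (dir a b) (0 : E3) = 0 := by
    have := cross_smul (dir a b) 0 0
    rwa [zero_smul, zero_smul] at this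
  rw [rotateAbout_eq, sub_self, this]; simp

theorem rotateAbout_right {a b : E3} (h : a ≠ b) (θ : ℝ) : rotateAbout a b θ b = b := by
  rw [rotateAbout_eq]
  have e := norm_smul_dir h
  have e1 : inner ℝ (dir a b) (dir a b) = (1 : ℝ) := by
    rw [real_inner_self_eq_norm_sq, norm_dir h]; norm_num
  have hb : b = a + ‖b - a‖ • dir a b := by rw [e]; abel
  rw [← e, cross_smul, cross_self, inner_smul_right, e1]
  nth_rw 6 [hb]
  module

theorem dist_rotateAbout {a b : E3} (h : a ≠ b) (θ : ℝ) (x y : E3) :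
    dist (rotateAbout a b θ x) (rotateAbout a b θ y) = dist x y := by
  set u := dir a b with hu
  have hu1 : ‖u‖ = 1 := norm_dir h
  rw [dist_eq_norm, dist_eq_norm]
  set z := x - y with hz
  have e : rotateAbout a b θ x - rotateAbout a b θ y = Real.cos θ • z + Real.sin θ • cross u z +
      ((1 - Real.cos θ) * inner ℝ u z) • u := by
    have h1 : cross u z = cross u (x - a) - cross u (y - a) := by rw [← cross_sub]; congr 1; rw [hz]; abel
    have h2 : (inner ℝ u z : ℝ) = inner ℝ u (x - a) - inner ℝ u (y - a) := by
      rw [← inner_sub_right]; congr 1; rw [hz]; abel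
    rw [rotateAbout_eq, rotateAbout_eq, ← hu, h1, h2, hz]
    module
  rw [e]
  refine (sq_eq_sq₀ (norm_nonneg _) (norm_nonneg _)).1 ?_
  rw [← real_inner_self_eq_norm_sq]
  have i1 : inner ℝ u u = (1 : ℝ) := by rw [real_inner_self_eq_norm_sq, hu1]; norm_num
  have i2 : inner ℝ z z = ‖z‖ ^ 2 := real_inner_self_eq_norm_sq z
  have i3 : inner ℝ (cross u z) (cross u z) = ‖z‖ ^ 2 - (inner ℝ u z) ^ 2 := by
    rw [real_inner_self_eq_norm_sq, norm_cross_sq, hu1]; ring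
  have i4 : inner ℝ (cross u z) u = (0 : ℝ) := by rw [real_inner_comm]; exact inner_cross_left u z
  have i5 : inner ℝ (cross u z) z = (0 : ℝ) := by rw [real_inner_comm]; exact inner_cross_right u z
  have i6 : inner ℝ z u = (inner ℝ u z : ℝ) := real_inner_comm _ _
  simp only [inner_add_left, inner_add_right, real_inner_smul_left, real_inner_smul_right, i1, i2, i3, i4,
    i5, i6, inner_cross_left, inner_cross_right]
  linear_combination (‖z‖ ^ 2 - (inner ℝ u z) ^ 2) * Real.sin_sq_add_cos_sq θ

theorem continuous_rotateAbout (a b x : E3) : Continuous fun θ => rotateAbout a b θ x := by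
  simp only [rotateAbout_eq]; fun_prop

/-! ### Lifting a vertex -/

/-- The function is the height of the vertex after a rotation by `φ`: `A` is the initial rate of
ascent and `Z` a small correction. Up to `π / 4` the cosine is at least `0.7`, so the derivative
stays positive; at `π / 4` the height exceeds `A / 2`, hence `ε`. -/
theorem exists_angle {A Z ε : ℝ} (hA : 0 < A) (hZ : |Z| ≤ A / 100) (hε : 0 < ε) (hεA : ε ≤ A / 2) :
    ∃ θ, 0 < θ ∧ θ ≤ Real.pi / 4 ∧
      StrictMonoOn (fun φ => Z * (1 - Real.cos φ) + A * Real.sin φ) (Icc 0 θ) ∧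
      Z * (1 - Real.cos θ) + A * Real.sin θ = ε := by
  have hπ := Real.pi_pos
  have h2 : (1.4 : ℝ) ≤ √2 := Real.le_sqrt_of_sq_le (by norm_num)
  have hd : ∀ φ : ℝ, HasDerivAt (fun φ => Z * (1 - Real.cos φ) + A * Real.sin φ)
      (Z * Real.sin φ + A * Real.cos φ) φ := by
    intro φ
    have := (((Real.hasDerivAt_cos φ).const_sub 1).const_mul Z).fun_add ((Real.hasDerivAt_sin φ).const_mul A)
    exact this.congr_deriv (by ring)
  have hZ' := abs_le.1 hZ
  have hmono : StrictMonoOn (fun φ => Z * (1 - Real.cos φ) + A * Real.sin φ) (Icc 0 (Real.pi / 4)) := by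
    refine strictMonoOn_of_deriv_pos (convex_Icc _ _) (by fun_prop) fun φ hφ => ?_
    rw [interior_Icc] at hφ
    rw [(hd φ).deriv]
    have h1 : Real.cos (Real.pi / 4) ≤ Real.cos φ :=
      Real.cos_le_cos_of_nonneg_of_le_pi hφ.1.le (by linarith) hφ.2.le
    rw [Real.cos_pi_div_four] at h1
    have h3 := Real.sin_nonneg_of_nonneg_of_le_pi hφ.1.le (by linarith [hφ.2])
    have h4 := Real.sin_le_one φ
    nlinarith
  have hend : ε < Z * (1 - Real.cos (Real.pi / 4)) + A * Real.sin (Real.pi / 4) := by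
    rw [Real.cos_pi_div_four, Real.sin_pi_div_four]
    have h3 : √2 ≤ 1.5 := Real.sqrt_le_iff.2 (by norm_num)
    nlinarith
  obtain ⟨θ, hθ, e⟩ := intermediate_value_Icc (by positivity : (0 : ℝ) ≤ Real.pi / 4)
    (f := fun φ => Z * (1 - Real.cos φ) + A * Real.sin φ) (by fun_prop) ⟨by simpa using hε.le, hend.le⟩
  refine ⟨θ, hθ.1.lt_of_ne ?_, hθ.2, hmono.mono (Icc_subset_Icc_right hθ.2), e⟩
  rintro rfl
  simp at e
  exact hε.ne e

theorem norm_flat_le (x : E3) : ‖flat x‖ ≤ ‖x‖ := by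
  refine (sq_le_sq₀ (norm_nonneg _) (norm_nonneg _)).1 ?_
  rw [norm_sq_eq, norm_sq_eq]
  simp [flat]
  positivity

theorem flat_add (x y : E3) : flat (x + y) = flat x + flat y := by
  refine E3.ext ?_ ?_ ?_ <;> simp [flat]

theorem flat_smul (r : ℝ) (x : E3) : flat (r • x) = r • flat x := by
  refine E3.ext ?_ ?_ ?_ <;> simp [flat]

theorem hdist_eq_norm (x y : E3) : hdist x y = ‖flat (x - y)‖ := by
  rw [hdist_eq, dist_eq_norm]
  congr 1
  refine E3.ext ?_ ?_ ?_ <;> simp [flat]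

theorem abs_turn_le (a v b : E3) : |turn a v b| ≤ hdist a v * hdist a b := by
  have h1 : hdist a v ^ 2 = (a 0 - v 0) ^ 2 + (a 1 - v 1) ^ 2 := Real.sq_sqrt (by positivity)
  have h2 : hdist a b ^ 2 = (a 0 - b 0) ^ 2 + (a 1 - b 1) ^ 2 := Real.sq_sqrt (by positivity)
  refine abs_le_of_sq_le_sq ?_ (mul_nonneg (Real.sqrt_nonneg _) (Real.sqrt_nonneg _))
  rw [mul_pow, h1, h2, turn]
  nlinarith [sq_nonneg ((a 0 - v 0) * (a 0 - b 0) + (a 1 - v 1) * (a 1 - b 1))]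

/-- The displacement is the sum of a part towards the axis, `1 - cos θ` times the distance from it,
and a part along the cross product. The latter is almost vertical in the application, so its
projection is kept as a separate term. -/
theorem hdist_rotateAbout_le {a b : E3} (h : a ≠ b) (θ : ℝ) (v : E3) :
    hdist (rotateAbout a b θ v) v ≤ (1 - Real.cos θ) * ‖cross (dir a b) (v - a)‖ +
      |Real.sin θ| * ‖flat (cross (dir a b) (v - a))‖ := by
  set u := dir a b with hu
  set r := v - a with hr
  have hu1 : ‖u‖ = 1 := norm_dir h
  have hc : 0 ≤ 1 - Real.cos θ := sub_nonneg.2 (Real.cos_le_one θ)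
  have e : rotateAbout a b θ v - v = -((1 - Real.cos θ) • (r - (inner ℝ u r : ℝ) • u)) + Real.sin θ • cross u r := by
    have hv : v = a + r := by rw [hr]; abel
    rw [rotateAbout_eq, ← hu, ← hr]
    nth_rw 1 [hv]
    module
  have hn : ‖r - (inner ℝ u r : ℝ) • u‖ = ‖cross u r‖ := by
    refine (sq_eq_sq₀ (norm_nonneg _) (norm_nonneg _)).1 ?_
    rw [norm_cross_sq, hu1, norm_sub_sq_real, norm_smul, hu1, real_inner_smul_right, real_inner_comm, Real.norm_eq_abs,
      mul_one, sq_abs]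
    ring
  rw [hdist_eq_norm, e, flat_add, flat_smul]
  refine (norm_add_le _ _).trans (add_le_add ?_ ?_)
  · refine (norm_flat_le _).trans ?_
    rw [norm_neg, norm_smul, hn, Real.norm_eq_abs, abs_of_nonneg hc]
  · rw [norm_smul, Real.norm_eq_abs]

/-- For horizontal `u` and `r` the cross product is vertical; the two terms account for the height
of `r` and for the tilt of `u`. -/
theorem norm_flat_cross_le {u r : E3} (hu : ‖u‖ = 1) : ‖flat (cross u r)‖ ≤ |r 2| + |u 2| * ‖flat r‖ := by
  have e : flat (cross u r) = r 2 • !₂[u 1, -u 0, 0] + u 2 • !₂[-r 1, r 0, 0] := by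
    refine E3.ext ?_ ?_ ?_ <;>
      simp only [flat, PiLp.add_apply, PiLp.smul_apply, smul_eq_mul, cross_zero_apply, cross_one_apply] <;> simp <;> ring
  have h1 : ‖(!₂[u 1, -u 0, 0] : E3)‖ ≤ 1 := by
    rw [← hu]
    refine (sq_le_sq₀ (norm_nonneg _) (norm_nonneg _)).1 ?_
    rw [norm_sq_eq, norm_sq_eq]
    simp
    nlinarith [sq_nonneg (u 2)]
  have h2 : ‖(!₂[-r 1, r 0, 0] : E3)‖ ≤ ‖flat r‖ := by
    refine (sq_le_sq₀ (norm_nonneg _) (norm_nonneg _)).1 ?_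
    rw [norm_sq_eq, norm_sq_eq]
    simp [flat]
    linarith
  rw [e]
  refine (norm_add_le _ _).trans (add_le_add ?_ ?_)
  · rw [norm_smul, Real.norm_eq_abs]; exact mul_le_of_le_one_right (abs_nonneg _) h1
  · rw [norm_smul, Real.norm_eq_abs]; gcongr

theorem height_rotateAbout {a b v : E3} (hv : height v = 0) (θ : ℝ) : height (rotateAbout a b θ v) =
    (height a + inner ℝ (dir a b) (v - a) * dir a b 2) * (1 - Real.cos θ) +
      cross (dir a b) (v - a) 2 * Real.sin θ := by
  rw [rotateAbout_eq]
  simp only [height, PiLp.add_apply, PiLp.smul_apply, smul_eq_mul, PiLp.sub_apply] at hv ⊢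
  rw [hv]; ring

theorem norm_le_flat_add (x : E3) : ‖x‖ ≤ ‖flat x‖ + |x 2| := by
  refine (sq_le_sq₀ (norm_nonneg _) (by positivity)).1 ?_
  have h1 : ‖flat x‖ ^ 2 = x 0 ^ 2 + x 1 ^ 2 := by rw [norm_sq_eq]; simp [flat]
  rw [norm_sq_eq]
  nlinarith [sq_abs (x 2), mul_nonneg (norm_nonneg (flat x)) (abs_nonneg (x 2))]

/-- The estimates for lifting a vertex of a triangle whose altitudes are large. -/
theorem lift_estimates {a v b : E3} {ε η : ℝ} (hε : 0 < ε) (hη : 500 * ε ≤ η) (ha0 : 0 ≤ height a)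
    (ha : height a ≤ ε) (hb0 : 0 ≤ height b) (hb : height b ≤ ε) (hv : height v = 0)
    (hT : turn a v b ≠ 0) (h1 : η * hdist a v ≤ |turn a v b|) (h3 : η * hdist b a ≤ |turn a v b|) :
    a ≠ b ∧ η ≤ 1.002 * |cross (dir a b) (v - a) 2| ∧
    |height a + inner ℝ (dir a b) (v - a) * dir a b 2| ≤ |cross (dir a b) (v - a) 2| / 100 ∧
    ‖cross (dir a b) (v - a)‖ ≤ 1.01 * |cross (dir a b) (v - a) 2| ∧
    ‖flat (cross (dir a b) (v - a))‖ * η ≤ 2.01 * (ε * |cross (dir a b) (v - a) 2|) := by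
  have hη0 : 0 < η := by linarith
  have hab : a ≠ b := by rintro rfl; exact hT (turn_self_left _ _)
  set u := dir a b with hu
  set r := v - a with hr
  set A := |cross u r 2| with hA
  set L := ‖b - a‖ with hL
  have hL0 : 0 < L := norm_pos_iff.2 (sub_ne_zero.2 hab.symm)
  have hu1 : ‖u‖ = 1 := norm_dir hab
  have hLu : L • u = b - a := norm_smul_dir hab
  have hLc : ∀ i, L * u i = b i - a i := fun i => by
    have := congrArg (fun x : E3 => x i) hLu
    simpa using this
  have hT0 : 0 < |turn a v b| := abs_pos.2 hT
  -- Twice the area of the projected triangle. Since the base is nearly horizontal, `A` is nearly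
  -- the altitude from `v`.
  have hAL : A * L = |turn a v b| := by
    rw [hA, ← abs_of_pos hL0, ← abs_mul, ← abs_neg (turn a v b), cross_two_apply, turn]
    congr 1
    simp only [hr, PiLp.sub_apply]
    linear_combination (v 1 - a 1) * hLc 0 - (v 0 - a 0) * hLc 1
  have hhav : hdist a v = ‖flat r‖ := by rw [hdist_comm, hdist_eq_norm]
  have hTle := abs_turn_le a v b
  have hav0 : 0 ≤ hdist a v := Real.sqrt_nonneg _
  have hba0 : 0 ≤ hdist b a := Real.sqrt_nonneg _
  rw [hdist_comm a b] at hTle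
  have hav : 0 < hdist a v := hav0.lt_of_ne fun e => by rw [← e, zero_mul] at hTle; linarith
  -- An altitude is at most as long as a side from the same vertex.
  have hba : η ≤ hdist b a := by
    by_contra! hlt
    have := mul_lt_mul_of_pos_left hlt hav
    linarith
  have hu2 : |u 2| * L ≤ ε := by
    rw [← abs_of_pos hL0, ← abs_mul, mul_comm, hLc, abs_le]
    simp only [height] at ha0 ha hb0 hb
    constructor <;> linarith
  -- The factor is `1 + 1 / 500`: the heights of `a` and `b` differ by at most `ε ≤ η / 500`.
  have hLle : L ≤ 1.002 * hdist b a := by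
    have := norm_le_flat_add (b - a)
    rw [← hL, ← hdist_eq_norm] at this
    have h4 : |(b - a) 2| ≤ ε := by
      rw [PiLp.sub_apply, abs_le]
      simp only [height] at ha0 ha hb0 hb
      constructor <;> linarith
    linarith
  have hA0 : 0 < A := by
    by_contra! hle
    have := mul_nonpos_of_nonpos_of_nonneg hle hL0.le
    linarith
  have hAη : η ≤ 1.002 * A := by
    by_contra! hlt
    have h4 := mul_lt_mul_of_pos_right hlt (hη0.trans_le hba)
    have h5 := mul_le_mul_of_nonneg_left hLle hA0.le
    linarith
  have hAε : 500 * (ε * A) ≤ A * η := by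
    have := mul_le_mul_of_nonneg_left hη hA0.le
    linarith
  have hu2av : |u 2| * hdist a v * η ≤ ε * A := by
    have : |u 2| * hdist a v * η ≤ |u 2| * L * A := by
      have := mul_le_mul_of_nonneg_left h1 (abs_nonneg (u 2))
      rw [← hAL] at this
      linarith
    have h4 := mul_le_mul_of_nonneg_right hu2 hA0.le
    linarith
  have hu21 : |u 2| ≤ 1 := by
    have := norm_sq_eq u
    rw [hu1] at this
    rw [abs_le_one_iff_mul_self_le_one]
    nlinarith [sq_nonneg (u 0), sq_nonneg (u 1)]
  have hr2 : |r 2| ≤ ε := by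
    simp only [height] at ha0 ha hv
    rw [hr, PiLp.sub_apply, hv, zero_sub, abs_neg, abs_of_nonneg ha0]; exact ha
  have hεη : ε * η ≤ 1.002 * (ε * A) := by
    have := mul_le_mul_of_nonneg_left hAη hε.le
    linarith
  have hK : ‖flat (cross u r)‖ * η ≤ 2.01 * (ε * A) := by
    have := norm_flat_cross_le (r := r) hu1
    rw [← hhav] at this
    have h5 : ‖flat (cross u r)‖ * η ≤ (ε + |u 2| * hdist a v) * η := by gcongr; linarith
    have h6 : 0 ≤ ε * A := by positivity
    linarith
  have hKA : ‖flat (cross u r)‖ ≤ 0.01 * A := by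
    by_contra! hlt
    have : 0.01 * A * η < 2.01 * (ε * A) := lt_of_lt_of_le (mul_lt_mul_of_pos_right hlt hη0) hK
    have : 0 < ε * A := by positivity
    linarith
  refine ⟨hab, hAη, ?_, ?_, hK⟩
  · have h5 : |inner ℝ u r| ≤ hdist a v + ε := by
      have := abs_real_inner_le_norm u r
      rw [hu1, one_mul] at this
      have h6 := norm_le_flat_add r
      rw [← hhav] at h6
      linarith
    have h6 : |height a + inner ℝ u r * u 2| ≤ ε + (hdist a v + ε) * |u 2| := by
      refine (abs_add_le _ _).trans (add_le_add ?_ ?_)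
      · rw [abs_of_nonneg ha0]; exact ha
      · rw [abs_mul]; gcongr
    refine h6.trans ?_
    have h7 : ε * |u 2| ≤ ε := mul_le_of_le_one_right hε.le hu21
    have h8 : |u 2| * hdist a v ≤ A / 500 := by
      by_contra! hlt
      have : A / 500 * η < ε * A := lt_of_lt_of_le (mul_lt_mul_of_pos_right hlt hη0) hu2av
      linarith
    linarith
  · have := norm_le_flat_add (cross u r)
    linarith

/-- The sense of rotation is the one in which the vertex rises. Until height `ε` is reached, `sin φ`
is at most `ε / (0.99 A)`, so the projection moves by a few `ε`, well within `η`. -/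
theorem exists_lift_angle {a v b : E3} {ε η : ℝ} (hε : 0 < ε) (hη : 500 * ε ≤ η) (ha0 : 0 ≤ height a)
    (ha : height a ≤ ε) (hb0 : 0 ≤ height b) (hb : height b ≤ ε) (hv : height v = 0)
    (hT : turn a v b ≠ 0) (h1 : η * hdist a v ≤ |turn a v b|) (h3 : η * hdist b a ≤ |turn a v b|) :
    ∃ θ : ℝ, StrictMonoOn (fun t => height (rotateAbout a b (t * θ) v)) (Icc 0 1) ∧
      height (rotateAbout a b θ v) = ε ∧
      ∀ t ∈ Icc (0 : ℝ) 1, hdist (rotateAbout a b (t * θ) v) v ≤ η := by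
  obtain ⟨hab, e1, e2, e3, e4⟩ := lift_estimates hε hη ha0 ha hb0 hb hv hT h1 h3
  simp only [height_rotateAbout hv]
  have hη0 : 0 < η := by linarith
  set Z := height a + inner ℝ (dir a b) (v - a) * dir a b 2 with hZ
  set w := cross (dir a b) (v - a) 2 with hw
  set A := |w| with hA
  have hA0 : 0 < A := by nlinarith
  obtain ⟨σ, hσ, hσw⟩ : ∃ σ : ℝ, (σ = 1 ∨ σ = -1) ∧ w * σ = A := by
    rcases le_total 0 w with h | h
    · exact ⟨1, .inl rfl, by rw [hA, abs_of_nonneg h, mul_one]⟩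
    · exact ⟨-1, .inr rfl, by rw [hA, abs_of_nonpos h]; ring⟩
  have hcos : ∀ x, Real.cos (σ * x) = Real.cos x := by
    intro x; rcases hσ with rfl | rfl <;> simp
  have hsin : ∀ x, w * Real.sin (σ * x) = A * Real.sin x := by
    intro x; rw [← hσw]; rcases hσ with rfl | rfl <;> simp
  obtain ⟨θ, hθ0, hθ4, hmono, hend⟩ := exists_angle hA0 e2 hε (by linarith)
  have hmem : ∀ t ∈ Icc (0 : ℝ) 1, t * θ ∈ Icc 0 θ := fun t ht =>
    ⟨mul_nonneg ht.1 hθ0.le, mul_le_of_le_one_left hθ0.le ht.2⟩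
  refine ⟨σ * θ, ?_, ?_, fun t ht => ?_⟩
  · intro s hs t ht hst
    dsimp only
    rw [mul_left_comm, mul_left_comm t, hcos, hcos, hsin, hsin]
    exact hmono (hmem s hs) (hmem t ht) (mul_lt_mul_of_pos_right hst hθ0)
  · rw [hcos, hsin]; exact hend
  · have hφ := hmem t ht
    have hle : Z * (1 - Real.cos (t * θ)) + A * Real.sin (t * θ) ≤ ε := by
      rw [← hend]; exact hmono.monotoneOn hφ (right_mem_Icc.2 hθ0.le) hφ.2
    refine (hdist_rotateAbout_le hab _ v).trans ?_
    rw [mul_left_comm, hcos]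
    have habs : |Real.sin (σ * (t * θ))| = |Real.sin (t * θ)| := by
      rcases hσ with rfl | rfl <;> simp
    rw [habs]
    set φ := t * θ with hφdef
    have hπ := Real.pi_pos
    have hs0 : 0 ≤ Real.sin φ := Real.sin_nonneg_of_nonneg_of_le_pi hφ.1 (by linarith [hφ.2])
    have hc0 : 0 ≤ Real.cos φ := Real.cos_nonneg_of_neg_pi_div_two_le_of_le (by linarith [hφ.1]) (by linarith [hφ.2])
    rw [abs_of_nonneg hs0]
    have hs1 := Real.sin_le_one φ
    have hc1 := Real.cos_le_one φ
    have hsc := Real.sin_sq_add_cos_sq φ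
    have hcs : 1 - Real.cos φ ≤ Real.sin φ ^ 2 := by nlinarith
    have hcs' : 1 - Real.cos φ ≤ Real.sin φ := by nlinarith
    have hSA : Real.sin φ * A * 0.99 ≤ ε := by
      have h5 : -(A / 100 * Real.sin φ) ≤ Z * (1 - Real.cos φ) := by
        have := abs_le.1 e2
        nlinarith
      linarith
    have t1 : (1 - Real.cos φ) * ‖cross (dir a b) (v - a)‖ ≤ Real.sin φ * (1.01 * A) :=
      mul_le_mul hcs' e3 (norm_nonneg _) hs0
    have t2 : Real.sin φ * ‖flat (cross (dir a b) (v - a))‖ ≤ ε := by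
      by_contra! hlt
      have h6 : ε * η < Real.sin φ * (2.01 * (ε * A)) := by
        calc ε * η < Real.sin φ * ‖flat (cross (dir a b) (v - a))‖ * η := mul_lt_mul_of_pos_right hlt hη0
          _ = Real.sin φ * (‖flat (cross (dir a b) (v - a))‖ * η) := by ring
          _ ≤ _ := by gcongr
      nlinarith
    linarith

end Arch
end

noncomputable section

namespace Arch

open Set Filter Topology

/-! ### Rotating an arch about its base -/

/-- The normal `g` to `f`, rotated about `f`. -/
def spin (f g : E3) (φ : ℝ) : E3 := Real.cos φ • g + Real.sin φ • cross f g

theorem Orth.spin {f g : E3} (h : Orth f g) (φ : ℝ) : Orth f (spin f g φ) := by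
  refine ⟨h.left, ?_, ?_⟩
  · have : ‖Arch.spin f g φ‖ ^ 2 = 1 := by
      have i1 : Inner.inner ℝ g g = (1 : ℝ) := by rw [real_inner_self_eq_norm_sq, h.right]; norm_num
      have i2 : Inner.inner ℝ (cross f g) (cross f g) = (1 : ℝ) := by
        rw [real_inner_self_eq_norm_sq, norm_cross_sq, h.left, h.right, h.inner]; norm_num
      have i3 : Inner.inner ℝ (cross f g) g = (0 : ℝ) := by rw [real_inner_comm]; exact inner_cross_right f g
      rw [← real_inner_self_eq_norm_sq, Arch.spin]
      simp only [inner_add_left, inner_add_right, real_inner_smul_left, real_inner_smul_right, i1, i2, i3,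
        inner_cross_right]
      linear_combination Real.sin_sq_add_cos_sq φ
    exact (pow_eq_one_iff_of_nonneg (norm_nonneg _) two_ne_zero).1 this
  · rw [Arch.spin, inner_add_right, inner_smul_right, inner_smul_right, h.inner, inner_cross_left]
    simp

/-- A rotation about the base only turns the second spanning vector; the planar coordinates of the
arch persist. -/
theorem rotateAbout_emb {f g : E3} (h : Orth f g) (o : E3) {b : ℝ} (hb : 0 < b) (φ : ℝ) (z : ℂ) :
    rotateAbout o (o + b • f) φ (emb o f g z) = emb o f (spin f g φ) z := by
  have hd : dir o (o + b • f) = f := by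
    rw [dir, add_sub_cancel_left, norm_smul, h.left, mul_one, Real.norm_eq_abs, abs_of_pos hb, smul_smul,
      inv_mul_cancel₀ hb.ne', one_smul]
  have i1 : inner ℝ f f = (1 : ℝ) := by rw [real_inner_self_eq_norm_sq, h.left]; norm_num
  have e : emb o f g z - o = z.re • f + z.im • g := by rw [emb]; abel
  rw [rotateAbout_eq, hd, e, cross_add, cross_smul, cross_smul, cross_self, inner_add_right, inner_smul_right,
    inner_smul_right, i1, h.inner, emb, spin]
  module

section

variable {n : ℕ} [NeZero n] {ε δ : ℝ} {p₀ p : Conf n} {m : ℕ}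

/-- The vertices `v_0, …, v_m` form a convex arc in the plane through `v_0` spanned by `f` and `g`,
with a horizontal base of direction `f` in `Π_ε`. -/
structure ArcOver (ε : ℝ) (p : Conf n) (m : ℕ) (f g : E3) (c : ℕ → ℂ) (b : ℝ) : Prop where
  orth : Orth f g
  horizontal : f 2 = 0
  arc : WArc m c
  zero : c 0 = 0
  last : c m = b
  pos : 0 < b
  eq : ∀ j : Fin n, (j : ℕ) ≤ m → p j = emb (p 0) f g (c j)
  height_zero : height (p 0) = ε

theorem ArcOver.congr {f g : E3} {c : ℕ → ℂ} {b : ℝ} (h : ArcOver ε p m f g c b) {q : Conf n}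
    (e : ∀ j : Fin n, (j : ℕ) ≤ m → q j = p j) : ArcOver ε q m f g c b where
  orth := h.orth
  horizontal := h.horizontal
  arc := h.arc
  zero := h.zero
  last := h.last
  pos := h.pos
  eq j hj := by rw [e j hj, e 0 (by simp)]; exact h.eq j hj
  height_zero := by rw [e 0 (by simp)]; exact h.height_zero

theorem height_emb {o f g : E3} (hf : f 2 = 0) (z : ℂ) : height (emb o f g z) = height o + z.im * g 2 := by
  simp [height, emb, hf]

theorem ArcOver.eq_last {f g : E3} {c : ℕ → ℂ} {b : ℝ} (h : ArcOver ε p m f g c b) {i : Fin n}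
    (hi : (i : ℕ) = m) : p i = p 0 + b • f := by
  rw [h.eq i hi.le, hi, h.last, emb_ofReal]

theorem ArcOver.height_last {f g : E3} {c : ℕ → ℂ} {b : ℝ} (h : ArcOver ε p m f g c b) {i : Fin n}
    (hi : (i : ℕ) = m) : height (p i) = ε := by
  rw [h.eq i hi.le, hi, h.last, height_emb h.horizontal, h.height_zero]; simp

theorem ArcOver.im_pos {f g : E3} {c : ℕ → ℂ} {b : ℝ} (h : ArcOver ε p m f g c b) {j : ℕ} (hj : 0 < j)
    (hjm : j < m) : 0 < (c j).im := by
  have := h.arc.weakArc.base j hj hjm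
  rw [h.zero, h.last, cw] at this
  simp only [sub_zero, Complex.ofReal_im, Complex.ofReal_re, mul_zero] at this
  exact pos_of_mul_pos_left this h.pos.le

/-- If the plane of the arch rises from the base, arch points off the base are higher than `ε`, out
of reach of the low chain. If the plane is horizontal, the low chain meets `Π_ε` only on the other
side of the base line. -/
theorem ArcOver.isSimplePolygon {f g : E3} {c : ℕ → ℂ} {b : ℝ} (h : ArcOver ε p m f g c b)
    (hl : LowChain ε δ p₀ p m) (hδ : DeltaOK p₀ δ) (h0 : ∀ j, height (p₀ j) = 0) (hm : m < n)
    (hg : 0 < g 2 ∨ g 2 = 0 ∧ ∀ j : Fin n, j = 0 ∨ m ≤ j → height (p j) = ε → inner ℝ g (p j - p 0) ≤ 0) :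
    IsSimplePolygon p := by
  have hm2 := h.arc.two_le
  refine hl.isSimplePolygon_of_arc hδ h0 (by omega) hm h.orth h.eq hm2 h.arc.weakArc h.zero h.last h.pos ?_
  intro z hz j hj t ht e
  have hh := congrArg height e
  have hle := hl.edgePt_le hj ⟨ht.1, ht.2.le⟩
  rw [height_emb h.horizontal, h.height_zero] at hh
  rcases hg with hg | ⟨hg, hin⟩
  · have := mul_pos hz hg
    linarith
  · rw [hg, mul_zero, add_zero] at hh
    have hinner : inner ℝ g (edgePt p j t - p 0) = z.im := by
      have i1 : inner ℝ g g = (1 : ℝ) := by rw [real_inner_self_eq_norm_sq, h.orth.right]; norm_num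
      have i2 : inner ℝ g f = (0 : ℝ) := by rw [real_inner_comm]; exact h.orth.inner
      rw [← e, emb, add_assoc, add_sub_cancel_left, inner_add_right, inner_smul_right, inner_smul_right, i1, i2]
      ring
    have hlj := hl.le j (.inr hj)
    have hls := hl.le _ (succ_low hj)
    rw [edgePt, height_lineMap] at hh
    have hsplit : inner ℝ g (edgePt p j t - p 0) = (1 - t) * inner ℝ g (p j - p 0) + t * inner ℝ g (p (j + 1) - p 0) := by
      rw [← inner_smul_right, ← inner_smul_right, ← inner_add_right, edgePt, AffineMap.lineMap_apply,
        vsub_eq_sub, vadd_eq_add]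
      congr 1
      module
    have ht1 : 0 < 1 - t := by linarith [ht.2]
    -- Both ends have height at most `ε`, so a point at height `ε` forces that height at every end
    -- with positive weight.
    have hj1 : height (p j) = ε := by
      by_contra hne
      have h1 := mul_lt_mul_of_pos_left (hlj.lt_of_ne hne) ht1
      have h2 := mul_le_mul_of_nonneg_left hls ht.1
      linarith
    have a1 := mul_nonneg ht1.le (neg_nonneg.2 (hin j (.inr hj) hj1))
    rcases ht.1.lt_or_eq with ht0 | rfl
    · have hj2 : height (p (j + 1)) = ε := by
        by_contra hne
        have h1 := mul_lt_mul_of_pos_left (hls.lt_of_ne hne) ht0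
        rw [hj1] at hh
        linarith
      have a2 := mul_nonneg ht.1 (neg_nonneg.2 (hin _ (succ_low hj) hj2))
      linarith
    · linarith

/-- The arch turns about its base. -/
theorem ArcOver.exists_rotation {f g : E3} {c : ℕ → ℂ} {b : ℝ} (h : ArcOver ε p m f g c b)
    (hl : LowChain ε δ p₀ p m) (hδ : DeltaOK p₀ δ) (h0 : ∀ j, height (p₀ j) = 0) {i : Fin n} (hi : (i : ℕ) = m)
    {θ : ℝ} (hg : ∀ t ∈ Icc (0 : ℝ) 1, 0 < spin f g (t * θ) 2 ∨ spin f g (t * θ) 2 = 0 ∧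
      ∀ j : Fin n, j = 0 ∨ m ≤ j → height (p j) = ε → inner ℝ (spin f g (t * θ)) (p j - p 0) ≤ 0) :
    ∃ q, IsMotion (rotationPath {j | 0 < j ∧ j < i} (p 0) (p i) θ p) p q ∧
      ArcOver ε q m f (spin f g θ) c b ∧ ∀ j : Fin n, j = 0 ∨ m ≤ j → q j = p j := by
  set γ := rotationPath {j : Fin n | 0 < j ∧ j < i} (p 0) (p i) θ p with hγ
  have hlow : ∀ t, ∀ j : Fin n, j = 0 ∨ m ≤ j → γ t j = p j := by
    intro t j hj
    refine if_neg ?_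
    rintro ⟨h1, h2⟩
    rcases hj with rfl | hj
    · exact h1.false
    · have : (j : ℕ) < i := h2
      omega
  have hmid : ∀ t, ∀ j : Fin n, (j : ℕ) ≤ m → γ t j = emb (p 0) f (spin f g (t * θ)) (c j) := by
    intro t j hj
    by_cases h1 : 0 < j ∧ j < i
    · simp only [hγ, rotationPath, mem_ofPred_eq, if_pos h1]
      rw [h.eq_last hi, h.eq j hj, rotateAbout_emb h.orth _ h.pos]
    · simp only [hγ, rotationPath, mem_ofPred_eq, if_neg h1]
      rcases not_and_or.1 h1 with h2 | h2
      · have : j = 0 := le_antisymm (not_lt.1 h2) (Fin.zero_le _)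
        subst this
        rw [Fin.val_zero, h.zero, emb_zero]
      · have : (j : ℕ) = m := le_antisymm hj (hi ▸ not_lt.1 h2)
        rw [this, h.last, emb_ofReal, h.eq_last this]
  have hz : ∀ t, γ t 0 = p 0 := fun t => hlow t 0 (.inl rfl)
  have harc : ∀ t, ArcOver ε (γ t) m f (spin f g (t * θ)) c b := fun t =>
    ⟨h.orth.spin _, h.horizontal, h.arc, h.zero, h.last, h.pos, fun j hj => by rw [hz, hmid t j hj],
      by rw [hz, h.height_zero]⟩
  have hlc : ∀ t, LowChain ε δ p₀ (γ t) m := fun t =>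
    ⟨fun j hj => by rw [hlow t j hj]; exact hl.le j hj, fun j hj => by rw [hlow t j hj]; exact hl.near j hj⟩
  have hm : m < n := hi ▸ i.isLt
  refine ⟨γ 1, ⟨?_, ?_, rfl, fun t ht => ⟨?_, fun j => ?_⟩⟩, ?_, hlow 1⟩
  · refine continuousOn_pi.2 fun j => Continuous.continuousOn ?_
    by_cases h1 : 0 < j ∧ j < i
    · simp only [hγ, rotationPath, mem_ofPred_eq, if_pos h1]
      exact (continuous_rotateAbout _ _ _).comp (by fun_prop)
    · simp only [hγ, rotationPath, mem_ofPred_eq, if_neg h1]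
      exact continuous_const
  · funext j
    simp only [hγ, rotationPath, zero_mul, rotateAbout_zero, ite_self]
  · refine (harc t).isSimplePolygon (hlc t) hδ h0 hm ?_
    refine (hg t ht).imp_right fun h1 => ⟨h1.1, fun j hj => ?_⟩
    rw [hlow t j hj, hz]
    exact h1.2 j hj
  · rcases lt_or_ge (j : ℕ) m with hj | hj
    · have hs : ((j + 1 : Fin n) : ℕ) ≤ m := by rw [val_succ_of_lt hm hj]; omega
      rw [hmid t j hj.le, hmid t _ hs, (h.orth.spin _).dist_emb, h.eq j hj.le, h.eq _ hs, h.orth.dist_emb]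
    · rw [hlow t j (.inr hj), hlow t _ (succ_low hj)]
  · have := harc 1
    rwa [one_mul] at this

/-! ### The lifting motion -/

/-- The altitudes at `v_k` are at least `δ / 2`, and `1000 * ε ≤ δ` is the requirement of
`exists_lift_angle` for `η = δ / 2`. Simplicity on the way enters as the hypothesis `hs`, as it has
different reasons with and without an arch. -/
theorem exists_lift (hδ : DeltaOK p₀ δ) (h0 : ∀ j, height (p₀ j) = 0) (hn : 3 ≤ n) (hε : 0 < ε)
    (hεδ : 1000 * ε ≤ δ) {k : Fin n} (hk : p k = p₀ k)
    (ha0 : 0 ≤ height (p (k - 1))) (ha : height (p (k - 1)) ≤ ε) (hb0 : 0 ≤ height (p (k + 1)))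
    (hb : height (p (k + 1)) ≤ ε) (hna : hdist (p (k - 1)) (p₀ (k - 1)) ≤ δ / 2)
    (hnb : hdist (p (k + 1)) (p₀ (k + 1)) ≤ δ / 2)
    (hs : ∀ x, height x ≤ ε → hdist x (p₀ k) ≤ δ / 2 → IsSimplePolygon (Function.update p k x)) :
    ∃ x, Lift ε δ k p (Function.update p k x) ∧ height x = ε ∧ hdist x (p₀ k) ≤ δ / 2 := by
  have hδ0 := hδ.1
  have hv : height (p k) = 0 := by rw [hk]; exact h0 k
  have hnv : hdist (p k) (p₀ k) ≤ δ / 2 := by rw [hk, hdist_self]; linarith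
  have hT := hδ.turn_ne_zero h0 hn (hna.trans (by linarith)) (hnv.trans (by linarith)) (hnb.trans (by linarith))
  obtain ⟨e1, -, e3⟩ := hδ.le_turn h0 hn hna hnv hnb
  obtain ⟨θ, hmono, hend, hnear⟩ := exists_lift_angle hε (η := δ / 2) (by linarith) ha0 ha hb0 hb hv hT e1 e3
  have hab : p (k - 1) ≠ p (k + 1) := fun e => hT (by rw [e, turn_self_left])
  have hpath : ∀ t, rotationPath {k} (p (k - 1)) (p (k + 1)) θ p t =
      Function.update p k (rotateAbout (p (k - 1)) (p (k + 1)) (t * θ) (p k)) := by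
    intro t
    funext j
    by_cases hj : j = k
    · subst hj; simp [rotationPath]
    · simp [rotationPath, hj]
  have hI1 : (1 : ℝ) ∈ Icc (0 : ℝ) 1 := ⟨zero_le_one, le_rfl⟩
  have e2 : k + 1 ≠ k := add_one_ne (by omega) k
  refine ⟨rotateAbout (p (k - 1)) (p (k + 1)) θ (p k), ⟨θ, ⟨?_, ?_, ?_, fun t ht => ⟨?_, fun j => ?_⟩⟩, hv, ?_, ?_, ?_⟩,
    hend, ?_⟩
  · rw [funext hpath]
    refine Continuous.continuousOn (continuous_const.update k ?_)
    exact (continuous_rotateAbout _ _ _).comp (by fun_prop)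
  · rw [hpath, zero_mul, rotateAbout_zero, Function.update_eq_self]
  · rw [hpath, one_mul]
  · rw [hpath]
    refine hs _ ?_ (by rw [← hk]; exact hnear t ht)
    have := hmono.monotoneOn ht hI1 ht.2
    simp only [one_mul, hend] at this
    exact this
  · rw [hpath]
    by_cases h1 : j = k
    · subst h1
      rw [Function.update_self, Function.update_of_ne e2]
      have := dist_rotateAbout hab (t * θ) (p j) (p (j + 1))
      rwa [rotateAbout_right hab] at this
    by_cases h2 : j + 1 = k
    · have h3 : j = k - 1 := by rw [← h2, add_sub_cancel_right]
      rw [h2, Function.update_self, Function.update_of_ne h1, h3]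
      have := dist_rotateAbout hab (t * θ) (p (k - 1)) (p k)
      rwa [rotateAbout_left] at this
    · rw [Function.update_of_ne h1, Function.update_of_ne h2]
  · simp only [hpath, Function.update_self]
    exact hmono
  · rw [Function.update_self, hend]
  · rw [Function.update_self]
    have := hnear 1 hI1
    rw [one_mul] at this
    linarith
  · have := hnear 1 hI1
    rw [one_mul] at this
    rwa [← hk]

end

end Arch
end

noncomputable section

namespace Arch

open Set Filter Topology

/-! ### Convexifying an arch in the horizontal plane -/

/-- In a horizontal plane `g` is `f` turned by a right angle, to the side given by the determinant
`±1`. -/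
theorem Orth.horizontal {f g : E3} (h : Orth f g) (hf : f 2 = 0) (hg : g 2 = 0) :
    (f 0 * g 1 - f 1 * g 0) ^ 2 = 1 ∧ g 0 = -((f 0 * g 1 - f 1 * g 0) * f 1) ∧
      g 1 = (f 0 * g 1 - f 1 * g 0) * f 0 := by
  have e1 := norm_sq_eq f
  have e2 := norm_sq_eq g
  have e3 := h.inner
  rw [h.left, hf] at e1
  rw [h.right, hg] at e2
  rw [inner_eq, hf, hg] at e3
  refine ⟨?_, ?_, ?_⟩
  · linear_combination (-1) * (e2) - (g 0 ^ 2 + g 1 ^ 2) * e1 - (f 0 * g 0 + f 1 * g 1) * e3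
  · linear_combination g 0 * e1 + f 0 * e3
  · linear_combination g 1 * e1 + f 1 * e3

/-- The complex coordinates of a vector. -/
def coord (f g y : E3) : ℂ := ⟨inner ℝ f y, inner ℝ g y⟩

theorem Orth.emb_coord {f g : E3} (h : Orth f g) (hf : f 2 = 0) (hg : g 2 = 0) {o x : E3}
    (hx : height x = height o) : emb o f g (coord f g (x - o)) = x := by
  obtain ⟨hD, h0, h1⟩ := h.horizontal hf hg
  set D := f 0 * g 1 - f 1 * g 0
  have e1 := norm_sq_eq f
  rw [h.left, hf] at e1
  simp only [height] at hx
  refine E3.ext ?_ ?_ ?_ <;>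
    simp only [emb, coord, inner_eq, PiLp.add_apply, PiLp.smul_apply, PiLp.sub_apply, smul_eq_mul, hf, hg, hx, h0, h1]
  · linear_combination (-(x 0 - o 0)) * e1 + ((x 0 - o 0) * f 1 ^ 2 - (x 1 - o 1) * f 0 * f 1) * hD
  · linear_combination (-(x 1 - o 1)) * e1 + ((x 1 - o 1) * f 0 ^ 2 - (x 0 - o 0) * f 0 * f 1) * hD
  · ring

theorem val_zero_sub_one {n : ℕ} [NeZero n] : ((0 - 1 : Fin n) : ℕ) + 1 = n := by
  have := val_add_one (0 - 1 : Fin n)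
  rw [sub_add_cancel, Fin.val_zero] at this
  by_contra h
  rw [if_neg h] at this
  omega

theorem val_sub_one {n : ℕ} [NeZero n] {j : Fin n} (hj : 0 < (j : ℕ)) : ((j - 1 : Fin n) : ℕ) + 1 = j := by
  have := val_add_one (j - 1 : Fin n)
  rw [sub_add_cancel] at this
  split_ifs at this <;> omega

theorem WeakArc.not_isStraight_zero {N n : ℕ} [NeZero n] (hn : N + 1 = n) (hN : 2 ≤ N) {c : ℕ → ℂ}
    (hc : WeakArc N c) {o f g : E3} (hfg : Orth f g) {p : Conf n}
    (hp : ∀ j : Fin n, p j = emb o f g (c j)) : ¬ IsStraight p 0 := by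
  have e1 : ((0 - 1 : Fin n) : ℕ) = N := by have := val_zero_sub_one (n := n); omega
  have e2 : ((0 + 1 : Fin n) : ℕ) = 1 := by rw [val_add_one, Fin.val_zero, if_neg (by omega)]
  refine not_isStraight_of_cw hfg (hp _) (hp _) (hp _) ?_
  rw [e1, e2, Fin.val_zero]
  exact (cw_pos_rotate' (hc.base 1 one_pos (by omega))).ne'

theorem WeakArc.not_isStraight_last {N n : ℕ} [NeZero n] (hn : N + 1 = n) (hN : 2 ≤ N) {c : ℕ → ℂ}
    (hc : WeakArc N c) {o f g : E3} (hfg : Orth f g) {p : Conf n}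
    (hp : ∀ j : Fin n, p j = emb o f g (c j)) {l : Fin n} (hl : (l : ℕ) = N) : ¬ IsStraight p l := by
  have e1 : ((l - 1 : Fin n) : ℕ) = N - 1 := by have := val_sub_one (j := l) (by omega); omega
  have e2 : ((l + 1 : Fin n) : ℕ) = 0 := by rw [val_add_one, if_pos (by omega)]
  refine not_isStraight_of_cw hfg (hp _) (hp _) (hp _) ?_
  rw [e1, e2, hl]
  exact (cw_pos_rotate (hc.base (N - 1) (by omega) (by omega))).ne'

section

variable {n : ℕ} [NeZero n] {ε δ : ℝ} {p₀ p : Conf n} {m : ℕ}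

theorem ArcOver.height_eq {f g : E3} {c : ℕ → ℂ} {b : ℝ} (h : ArcOver ε p m f g c b) {j : Fin n}
    (hj : (j : ℕ) ≤ m) : height (p j) = ε + (c j).im * g 2 := by
  rw [h.eq j hj, height_emb h.horizontal, h.height_zero]

/-- A convex arc in `Π_ε` over the segment from `v_0` to `v_i`, from a convex polygon there. -/
theorem exists_arcOver {f g : E3} (hfg : Orth f g) (hf : f 2 = 0) (hg : g 2 = 0) {c : ℕ → ℂ}
    (hc : WArc m c) (hc0 : c 0 = 0) (hp : ∀ j : Fin n, (j : ℕ) ≤ m → p j = emb (p 0) f g (c j))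
    (hz : height (p 0) = ε) :
    ∃ f' g' : E3, ∃ c' : ℕ → ℂ, ∃ b : ℝ, g' 2 = 0 ∧ ArcOver ε p m f' g' c' b := by
  have hx0 : c m ≠ 0 := by rw [← hc0]; exact hc.weakArc.ends_ne hc.two_le
  set x := c m
  set r := ‖x‖ with hr
  have hr0 : 0 < r := norm_pos_iff.2 hx0
  have hrr : x.re * x.re + x.im * x.im = r ^ 2 := by rw [hr, Complex.sq_norm, Complex.normSq_apply]
  -- The rotation that takes the last vertex to the positive real axis; the frame is turned
  -- inversely, so that the points in space stay the same.
  set u : ℂ := (starRingEnd ℂ) x / r with hu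
  have hure : u.re = x.re / r := by rw [hu, Complex.div_ofReal_re, Complex.conj_re]
  have huim : u.im = -x.im / r := by rw [hu, Complex.div_ofReal_im, Complex.conj_im]
  have hu1 : ‖u‖ = 1 := by
    rw [hu, norm_div, RCLike.norm_conj, Complex.norm_of_nonneg hr0.le, ← hr, div_self hr0.ne']
  have huu : (x.re / r) * (x.re / r) + (x.im / r) * (x.im / r) = 1 := by
    field_simp; linarith
  refine ⟨(x.re / r) • f + (x.im / r) • g, (-x.im / r) • f + (x.re / r) • g, fun j => u * c j + 0, r, ?_,
    ⟨⟨?_, ?_, ?_⟩, ?_, hc.rigid 0 hu1, ?_, ?_, hr0, fun j hj => ?_, hz⟩⟩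
  · simp [hf, hg]
  · have := hfg.inner_comb (x.re / r) (x.im / r) (x.re / r) (x.im / r)
    rw [real_inner_self_eq_norm_sq, huu] at this
    exact (pow_eq_one_iff_of_nonneg (norm_nonneg _) two_ne_zero).1 this
  · have := hfg.inner_comb (-x.im / r) (x.re / r) (-x.im / r) (x.re / r)
    rw [real_inner_self_eq_norm_sq] at this
    refine (pow_eq_one_iff_of_nonneg (norm_nonneg _) two_ne_zero).1 (this.trans ?_)
    rw [← huu]; ring
  · rw [hfg.inner_comb]; ring
  · simp [hf, hg]
  · rw [hc0]; simp
  · have : (starRingEnd ℂ) x * x = ((r ^ 2 : ℝ) : ℂ) := by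
      rw [mul_comm, Complex.mul_conj, hr, Complex.sq_norm]
    rw [add_zero, hu, div_mul_eq_mul_div, this]
    have hrc : (r : ℂ) ≠ 0 := by exact_mod_cast hr0.ne'
    push_cast
    field_simp
  · rw [hp j hj]
    simp only [emb, add_zero, Complex.mul_re, Complex.mul_im, hure, huim]
    have h1 : (x.re / r * (c j).re - -x.im / r * (c j).im) * (x.re / r) +
        (x.re / r * (c j).im + -x.im / r * (c j).re) * (-x.im / r) = (c j).re := by
      linear_combination (c j).re * huu
    have h2 : (x.re / r * (c j).re - -x.im / r * (c j).im) * (x.im / r) +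
        (x.re / r * (c j).im + -x.im / r * (c j).re) * (x.re / r) = (c j).im := by
      linear_combination (c j).im * huu
    refine Eq.trans (b := p 0 + ((x.re / r * (c j).re - -x.im / r * (c j).im) * (x.re / r) +
        (x.re / r * (c j).im + -x.im / r * (c j).re) * (-x.im / r)) • f +
        ((x.re / r * (c j).re - -x.im / r * (c j).im) * (x.im / r) +
        (x.re / r * (c j).im + -x.im / r * (c j).re) * (x.re / r)) • g) (by rw [h1, h2]) (by module)

/-- The planar motion of `WArc.exists_fold` is carried out in `Π_ε`. It leaves `v_0` and `v_i` at
rest, so the rest of the chain can stay where it is. -/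
theorem ArcOver.exists_convexify {f g : E3} {c : ℕ → ℂ} {b : ℝ} (h : ArcOver ε p m f g c b)
    (hg : g 2 = 0) (hl : LowChain ε δ p₀ p m) (hδ : DeltaOK p₀ δ) (h0 : ∀ j, height (p₀ j) = 0)
    {i : Fin n} (hi : (i : ℕ) = m + 1) (hpi : height (p i) = ε) (hside : inner ℝ g (p i - p 0) ≤ 0)
    (hs : IsSimplePolygon p) (hrest : ∀ j, i < j → height (p j) < ε) :
    ∃ q, ConvexifyArch ε i p q ∧ (∀ j : Fin n, j = 0 ∨ i ≤ j → q j = p j) ∧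
      ∃ f' g' : E3, ∃ c' : ℕ → ℂ, ∃ b' : ℝ, g' 2 = 0 ∧ ArcOver ε q i f' g' c' b' := by
  have hm2 := h.arc.two_le
  have hn := i.isLt
  set X := coord f g (p i - p 0) with hX
  have hXe : emb (p 0) f g X = p i := h.orth.emb_coord h.horizontal hg (hpi.trans h.height_zero.symm)
  set c₂ := extend m c X with hc₂
  have hce : ∀ j ≤ m, c₂ j = c j := fun j hj => extend_le _ _ hj
  have hcl : c₂ (m + 1) = X := extend_last _ _ _
  have hpe : ∀ j : Fin n, (j : ℕ) ≤ m + 1 → p j = emb (p 0) f g (c₂ j) := by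
    intro j hj
    rcases hj.lt_or_eq with hj | hj
    · rw [hce _ (by omega)]; exact h.eq j (by omega)
    · rw [hj, hcl, hXe, Fin.ext (hj.trans hi.symm)]
  have hX0 : X ≠ 0 := by
    intro e
    rw [e, emb_zero] at hXe
    exact hs.injective.ne (a₁ := 0) (a₂ := i) (fun e => by rw [← e] at hi; simp at hi) hXe
  have hXm : X ≠ c₂ m := by
    intro e
    rw [e, ← hpe ⟨m, by omega⟩ (by simp)] at hXe
    have := congrArg Fin.val (hs.injective hXe)
    simp only at this
    omega
  obtain ⟨C, hC, hC0, hCl, hCs, hC1⟩ := (h.arc.congr hce).exists_fold (by rw [hce 0 (by omega), h.zero])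
    (by rw [hce m le_rfl, h.last]) h.pos (by rw [hcl]; exact hside) (by rw [hcl]; exact hX0) (by rw [hcl]; exact hXm)
  rw [hce 0 (by omega), h.zero] at hC0
  rw [hcl] at hCl
  set γ : ℝ → Conf n := fun t j => if (j : ℕ) ≤ m + 1 then emb (p 0) f g (C t j) else p j with hγ
  have hγle : ∀ t, ∀ j : Fin n, (j : ℕ) ≤ m + 1 → γ t j = emb (p 0) f g (C t j) := fun t j hj => if_pos hj
  have hI0 : (0 : ℝ) ∈ Icc (0 : ℝ) 1 := ⟨le_rfl, zero_le_one⟩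
  have hI1 : (1 : ℝ) ∈ Icc (0 : ℝ) 1 := ⟨zero_le_one, le_rfl⟩
  have hfix : ∀ t ∈ Icc (0 : ℝ) 1, ∀ j : Fin n, j = 0 ∨ i ≤ j → γ t j = p j := by
    intro t ht j hj
    rcases hj with rfl | hj
    · rw [hγle t 0 (by simp), Fin.val_zero, hC0 t ht, emb_zero]
    · rcases (show (i : ℕ) ≤ j from hj).lt_or_eq with h1 | h1
      · exact if_neg (by omega)
      · rw [hγle t j (by omega), ← h1, hi, hCl t ht, hXe, Fin.ext h1]
  have hz : ∀ t ∈ Icc (0 : ℝ) 1, γ t 0 = p 0 := fun t ht => hfix t ht 0 (.inl rfl)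
  have hγ0 : γ 0 = p := by
    funext j
    by_cases hj : (j : ℕ) ≤ m + 1
    · rw [hγle 0 j hj, hC.zero j hj, ← hpe j hj]
    · exact if_neg hj
  have hh : ∀ t, ∀ j : Fin n, j ≤ i → height (γ t j) = ε := by
    intro t j hj
    have : (j : ℕ) ≤ i := hj
    rw [hγle t j (by omega), height_emb h.horizontal, hg, h.height_zero, mul_zero, add_zero]
  have harch : ∀ t, ∀ j : Fin (i + 1), arch i (γ t) j = emb (p 0) f g (C t j) := fun t j =>
    hγle t _ (by simp only; omega)
  have hsimple : ∀ t ∈ Icc (0 : ℝ) 1, IsSimplePolygon (γ t) := by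
    intro t ht
    rcases ht.1.lt_or_eq with ht0 | rfl
    swap
    · rw [hγ0]; exact hs
    have hP := hCs t ⟨ht0, ht.2⟩
    have hlc : LowChain ε δ p₀ (γ t) (m + 1) := by
      constructor <;> intro j hj <;> rw [hfix t ht j (hj.imp_right fun h1 => Fin.le_def.2 (by omega))]
      · exact hl.le j (hj.imp_right fun h1 => by omega)
      · exact hl.near j (hj.imp_right fun h1 => by omega)
    refine hlc.isSimplePolygon_of_planar hδ h0 hs.1 (by omega) h.orth (c := C t)
      (fun j hj => by rw [hγle t j hj]) (fun j hj => ?_) (fun a d had hd s hs t' ht' => ?_)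
      fun a ha s hs j hj t' ht' e => ?_
    · have := hP.1 j (by omega)
      rwa [if_neg (by omega)] at this
    · have := hP.2 a d had (by omega) s hs t' ht'
      rwa [if_neg (by omega)] at this
    -- The rest of the chain reaches height `ε` only at `v_i` or, if `v_i` is the last vertex, along
    -- the edge `v_i v_0`. Either way the point is on the closing edge of the planar polygon, which
    -- the arch avoids.
    · have key : ∃ r ∈ Ico (0 : ℝ) 1, edgePt (γ t) j t' = emb (p 0) f g (AffineMap.lineMap X 0 r) := by
        have e' := congrArg height e
        rw [height_emb h.horizontal, hg, h.height_zero, mul_zero, add_zero, edgePt, height_lineMap] at e'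
        have a1 := hlc.le j (.inr hj)
        have a2 := hlc.le _ (succ_low hj)
        have ht1 : 0 < 1 - t' := by linarith [ht'.2]
        have hj1 : height (γ t j) = ε := by
          by_contra hne
          have h1 := mul_lt_mul_of_pos_left (a1.lt_of_ne hne) ht1
          have h2 := mul_le_mul_of_nonneg_left a2 ht'.1
          linarith
        have hji : j = i := by
          by_contra hne
          have hij : i < j := lt_of_le_of_ne (Fin.le_def.2 (by omega)) (Ne.symm hne)
          rw [hfix t ht j (.inr hij.le)] at hj1
          exact (hrest j hij).ne hj1
        subst hji
        have hγi : γ t j = emb (p 0) f g X := by rw [hfix t ht j (.inr le_rfl), hXe]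
        rcases ht'.1.lt_or_eq with h1 | rfl
        · have hj2 : height (γ t (j + 1)) = ε := by
            by_contra hne
            have h1 := mul_lt_mul_of_pos_left (a2.lt_of_ne hne) h1
            rw [hj1] at e'
            linarith
          have hj3 : j + 1 = 0 := by
            by_contra hne
            have hlow := (succ_low hj).resolve_left hne
            have hv := val_add_one j
            rw [if_neg (fun e => hne (Fin.ext (by rw [hv, if_pos e, Fin.val_zero])))] at hv
            have hlt : j < j + 1 := Fin.lt_def.2 (by omega)
            rw [hfix t ht _ (.inr hlt.le)] at hj2
            exact (hrest _ hlt).ne hj2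
          refine ⟨t', ht', ?_⟩
          rw [edgePt, hj3, hz t ht, hγi, ← lineMap_emb, emb_zero]
        · refine ⟨0, ⟨le_rfl, one_pos⟩, ?_⟩
          rw [edgePt_zero, AffineMap.lineMap_apply_zero, hγi]
      obtain ⟨r, hr, er⟩ := key
      have := h.orth.emb_injective _ (e.trans er)
      refine hP.2 a (m + 1) ha le_rfl s hs r hr ?_
      rw [if_pos rfl, hC0 t ht, hCl t ht]
      exact this
  have hqe : ∀ j : Fin n, (j : ℕ) ≤ i → γ 1 j = emb (γ 1 0) f g (C 1 j) := fun j hj => by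
    rw [hz 1 hI1, hγle 1 j (by omega)]
  have hC1i : WArc i (C 1) := by rw [hi]; exact hC1
  refine ⟨γ 1, ⟨γ, ⟨?_, hγ0, rfl, fun t ht => ⟨hsimple t ht, fun j => ?_⟩⟩, fun t ht => ⟨hfix t ht, hh t, fun ht0 => ?_⟩,
    ?_, ?_, ?_⟩, hfix 1 hI1, exists_arcOver h.orth h.horizontal hg hC1i (hC0 1 hI1) hqe (hh 1 0 (Fin.zero_le _))⟩
  · refine continuousOn_pi.2 fun j => ?_
    by_cases hj : (j : ℕ) ≤ m + 1
    · simp only [hγ, if_pos hj]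
      exact (continuous_emb _ _ _).comp_continuousOn (hC.cont j hj)
    · simp only [hγ, if_neg hj]; exact continuousOn_const
  · rcases lt_or_ge (j : ℕ) (m + 1) with hj | hj
    · have hv := val_succ_of_lt (show m + 1 < n by omega) hj
      rw [hγle t j hj.le, hγle t (j + 1) (by omega), h.orth.dist_emb, hv, hC.len t ht j hj, hpe j hj.le,
        hpe (j + 1) (by omega), h.orth.dist_emb, hv]
    · rw [hfix t ht j (.inr (Fin.le_def.2 (by omega))), hfix t ht (j + 1)
        ((succ_low hj).imp_right fun h1 => Fin.le_def.2 (by omega))]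
  · exact (hi ▸ hCs t ⟨ht0, ht.2⟩ : PlanarSimple i (C t)).isSimplePolygon rfl (by omega) h.orth (harch t)
  · exact hC1i.weakArc.isConvexPolygon rfl (by omega) h.orth (harch 1)
  · exact hC1i.weakArc.not_isStraight_zero rfl (by omega) h.orth (harch 1)
  · exact hC1i.weakArc.not_isStraight_last rfl (by omega) h.orth (harch 1) (Fin.val_last _)

end

end Arch
end

noncomputable section

namespace Arch

open Set Filter Topology

/-! ### The steps of the algorithm -/

/-- The upward unit vector. -/
def ez : E3 := !₂[0, 0, 1]

theorem ez_two : ez 2 = 1 := by simp [ez]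

section

variable {n : ℕ} [NeZero n] {ε δ : ℝ} {p₀ p : Conf n} {m : ℕ} {f g : E3} {c : ℕ → ℂ} {b : ℝ}

/-- The arc stands over the segment from `v_0` to `v_m`, which are close to their original
positions; the later vertices are in their original positions. -/
structure Settled (ε δ : ℝ) (p₀ p : Conf n) (m : ℕ) (f g : E3) (c : ℕ → ℂ) (b : ℝ) : Prop where
  arcOver : ArcOver ε p m f g c b
  near_zero : hdist (p 0) (p₀ 0) ≤ δ / 2
  near_last : ∀ j : Fin n, (j : ℕ) = m → hdist (p j) (p₀ j) ≤ δ / 2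
  rest : ∀ j : Fin n, m < j → p j = p₀ j

theorem Settled.lowChain (h : Settled ε δ p₀ p m f g c b) (hε : 0 ≤ ε) (hδ : 0 ≤ δ)
    (h0 : ∀ j, height (p₀ j) = 0) : LowChain ε δ p₀ p m := by
  constructor <;> intro j hj
  · rcases hj with rfl | hj
    · exact h.arcOver.height_zero.le
    · rcases hj.lt_or_eq with hj | hj
      · rw [h.rest j hj, h0]; exact hε
      · exact (h.arcOver.height_last hj.symm).le
  · rcases hj with rfl | hj
    · exact h.near_zero.trans (by linarith)
    · rcases hj.lt_or_eq with hj | hj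
      · rw [h.rest j hj, hdist_self]; exact hδ
      · exact (h.near_last j hj.symm).trans (by linarith)

theorem LowChain.update (h : LowChain ε δ p₀ p m) (i : Fin n) {x : E3} (hx : height x ≤ ε)
    (hd : hdist x (p₀ i) ≤ δ) : LowChain ε δ p₀ (Function.update p i x) m := by
  constructor <;> intro j hj <;> by_cases e : j = i
  · subst e; rwa [Function.update_self]
  · rw [Function.update_of_ne e]; exact h.le j hj
  · subst e; rwa [Function.update_self]
  · rw [Function.update_of_ne e]; exact h.near j hj

theorem Settled.hyp (h : Settled ε δ p₀ p m f ez c b) (hε : 0 < ε) (hδ : 0 < δ)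
    (h0 : ∀ j, height (p₀ j) = 0) {i : Fin n} (hi : (i : ℕ) = m) : Hyp ε δ p₀ i p := by
  have hrest : ∀ j, i < j → p j = p₀ j := fun j hj => h.rest j (hi ▸ hj)
  refine ⟨⟨h.arcOver.height_zero, h.arcOver.height_last hi, fun j hj hji => ?_, fun j hj => ?_⟩,
    ⟨fun j hj => ?_, ?_⟩, ⟨h.near_zero.trans (by linarith), (h.near_last i hi).trans (by linarith)⟩, hrest⟩
  · have hjm : (j : ℕ) < m := hi ▸ hji
    have := h.arcOver.im_pos (j := j) hj hjm
    rw [h.arcOver.height_eq hjm.le, ez_two]; linarith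
  · rw [hrest j hj, h0]; exact hε
  · have hjm : (j : ℕ) ≤ m := hi ▸ hj
    rw [h.arcOver.eq_last hi, h.arcOver.eq j hjm]
    simp [turn, emb, ez]
    ring
  · subst hi
    exact h.arcOver.arc.weakArc.isConvexPolygon rfl h.arcOver.arc.two_le h.arcOver.orth
      fun k => h.arcOver.eq ⟨k, by omega⟩ (by simp only; omega)

theorem inner_ofReal_smul (h : Orth f g) (r : ℝ) : inner ℝ g (r • f) = 0 := by
  rw [inner_smul_right, real_inner_comm, h.inner, mul_zero]

/-- `cross f g` is `D` times the upward unit vector with `D = ±1`, so the rotation by `D * (π / 2)`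
goes upward. At its start the low vertices at height `ε` are the two ends of the base. -/
theorem Settled.exists_raise (h : Settled ε δ p₀ p m f g c b) (hg : g 2 = 0) (hδ : DeltaOK p₀ δ)
    (h0 : ∀ j, height (p₀ j) = 0) (hε : 0 < ε) {i : Fin n} (hi : (i : ℕ) = m) :
    ∃ q, Raise i p q ∧ Settled ε δ p₀ q m f ez c b := by
  obtain ⟨hD, -, -⟩ := h.arcOver.orth.horizontal h.arcOver.horizontal hg
  set D := f 0 * g 1 - f 1 * g 0 with hDdef
  have hc : cross f g = D • ez := by
    refine E3.ext ?_ ?_ ?_ <;>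
      simp only [cross_zero_apply, cross_one_apply, cross_two_apply, PiLp.smul_apply, smul_eq_mul, hg,
        h.arcOver.horizontal] <;> simp [ez, hDdef]
  have hD1 : D = 1 ∨ D = -1 := mul_self_eq_one_iff.1 (by rw [← sq]; exact hD)
  have hsin : ∀ x, Real.sin (D * x) * D = Real.sin x := by
    intro x; rcases hD1 with e | e <;> rw [e] <;> simp
  have hcos : ∀ x, Real.cos (D * x) = Real.cos x := by
    intro x; rcases hD1 with e | e <;> rw [e] <;> simp
  have hspin : ∀ x, spin f g (D * x) = Real.cos x • g + Real.sin x • ez := by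
    intro x; rw [spin, hcos, hc, smul_smul, hsin]
  have hπ := Real.pi_pos
  obtain ⟨q, hq, hover, hlow⟩ := h.arcOver.exists_rotation (h.lowChain hε.le hδ.1.le h0) hδ h0 hi
    (θ := D * (Real.pi / 2)) fun t ht => by
      rw [mul_left_comm, hspin]
      rcases ht.1.lt_or_eq with h1 | rfl
      · left
        have : 0 < Real.sin (t * (Real.pi / 2)) :=
          Real.sin_pos_of_pos_of_lt_pi (by positivity) (by nlinarith [ht.2])
        simpa [hg, ez_two] using this
      · right
        rw [zero_mul, Real.cos_zero, Real.sin_zero, one_smul, zero_smul, add_zero]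
        refine ⟨hg, fun j hj hh => ?_⟩
        rcases hj with rfl | hj
        · rw [sub_self, inner_zero_right]
        · rcases hj.lt_or_eq with hj | hj
          · rw [h.rest j hj, h0] at hh; exact absurd hh hε.ne
          · rw [h.arcOver.eq_last hj.symm, add_sub_cancel_left, inner_ofReal_smul h.arcOver.orth]
  rw [hspin, Real.cos_pi_div_two, Real.sin_pi_div_two, zero_smul, one_smul, zero_add] at hover
  refine ⟨q, ⟨D * (Real.pi / 2), ?_, hq⟩, hover, ?_, fun j hj => ?_, fun j hj => ?_⟩
  · rcases hD1 with e | e <;> rw [e] <;> simp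
  · rw [hlow 0 (.inl rfl)]; exact h.near_zero
  · rw [hlow j (.inr hj.ge)]; exact h.near_last j hj
  · rw [hlow j (.inr hj.le)]; exact h.rest j hj

theorem turn_base (f g o : E3) (b : ℝ) (z : ℂ) :
    turn o (o + b • f) (emb o f g z) = b * (f 0 * g 1 - f 1 * g 0) * z.im := by
  simp [turn, emb]; ring

theorem Settled.exists_steps (h : Settled ε δ p₀ p m f ez c b) (hδ : DeltaOK p₀ δ)
    (h0 : ∀ j, height (p₀ j) = 0) (hn : 3 ≤ n) (hε : 0 < ε) (hεδ : 1000 * ε ≤ δ) {i : Fin n}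
    (hi : (i : ℕ) = m + 1) : ∃ q, Steps123 ε δ i p q ∧
      ∃ f' g' : E3, ∃ c' : ℕ → ℂ, ∃ b' : ℝ, g' 2 = 0 ∧ Settled ε δ p₀ q i f' g' c' b' := by
  have hδ0 := hδ.1
  have hin := i.isLt
  have hlow := h.lowChain hε.le hδ0.le h0
  have him : ((i - 1 : Fin n) : ℕ) = m := by have := val_sub_one (j := i) (by omega); omega
  have hi0 : i ≠ 0 := fun e => by rw [e, Fin.val_zero] at hi; omega
  -- lifting
  have hsucc : (0 ≤ height (p (i + 1)) ∧ height (p (i + 1)) ≤ ε) ∧ hdist (p (i + 1)) (p₀ (i + 1)) ≤ δ / 2 := by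
    by_cases e : (i : ℕ) + 1 = n
    · have : i + 1 = 0 := Fin.ext (by rw [val_add_one, if_pos e, Fin.val_zero])
      rw [this]
      exact ⟨⟨by rw [h.arcOver.height_zero]; exact hε.le, h.arcOver.height_zero.le⟩, h.near_zero⟩
    · have := h.rest (i + 1) (by rw [val_add_one, if_neg e]; omega)
      rw [this, h0, hdist_self]
      exact ⟨⟨le_rfl, hε.le⟩, by linarith⟩
  have hpre := h.arcOver.height_last him
  obtain ⟨x, hx, hxh, hxd⟩ := exists_lift hδ h0 hn hε hεδ (h.rest i (by omega)) (by rw [hpre]; exact hε.le) hpre.le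
    hsucc.1.1 hsucc.1.2 (h.near_last _ him) hsucc.2 fun y hy hyd => by
      have := h.arcOver.congr (q := Function.update p i y) fun j hj =>
        Function.update_of_ne (fun e => by rw [e] at hj; omega) _ _
      exact this.isSimplePolygon (hlow.update i hy (by linarith)) hδ h0 (by omega) (.inl (by rw [ez_two]; exact one_pos))
  have hover := h.arcOver.congr (q := Function.update p i x) fun j hj =>
    Function.update_of_ne (fun e => by rw [e] at hj; omega) _ _
  have hlow₁ := hlow.update i hxh.le (show hdist x (p₀ i) ≤ δ by linarith)
  set p₁ := Function.update p i x with hp₁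
  have hp₁i : p₁ i = x := Function.update_self _ _ _
  have hp₁' : ∀ j, j ≠ i → p₁ j = p j := fun j hj => Function.update_of_ne hj _ _
  -- laying down
  obtain ⟨τ, hτ, hτx⟩ : ∃ τ : ℝ, (τ = 1 ∨ τ = -1) ∧ τ * inner ℝ (cross f ez) (x - p₁ 0) ≤ 0 := by
    rcases le_total (inner ℝ (cross f ez) (x - p₁ 0)) 0 with h1 | h1
    · exact ⟨1, .inl rfl, by linarith⟩
    · exact ⟨-1, .inr rfl, by linarith⟩
  have hcos : ∀ x, Real.cos (τ * x) = Real.cos x := by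
    intro x; rcases hτ with e | e <;> rw [e] <;> simp
  have hsin : ∀ x, Real.sin (τ * x) = τ * Real.sin x := by
    intro x; rcases hτ with e | e <;> rw [e] <;> simp
  have hc2 : cross f ez 2 = 0 := by rw [cross_two_apply]; simp [ez]
  have hπ := Real.pi_pos
  have hend : spin f ez (τ * (Real.pi / 2)) = τ • cross f ez := by
    rw [spin, hcos, hsin, Real.cos_pi_div_two, Real.sin_pi_div_two, zero_smul, zero_add, mul_one]
  have hside : inner ℝ (τ • cross f ez) (x - p₁ 0) ≤ 0 := by rwa [real_inner_smul_left]
  have horth : Orth f (τ • cross f ez) := hend ▸ h.arcOver.orth.spin _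
  obtain ⟨p₂, hm₂, hover₂, hp₂⟩ := hover.exists_rotation hlow₁ hδ h0 him
    (θ := τ * (Real.pi / 2)) fun t ht => by
      -- Before the end the plane of the arch still rises from the base. At the end, the low
      -- vertices at height `ε` are the ends of the base and `v_i`, which is on the other side or on
      -- the line of the base.
      rcases ht.2.lt_or_eq with h1 | rfl
      · left
        have : 0 < Real.cos (t * (Real.pi / 2)) :=
          Real.cos_pos_of_mem_Ioo ⟨by nlinarith [ht.1], by nlinarith⟩
        rw [mul_left_comm, spin, hcos, hsin]
        simpa [hc2, ez_two] using this
      · right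
        rw [one_mul, hend]
        refine ⟨by simp [hc2], fun j hj hh => ?_⟩
        rcases hj with rfl | hj
        · rw [sub_self, inner_zero_right]
        · rcases hj.lt_or_eq with hj | hj
          · by_cases e : j = i
            · rw [e, hp₁i]; exact hside
            · rw [hp₁' j e, h.rest j hj, h0] at hh; exact absurd hh hε.ne
          · rw [hover.eq_last hj.symm, add_sub_cancel_left, inner_ofReal_smul horth]
  rw [hend] at hover₂
  have hg2 : (τ • cross f ez) 2 = 0 := by simp [hc2]
  have hp₂0 : p₂ 0 = p₁ 0 := hp₂ 0 (.inl rfl)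
  have hp₂i : p₂ i = x := by rw [hp₂ i (.inr (by omega)), hp₁i]
  have hlow₂ : LowChain ε δ p₀ p₂ m :=
    ⟨fun j hj => by rw [hp₂ j hj]; exact hlow₁.le j hj, fun j hj => by rw [hp₂ j hj]; exact hlow₁.near j hj⟩
  have hs₂ : IsSimplePolygon p₂ := by
    have := (hm₂.2.2.2 1 ⟨zero_le_one, le_rfl⟩).1
    rwa [hm₂.2.2.1] at this
  have hlay : LayDown ε i p₁ p₂ := by
    refine ⟨τ * (Real.pi / 2), ?_, hm₂, fun j hj hji => ?_⟩
    · rcases hτ with e | e <;> rw [e] <;> simp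
    · have hjm : (j : ℕ) < m := him ▸ hji
      refine ⟨by rw [hover₂.height_eq hjm.le, hg2]; simp, ?_⟩
      have ej := hover₂.eq j hjm.le
      have ei := horth.emb_coord h.arcOver.horizontal hg2 (o := p₁ 0) (x := x) (hxh.trans hover.height_zero.symm)
      rw [hover.eq_last him, hp₂i, ← ei, ej, hp₂0, turn_base, turn_base]
      have h1 : 0 ≤ (c j).im * -(coord f (τ • cross f ez) (x - p₁ 0)).im :=
        mul_nonneg (hover₂.im_pos hj hjm).le (neg_nonneg.2 hside)
      have h2 := mul_nonneg (sq_nonneg (b * (f 0 * (τ • cross f ez) 1 - f 1 * (τ • cross f ez) 0))) h1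
      linarith
  -- convexifying
  have hrest₂ : ∀ j, i < j → p₂ j = p₀ j := fun j hj => by
    have : (i : ℕ) < j := hj
    rw [hp₂ j (.inr (by omega)), hp₁' j hj.ne', h.rest j (by omega)]
  obtain ⟨q, hq, hqf, f', g', c', b', hg', hover'⟩ := hover₂.exists_convexify hg2 hlow₂ hδ h0 hi
    (by rw [hp₂i]; exact hxh) (by rw [hp₂i, hp₂0]; exact hside) hs₂
    (fun j hj => by rw [hrest₂ j hj, h0]; exact hε)
  refine ⟨q, ⟨p₁, p₂, hx, hlay, hq⟩, f', g', c', b', hg', hover', ?_, fun j hj => ?_, fun j hj => ?_⟩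
  · rw [hqf 0 (.inl rfl), hp₂0, hp₁' 0 hi0.symm]; exact h.near_zero
  · rw [Fin.ext hj, hqf i (.inr le_rfl), hp₂i]; exact hxd
  · rw [hqf j (.inr (le_of_lt hj)), hrest₂ j hj]

/-! ### The initial step -/

/-- Without an arch the whole chain is low, so simplicity comes from the projection alone. -/
theorem exists_lift_of_low (hδ : DeltaOK p₀ δ) (h0 : ∀ j, height (p₀ j) = 0) (hn : 3 ≤ n) (hε : 0 < ε)
    (hεδ : 1000 * ε ≤ δ)
    (hp : ∀ j, 0 ≤ height (p j) ∧ height (p j) ≤ ε ∧ hdist (p j) (p₀ j) ≤ δ / 2) {k : Fin n} (hk : p k = p₀ k) :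
    ∃ x, Lift ε δ k p (Function.update p k x) ∧ height x = ε ∧
      ∀ j, 0 ≤ height (Function.update p k x j) ∧ height (Function.update p k x j) ≤ ε ∧
        hdist (Function.update p k x j) (p₀ j) ≤ δ / 2 := by
  have hδ0 := hδ.1
  have hlow : LowChain ε δ p₀ p 0 := ⟨fun j _ => (hp j).2.1, fun j _ => (hp j).2.2.trans (by linarith)⟩
  obtain ⟨x, hx, hxh, hxd⟩ := exists_lift hδ h0 hn hε hεδ hk (hp _).1 (hp _).2.1 (hp _).1 (hp _).2.1 (hp _).2.2
    (hp _).2.2 fun y hy hyd => (hlow.update k hy (by linarith)).isSimplePolygon hδ h0 hn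
  refine ⟨x, hx, hxh, fun j => ?_⟩
  by_cases e : j = k
  · subst e; rw [Function.update_self]; exact ⟨by rw [hxh]; exact hε.le, hxh.le, hxd⟩
  · rw [Function.update_of_ne e]; exact hp j

theorem exists_triangle (hδ : DeltaOK p₀ δ) (h0 : ∀ j, height (p₀ j) = 0) (hn : 3 ≤ n)
    (hh : ∀ j : Fin n, (j : ℕ) ≤ 2 → height (p j) = ε) (hd : ∀ j, hdist (p j) (p₀ j) ≤ δ / 2)
    (hr : ∀ j : Fin n, 2 < (j : ℕ) → p j = p₀ j) :
    ∃ f g : E3, ∃ c : ℕ → ℂ, ∃ b : ℝ, g 2 = 0 ∧ Settled ε δ p₀ p 2 f g c b := by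
  have hδ0 := hδ.1
  have v1 : ((1 : Fin n) : ℕ) = 1 := by rw [Fin.val_one']; exact Nat.mod_eq_of_lt (by omega)
  have v2 : ((1 + 1 : Fin n) : ℕ) = 2 := by rw [val_add_one, v1, if_neg (by omega)]
  have hT := hδ.turn_ne_zero h0 hn (k := 1) (a := p (1 - 1)) (v := p 1) (b := p (1 + 1)) ((hd _).trans (by linarith))
    ((hd _).trans (by linarith)) ((hd _).trans (by linarith))
  rw [sub_self] at hT
  -- The sign of the second coordinate vector is chosen such that `v_0, v_1, v_2` are clockwise in
  -- the resulting coordinates.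
  obtain ⟨τ, hτ, hτT⟩ : ∃ τ : ℝ, (τ = 1 ∨ τ = -1) ∧ τ * turn (p 0) (p 1) (p (1 + 1)) < 0 := by
    rcases lt_or_gt_of_ne hT with h1 | h1
    · exact ⟨1, .inl rfl, by linarith⟩
    · exact ⟨-1, .inr rfl, by linarith⟩
  have hττ : τ ^ 2 = 1 := by rcases hτ with rfl | rfl <;> norm_num
  have horth : Orth !₂[1, 0, 0] !₂[0, τ, 0] := by
    refine ⟨?_, ?_, ?_⟩
    · refine (pow_eq_one_iff_of_nonneg (norm_nonneg _) two_ne_zero).1 ?_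
      rw [norm_sq_eq]; simp
    · refine (pow_eq_one_iff_of_nonneg (norm_nonneg _) two_ne_zero).1 ?_
      rw [norm_sq_eq]; simp [hττ]
    · rw [inner_eq]; simp
  set F : E3 := !₂[1, 0, 0] with hF
  set G : E3 := !₂[0, τ, 0] with hG
  have hF2 : F 2 = 0 := by simp [hF]
  have hG2 : G 2 = 0 := by simp [hG]
  set c : ℕ → ℂ := fun j => coord F G (p (Fin.ofNat n j) - p 0) with hc
  have hcv : ∀ j : Fin n, c j = coord F G (p j - p 0) := fun j => by
    rw [hc]; simp only [Fin.ofNat_val_eq_self]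
  have hc0 : c 0 = 0 := by
    have := hcv 0
    rw [Fin.val_zero] at this
    rw [this, sub_self, coord, inner_zero_right, inner_zero_right]; rfl
  have hz : height (p 0) = ε := hh 0 (by simp)
  have harc : WArc 2 c := by
    refine .core le_rfl ?_
    intro i j k hij hjk hk
    obtain ⟨rfl, rfl, rfl⟩ : i = 0 ∧ j = 1 ∧ k = 2 := by omega
    have e1 := hcv 1
    have e2 := hcv (1 + 1)
    rw [v1] at e1
    rw [v2] at e2
    rw [hc0, e1, e2]
    simp only [cw, coord, inner_eq, sub_zero, PiLp.sub_apply]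
    simp [hF, hG]
    simp only [turn] at hτT
    linarith
  obtain ⟨f, g, c', b, hg, hover⟩ := exists_arcOver horth hF2 hG2 harc hc0
    (fun j hj => by rw [hcv, horth.emb_coord hF2 hG2 ((hh j hj).trans hz.symm)]) hz
  exact ⟨f, g, c', b, hg, hover, hd 0, fun j _ => hd j, hr⟩

theorem exists_init (hδ : DeltaOK p₀ δ) (h0 : ∀ j, height (p₀ j) = 0) (hn : 4 ≤ n) (hε : 0 < ε)
    (hεδ : 1000 * ε ≤ δ) :
    ∃ q, Init ε δ p₀ q ∧ ∃ f : E3, ∃ c : ℕ → ℂ, ∃ b : ℝ, Settled ε δ p₀ q 2 f ez c b := by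
  have hδ0 := hδ.1
  have hn3 : 3 ≤ n := by omega
  have v1 : ((1 : Fin n) : ℕ) = 1 := by rw [Fin.val_one']; exact Nat.mod_eq_of_lt (by omega)
  have v2 : ((2 : Fin n) : ℕ) = 2 := by
    change 2 % n = 2
    exact Nat.mod_eq_of_lt (by omega)
  have n01 : (0 : Fin n) ≠ 1 := fun e => by have := congrArg Fin.val e; rw [v1, Fin.val_zero] at this; omega
  have n02 : (0 : Fin n) ≠ 2 := fun e => by have := congrArg Fin.val e; rw [v2, Fin.val_zero] at this; omega
  have n12 : (1 : Fin n) ≠ 2 := fun e => by have := congrArg Fin.val e; rw [v1, v2] at this; omega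
  obtain ⟨x, hx, hxh, hx'⟩ := exists_lift_of_low (p := p₀) hδ h0 hn3 hε hεδ
    (fun j => ⟨(h0 j).ge, by rw [h0]; exact hε.le, by rw [hdist_self]; linarith⟩) (k := 1) rfl
  obtain ⟨y, hy, hyh, hy'⟩ := exists_lift_of_low hδ h0 hn3 hε hεδ hx' (k := 0) (Function.update_of_ne n01 _ _)
  obtain ⟨z, hz, hzh, hz'⟩ := exists_lift_of_low hδ h0 hn3 hε hεδ hy' (k := 2)
    (by rw [Function.update_of_ne n02.symm, Function.update_of_ne n12.symm])
  obtain ⟨f, g, c, b, hg, hS⟩ := exists_triangle hδ h0 hn3 (p := Function.update (Function.update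
    (Function.update p₀ 1 x) 0 y) 2 z) (ε := ε) (fun j hj => by
      have : j = 0 ∨ j = 1 ∨ j = 2 := by
        rcases (show (j : ℕ) = 0 ∨ (j : ℕ) = 1 ∨ (j : ℕ) = 2 by omega) with e | e | e
        · exact .inl (Fin.ext (by rw [e, Fin.val_zero]))
        · exact .inr (.inl (Fin.ext (by rw [e, v1])))
        · exact .inr (.inr (Fin.ext (by rw [e, v2])))
      rcases this with rfl | rfl | rfl
      · rwa [Function.update_of_ne n02, Function.update_self]
      · rwa [Function.update_of_ne n12, Function.update_of_ne n01.symm, Function.update_self]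
      · rwa [Function.update_self]) (fun j => (hz' j).2.2) (fun j hj => by
      rw [Function.update_of_ne, Function.update_of_ne, Function.update_of_ne]
      · rintro rfl; omega
      · rintro rfl; simp at hj
      · rintro rfl; omega)
  obtain ⟨q, hq, hq'⟩ := hS.exists_raise hg hδ h0 hε v2
  exact ⟨q, ⟨_, _, _, hx, hy, hz, hq⟩, f, c, b, hq'⟩

/-! ### The whole algorithm -/

theorem exists_run (hδ : DeltaOK p₀ δ) (h0 : ∀ j, height (p₀ j) = 0) (hn : 4 ≤ n) (hε : 0 < ε)
    (hεδ : 1000 * ε ≤ δ) : ∃ q, Run ε δ p₀ q := by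
  classical
  have hδ0 := hδ.1
  set S : ℕ → Conf n → Prop := fun m p => ∃ f : E3, ∃ c : ℕ → ℂ, ∃ b : ℝ, Settled ε δ p₀ p m f ez c b with hS
  obtain ⟨p₂, hinit, hp₂⟩ := exists_init hδ h0 hn hε hεδ
  -- Made total for `choose`: nothing is promised outside the states that occur.
  have step : ∀ m p, ∃ q, S m p → ∀ i : Fin n, (i : ℕ) = m + 1 →
      (∃ d, Steps123 ε δ i p d ∧ Raise i d q) ∧ S (m + 1) q := by
    intro m p
    by_cases h : S m p ∧ m + 1 < n
    · obtain ⟨⟨f, c, b, h⟩, hm⟩ := h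
      obtain ⟨d, hd, f', g', c', b', hg', hd'⟩ := h.exists_steps hδ h0 (by omega) hε hεδ (i := ⟨m + 1, hm⟩) rfl
      obtain ⟨q, hq, hq'⟩ := hd'.exists_raise hg' hδ h0 hε rfl
      refine ⟨q, fun _ i hi => ?_⟩
      obtain rfl : i = ⟨m + 1, hm⟩ := Fin.ext hi
      exact ⟨⟨d, hd, hq⟩, f', c', b', hq'⟩
    · exact ⟨p, fun h1 i hi => absurd ⟨h1, by omega⟩ h⟩
  choose F hF using step
  -- `s k` is the configuration after step `k + 2`; hence the shift `i - 2` in the witness for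
  -- `Run`, whose values at `i < 2` play no role.
  set s : ℕ → Conf n := fun k => Nat.rec p₂ (fun k p => F (k + 2) p) k with hs
  have hsS : ∀ k, k + 2 < n → S (k + 2) (s k) := by
    intro k
    induction k with
    | zero => exact fun _ => hp₂
    | succ k ih => exact fun hk => (hF (k + 2) (s k) (ih (by omega)) ⟨k + 1 + 2, hk⟩ rfl).2
  have v2 : ((2 : Fin n) : ℕ) = 2 := by
    change 2 % n = 2
    exact Nat.mod_eq_of_lt (by omega)
  have hc : ∀ i : Fin n, 3 ≤ (i : ℕ) → ((i - 1 : Fin n) : ℕ) - 2 + 2 + 1 = i := fun i hi => by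
    have := val_sub_one (j := i) (by omega); omega
  obtain ⟨f, c, b, hlast⟩ := hsS (n - 4) (by omega)
  obtain ⟨l, hl⟩ : ∃ l : Fin n, (l : ℕ) = n - 1 := ⟨⟨n - 1, by omega⟩, rfl⟩
  have hl1 : ((l - 1 : Fin n) : ℕ) - 2 = n - 4 := by
    have := val_sub_one (j := l) (by omega)
    omega
  obtain ⟨q, hq, f', g', c', b', hg', hq'⟩ := hlast.exists_steps hδ h0 (by omega) hε hεδ (i := l)
    (by omega)
  refine ⟨q, fun i => s ((i : ℕ) - 2), ⟨?_, ?_⟩, fun i hi hin => ?_, fun i hi => ?_, ?_, fun j => ?_⟩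
  · simp only [v2]; exact hinit
  · simp only [v2]
    obtain ⟨f, c, b, h⟩ := hp₂
    exact h.hyp hε hδ0 h0 v2
  · have e := hc i hi
    have hSi := hF _ _ (hsS (((i - 1 : Fin n) : ℕ) - 2) (by omega)) i (by omega)
    have e2 : (i : ℕ) - 2 = ((i - 1 : Fin n) : ℕ) - 2 + 1 := by omega
    dsimp only
    rw [e2]
    obtain ⟨f, c, b, h⟩ := hSi.2
    exact ⟨hSi.1, h.hyp hε hδ0 h0 (by omega)⟩
  · obtain rfl : i = l := Fin.ext (by omega)
    simp only [hl1]
    exact hq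
  · exact hq'.arcOver.arc.weakArc.isConvexPolygon (by omega) hq'.arcOver.arc.two_le hq'.arcOver.orth
      fun j => hq'.arcOver.eq j (by omega)
  · rw [hq'.arcOver.height_eq (by omega), hg', mul_zero, add_zero]

end

end Arch
end

noncomputable section

namespace Arch

open Set Filter Topology

/-! ### Motions: composition, isometries, shifts -/

/-- There is a motion from `p` to `q`. -/
def Movable {n : ℕ} [NeZero n] (p q : Conf n) : Prop := ∃ γ, IsMotion γ p q

section

variable {n : ℕ} [NeZero n] {p q r : Conf n}

theorem Movable.trans (h₁ : Movable p q) (h₂ : Movable q r) : Movable p r := by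
  obtain ⟨f, hf, hf0, hf1, hf'⟩ := h₁
  obtain ⟨g, hg, hg0, hg1, hg'⟩ := h₂
  have hlen : ∀ j, dist (q j) (q (j + 1)) = dist (p j) (p (j + 1)) := by
    rw [← hf1]; exact (hf' 1 ⟨zero_le_one, le_rfl⟩).2
  refine ⟨concat f g, continuousOn_concat hf hg (hf1.trans hg0.symm), ?_, ?_, fun t ht => ?_⟩
  · rw [concat_le _ _ (by norm_num), mul_zero, hf0]
  · rw [concat_gt _ _ (by norm_num)]; norm_num [hg1]
  · refine concat_induction (C := fun c : Conf n => IsSimplePolygon c ∧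
      ∀ j, dist (c j) (c (j + 1)) = dist (p j) (p (j + 1))) ht hf' fun s hs => ⟨(hg' s hs).1, fun j => ?_⟩
    rw [(hg' s hs).2, hlen]

theorem IsMotion.movable {γ : ℝ → Conf n} (h : IsMotion γ p q) : Movable p q := ⟨γ, h⟩

theorem Steps123.movable {ε δ : ℝ} {i : Fin n} (h : Steps123 ε δ i p q) : Movable p q := by
  obtain ⟨a, b, ⟨_, ha, _⟩, ⟨_, _, hb, _⟩, γ, hγ, _⟩ := h
  exact (ha.movable.trans hb.movable).trans hγ.movable

theorem Raise.movable {i : Fin n} (h : Raise i p q) : Movable p q := by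
  obtain ⟨_, _, h⟩ := h
  exact h.movable

theorem Run.movable {ε δ : ℝ} (hn : 4 ≤ n) (h : Run ε δ p q) : Movable p q := by
  obtain ⟨c, ⟨⟨a₁, a₂, a₃, ⟨_, h₁, _⟩, ⟨_, h₂, _⟩, ⟨_, h₃, _⟩, h₄⟩, -⟩, hstep, hlast, -⟩ := h
  have v2 : ((2 : Fin n) : ℕ) = 2 := by
    change 2 % n = 2
    exact Nat.mod_eq_of_lt (by omega)
  have key : ∀ m, 2 ≤ m → m + 2 ≤ n → ∀ i : Fin n, (i : ℕ) = m → Movable p (c i) := by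
    intro m hm
    induction m, hm using Nat.le_induction with
    | base =>
      intro _ i hi
      obtain rfl : i = 2 := Fin.ext (hi.trans v2.symm)
      exact ((h₁.movable.trans h₂.movable).trans h₃.movable).trans h₄.movable
    | succ m hm ih =>
      intro hmn i hi
      obtain ⟨⟨d, hd, hd'⟩, -⟩ := hstep i (by omega) (by omega)
      have := val_sub_one (j := i) (by omega)
      exact ((ih (by omega) (i - 1) (by omega)).trans hd.movable).trans hd'.movable
  obtain ⟨l, hl⟩ : ∃ l : Fin n, (l : ℕ) = n - 1 := ⟨⟨n - 1, by omega⟩, rfl⟩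
  have := val_sub_one (j := l) (by omega)
  exact (key (n - 2) (by omega) (by omega) (l - 1) (by omega)).trans (hlast l (by omega)).movable

/-- The chain can be convexified such that straight joints stay straight. -/
def Convexifiable (p : Conf n) : Prop := ∃ (γ : ℝ → Conf n) (q : Conf n), IsMotion γ p q ∧
  IsConvexPolygon q ∧ ∀ j, IsStraight p j → ∀ t ∈ Icc (0 : ℝ) 1, IsStraight (γ t) j

theorem IsConvexPolygon.convexifiable (h : IsConvexPolygon p) : Convexifiable p :=
  ⟨fun _ => p, p, ⟨continuousOn_const, rfl, rfl, fun _ _ => ⟨h.1, fun _ => rfl⟩⟩, h, fun _ hj _ _ => hj⟩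

theorem isSimplePolygon_iff : IsSimplePolygon p ↔ 3 ≤ n ∧ (∀ i, p i ≠ p (i + 1)) ∧
    ∀ i j : Fin n, i ≠ j → ∀ s ∈ Ico (0 : ℝ) 1, ∀ t ∈ Ico (0 : ℝ) 1, edgePt p i s ≠ edgePt p j t :=
  ⟨fun h => ⟨h.1, h.2.1, fun _ _ hij _ hs _ ht => h.edgePt_ne hij hs ht⟩,
    fun h => isSimplePolygon_of_edgePt h.1 h.2.1 fun i j hij => h.2.2 i j hij.ne⟩

theorem edgePt_isometry (Φ : E3 ≃ᵃⁱ[ℝ] E3) (p : Conf n) (i : Fin n) (s : ℝ) :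
    edgePt (fun j => Φ (p j)) i s = Φ (edgePt p i s) :=
  (Φ.toAffineEquiv.toAffineMap.apply_lineMap (p i) (p (i + 1)) s).symm

theorem IsSimplePolygon.isometry (h : IsSimplePolygon p) (Φ : E3 ≃ᵃⁱ[ℝ] E3) :
    IsSimplePolygon fun j => Φ (p j) := by
  rw [isSimplePolygon_iff] at h ⊢
  refine ⟨h.1, fun i => Φ.injective.ne (h.2.1 i), fun i j hij s hs t ht => ?_⟩
  rw [edgePt_isometry, edgePt_isometry]
  exact Φ.injective.ne (h.2.2 i j hij s hs t ht)

theorem isStraight_isometry (Φ : E3 ≃ᵃⁱ[ℝ] E3) {j : Fin n} :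
    IsStraight (fun j => Φ (p j)) j ↔ IsStraight p j := by
  rw [IsStraight, IsStraight, jointAngle, jointAngle]
  have := Φ.toAffineIsometry.angle_map (p (j - 1)) (p j) (p (j + 1))
  rw [← this]; rfl

theorem IsConvexPolygon.isometry (h : IsConvexPolygon p) (Φ : E3 ≃ᵃⁱ[ℝ] E3) :
    IsConvexPolygon fun j => Φ (p j) := by
  have hin : ∀ (u : E3) (i j : Fin n), inner ℝ (Φ.linearIsometryEquiv u) (Φ (p j) - Φ (p i)) =
      inner ℝ u (p j - p i) := fun u i j => by
    rw [← vsub_eq_sub (Φ (p j)), ← Φ.map_vsub, LinearIsometryEquiv.inner_map_map, vsub_eq_sub]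
  refine ⟨h.1.isometry Φ, ?_, fun i => ?_⟩
  · have h2 := h.2.1
    rw [coplanar_iff_finrank_le_two] at h2 ⊢
    have e : range (fun j => Φ (p j)) = Φ.toAffineEquiv.toAffineMap '' range p := by
      rw [← range_comp]; rfl
    rw [e, ← AffineMap.map_vectorSpan]
    exact (Submodule.finrank_map_le _ _).trans h2
  · obtain ⟨u, h1, h2, j, h3⟩ := h.2.2 i
    exact ⟨Φ.linearIsometryEquiv u, by rw [hin]; exact h1, fun k => by rw [hin]; exact h2 k, j,
      by rw [hin]; exact h3⟩

theorem Convexifiable.of_isometry {Φ : E3 ≃ᵃⁱ[ℝ] E3} (h : Convexifiable fun j => Φ (p j)) :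
    Convexifiable p := by
  obtain ⟨γ, q, ⟨hc, h0, h1, hm⟩, hq, hs⟩ := h
  refine ⟨fun t j => Φ.symm (γ t j), fun j => Φ.symm (q j), ⟨?_, ?_, ?_, fun t ht => ⟨?_, fun j => ?_⟩⟩,
    hq.isometry _, fun j hj t ht => ?_⟩
  · refine continuousOn_pi.2 fun j => ?_
    exact Φ.symm.continuous.comp_continuousOn (continuousOn_pi.1 hc j)
  · simp [h0]
  · simp [h1]
  · exact (hm t ht).1.isometry _
  · rw [Φ.symm.dist_map, (hm t ht).2, Φ.dist_map]
  · exact (isStraight_isometry Φ.symm).2 (hs j ((isStraight_isometry Φ).2 hj) t ht)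

theorem edgePt_shift (s : Fin n) (p : Conf n) (i : Fin n) (r : ℝ) :
    edgePt (fun j => p (j + s)) i r = edgePt p (i + s) r := by
  rw [edgePt, edgePt, add_right_comm]

theorem IsSimplePolygon.shift (h : IsSimplePolygon p) (s : Fin n) : IsSimplePolygon fun j => p (j + s) := by
  rw [isSimplePolygon_iff] at h ⊢
  refine ⟨h.1, fun i => ?_, fun i j hij a ha b hb => ?_⟩
  · rw [add_right_comm]; exact h.2.1 _
  · rw [edgePt_shift, edgePt_shift]
    exact h.2.2 _ _ (fun e => hij (add_right_cancel e)) a ha b hb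

theorem isStraight_shift (s : Fin n) {j : Fin n} :
    IsStraight (fun j => p (j + s)) j ↔ IsStraight p (j + s) := by
  rw [IsStraight, IsStraight, jointAngle, jointAngle, add_right_comm, sub_add_eq_add_sub]

theorem range_shift (s : Fin n) (p : Conf n) : range (fun j => p (j + s)) = range p :=
  (Equiv.addRight s).surjective.range_comp p

theorem IsConvexPolygon.shift (h : IsConvexPolygon p) (s : Fin n) : IsConvexPolygon fun j => p (j + s) := by
  refine ⟨h.1.shift s, by rw [range_shift]; exact h.2.1, fun i => ?_⟩
  obtain ⟨u, h1, h2, j, h3⟩ := h.2.2 (i + s)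
  refine ⟨u, ?_, fun k => h2 _, j - s, ?_⟩ <;> beta_reduce
  · rw [add_right_comm]; exact h1
  · rw [sub_add_cancel]; exact h3

theorem Convexifiable.of_shift {s : Fin n} (h : Convexifiable fun j => p (j + s)) : Convexifiable p := by
  obtain ⟨γ, q, ⟨hc, h0, h1, hm⟩, hq, hs⟩ := h
  refine ⟨fun t j => γ t (j + -s), fun j => q (j + -s), ⟨?_, ?_, ?_, fun t ht => ⟨?_, fun j => ?_⟩⟩,
    hq.shift _, fun j hj t ht => ?_⟩
  · exact continuousOn_pi.2 fun j => continuousOn_pi.1 hc _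
  · simp [h0]
  · simp [h1]
  · exact (hm t ht).1.shift _
  · have := (hm t ht).2 (j + -s)
    beta_reduce at this ⊢
    rw [add_right_comm, this, neg_add_cancel_right, add_right_comm (j + -s) 1 s, neg_add_cancel_right]
  · refine (isStraight_shift (-s)).2 (hs _ ((isStraight_shift s).2 ?_) t ht)
    rwa [neg_add_cancel_right]

/-! ### Inserting a straight vertex -/

/-- The chain with one more vertex at the end, on the closing edge. -/
def insertLast (r : ℝ) (p : Conf n) : Conf (n + 1) := fun j =>
  if h : (j : ℕ) < n then p ⟨j, h⟩ else edgePt p (0 - 1) r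

theorem insertLast_castSucc (r : ℝ) (p : Conf n) (j : Fin n) : insertLast r p j.castSucc = p j :=
  dif_pos j.isLt

theorem insertLast_last (r : ℝ) (p : Conf n) : insertLast r p (Fin.last n) = edgePt p (0 - 1) r :=
  dif_neg (by simp)

theorem castSucc_add_one {j : Fin n} (hj : (j : ℕ) + 1 < n) : j.castSucc + 1 = (j + 1).castSucc := by
  refine Fin.ext ?_
  rw [val_add_one, Fin.val_castSucc, Fin.val_castSucc, val_add_one, if_neg (by omega), if_neg (by omega)]

theorem castSucc_zero_sub_one_add_one : (0 - 1 : Fin n).castSucc + 1 = Fin.last n := by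
  refine Fin.ext ?_
  have := val_zero_sub_one (n := n)
  rw [val_add_one, Fin.val_castSucc, if_neg (by omega), Fin.val_last, this]

theorem last_add_one : Fin.last n + 1 = (0 : Fin n).castSucc := by
  refine Fin.ext ?_
  rw [val_add_one, if_pos (by simp)]; simp

theorem eq_zero_sub_one {j : Fin n} (hj : ¬ (j : ℕ) + 1 < n) : j = 0 - 1 := by
  have := val_zero_sub_one (n := n)
  exact Fin.ext (by omega)

theorem edgePt_edgePt_left (p : Conf n) (i : Fin n) (r s : ℝ) :
    AffineMap.lineMap (p i) (edgePt p i r) s = edgePt p i (r * s) := by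
  simp only [edgePt, AffineMap.lineMap_apply, vsub_eq_sub, vadd_eq_add]; module

theorem edgePt_edgePt_right (p : Conf n) (i : Fin n) (r s : ℝ) :
    AffineMap.lineMap (edgePt p i r) (p (i + 1)) s = edgePt p i (r + (1 - r) * s) := by
  simp only [edgePt, AffineMap.lineMap_apply, vsub_eq_sub, vadd_eq_add]; module

theorem edgePt_insertLast_of_lt (r : ℝ) (p : Conf n) {j : Fin n} (hj : (j : ℕ) + 1 < n) (s : ℝ) :
    edgePt (insertLast r p) j.castSucc s = edgePt p j s := by
  rw [edgePt, castSucc_add_one hj, insertLast_castSucc, insertLast_castSucc, edgePt]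

theorem edgePt_insertLast_penult (r : ℝ) (p : Conf n) (s : ℝ) :
    edgePt (insertLast r p) (0 - 1 : Fin n).castSucc s = edgePt p (0 - 1) (r * s) := by
  rw [edgePt, castSucc_zero_sub_one_add_one, insertLast_castSucc, insertLast_last, edgePt_edgePt_left]

theorem edgePt_insertLast_last (r : ℝ) (p : Conf n) (s : ℝ) :
    edgePt (insertLast r p) (Fin.last n) s = edgePt p (0 - 1) (r + (1 - r) * s) := by
  rw [edgePt, last_add_one, insertLast_castSucc, insertLast_last, ← edgePt_edgePt_right, sub_add_cancel]

/-- The edges of the chain are unions of edges of the chain with the additional vertex. -/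
theorem exists_edgePt {r : ℝ} (hr : r ∈ Ioo (0 : ℝ) 1) (p : Conf n) (i : Fin n) {s : ℝ} (hs : s ∈ Ico (0 : ℝ) 1) :
    ∃ j : Fin (n + 1), (j = i.castSucc ∨ j = Fin.last n ∧ i = 0 - 1) ∧
      ∃ t ∈ Ico (0 : ℝ) 1, edgePt (insertLast r p) j t = edgePt p i s := by
  have hr1 : 0 < 1 - r := by linarith [hr.2]
  have hr0 := hr.1
  by_cases hi : (i : ℕ) + 1 < n
  · exact ⟨_, .inl rfl, s, hs, edgePt_insertLast_of_lt r p hi s⟩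
  · obtain rfl := eq_zero_sub_one hi
    rcases lt_or_ge s r with h | h
    · refine ⟨_, .inl rfl, s / r, ⟨div_nonneg hs.1 hr0.le, (div_lt_one hr0).2 h⟩, ?_⟩
      rw [edgePt_insertLast_penult, mul_div_cancel₀ _ hr0.ne']
    · refine ⟨_, .inr ⟨rfl, rfl⟩, (s - r) / (1 - r), ⟨div_nonneg (by linarith) hr1.le, (div_lt_one hr1).2 (by linarith [hs.2])⟩, ?_⟩
      rw [edgePt_insertLast_last, mul_div_cancel₀ _ hr1.ne', add_sub_cancel]

/-- The two last edges divide the closing edge at the parameter `r`; the comparison with `r`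
recovers the edge from which a point came. -/
theorem exists_edgePt_of_insertLast {r : ℝ} (hr : r ∈ Ioo (0 : ℝ) 1) (p : Conf n) (j : Fin (n + 1)) {t : ℝ}
    (ht : t ∈ Ico (0 : ℝ) 1) : ∃ i : Fin n, ∃ s ∈ Ico (0 : ℝ) 1, edgePt (insertLast r p) j t = edgePt p i s ∧
      (j = i.castSucc ∧ (i = 0 - 1 → s < r) ∨ j = Fin.last n ∧ i = 0 - 1 ∧ r ≤ s) := by
  have hr1 : 0 < 1 - r := by linarith [hr.2]
  have hr0 := hr.1
  refine Fin.lastCases ?_ (fun i => ?_) j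
  · have := mul_lt_mul_of_pos_left ht.2 hr1
    have h2 := mul_nonneg hr1.le ht.1
    exact ⟨0 - 1, r + (1 - r) * t, ⟨by linarith, by linarith⟩, edgePt_insertLast_last r p t,
      .inr ⟨rfl, rfl, by linarith⟩⟩
  · by_cases hi : (i : ℕ) + 1 < n
    · refine ⟨i, t, ht, edgePt_insertLast_of_lt r p hi t, .inl ⟨rfl, fun e => ?_⟩⟩
      have := val_zero_sub_one (n := n)
      rw [← e] at this; omega
    · obtain rfl := eq_zero_sub_one hi
      have h2 := mul_lt_mul_of_pos_left ht.2 hr0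
      exact ⟨0 - 1, r * t, ⟨mul_nonneg hr0.le ht.1, by linarith [hr.2]⟩, edgePt_insertLast_penult r p t,
        .inl ⟨rfl, fun _ => by linarith⟩⟩

theorem IsSimplePolygon.insertLast (h : IsSimplePolygon p) {r : ℝ} (hr : r ∈ Ioo (0 : ℝ) 1) :
    IsSimplePolygon (insertLast r p) := by
  have hdis : ∀ i j : Fin (n + 1), i ≠ j → ∀ s ∈ Ico (0 : ℝ) 1, ∀ t ∈ Ico (0 : ℝ) 1,
      edgePt (Arch.insertLast r p) i s ≠ edgePt (Arch.insertLast r p) j t := by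
    intro i j hij s hs t ht e
    obtain ⟨i', s', hs', ei, hi⟩ := exists_edgePt_of_insertLast hr p i hs
    obtain ⟨j', t', ht', ej, hj⟩ := exists_edgePt_of_insertLast hr p j ht
    have e' := ei.symm.trans (e.trans ej)
    have hij' : i' = j' := by
      by_contra hne
      exact h.edgePt_ne hne hs' ht' e'
    subst hij'
    have hst : s' = t' := AffineMap.lineMap_injective ℝ (h.2.1 i') e'
    subst hst
    rcases hi with ⟨rfl, hi⟩ | ⟨rfl, hi, hi'⟩ <;> rcases hj with ⟨rfl, hj⟩ | ⟨rfl, hj, hj'⟩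
    · exact hij rfl
    · linarith [hi hj]
    · linarith [hj hi]
    · exact hij rfl
  refine isSimplePolygon_iff.2 ⟨by have := h.1; omega, fun i e => ?_, hdis⟩
  have hn := h.1
  refine hdis i (i + 1) (add_one_ne (by omega) i).symm 0 ⟨le_rfl, one_pos⟩ 0 ⟨le_rfl, one_pos⟩ ?_
  rw [edgePt_zero, edgePt_zero, e]

theorem IsSimplePolygon.of_insertLast (hn : 3 ≤ n) {r : ℝ} (hr : r ∈ Ioo (0 : ℝ) 1)
    (h : IsSimplePolygon (Arch.insertLast r p)) : IsSimplePolygon p := by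
  have hdis : ∀ i j : Fin n, i ≠ j → ∀ s ∈ Ico (0 : ℝ) 1, ∀ t ∈ Ico (0 : ℝ) 1, edgePt p i s ≠ edgePt p j t := by
    intro i j hij s hs t ht e
    obtain ⟨i', hi, s', hs', ei⟩ := exists_edgePt hr p i hs
    obtain ⟨j', hj, t', ht', ej⟩ := exists_edgePt hr p j ht
    refine h.edgePt_ne ?_ hs' ht' (ei.trans (e.trans ej.symm))
    rintro rfl
    rcases hi with rfl | ⟨rfl, rfl⟩ <;> rcases hj with hj | ⟨hj, rfl⟩
    · exact hij (Fin.castSucc_injective n hj)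
    · exact (Fin.castSucc_lt_last i).ne hj
    · exact (Fin.castSucc_lt_last j).ne hj.symm
    · exact hij rfl
  refine isSimplePolygon_iff.2 ⟨hn, fun i e => ?_, hdis⟩
  refine hdis i (i + 1) (add_one_ne (by omega) i).symm 0 ⟨le_rfl, one_pos⟩ 0 ⟨le_rfl, one_pos⟩ ?_
  rw [edgePt_zero, edgePt_zero, e]

theorem edgePt_sub_left (p : Conf n) (i : Fin n) (r : ℝ) : edgePt p i r - p i = r • (p (i + 1) - p i) := by
  simp [edgePt, AffineMap.lineMap_apply]

theorem edgePt_sub_right (p : Conf n) (i : Fin n) (r : ℝ) :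
    edgePt p i r - p (i + 1) = (1 - r) • (p i - p (i + 1)) := by
  simp only [edgePt, AffineMap.lineMap_apply, vsub_eq_sub, vadd_eq_add]; module

theorem isStraight_insertLast_last (h : ∀ i, p i ≠ p (i + 1)) {r : ℝ} (hr : r ∈ Ioo (0 : ℝ) 1) :
    IsStraight (insertLast r p) (Fin.last n) := by
  have hr1 : 0 < 1 - r := by linarith [hr.2]
  have hr0 := hr.1
  rw [isStraight_iff, last_add_one, ← castSucc_zero_sub_one_add_one, add_sub_cancel_right,
    castSucc_zero_sub_one_add_one, insertLast_last, insertLast_castSucc, insertLast_castSucc]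
  have h1 := h (0 - 1)
  have e1 := edgePt_sub_left p (0 - 1) r
  have e2 := edgePt_sub_right p (0 - 1) r
  rw [sub_add_cancel] at h1 e1 e2
  refine ⟨?_, -((1 - r) / r), by simpa using div_pos hr1 hr0, ?_⟩
  · rw [← neg_sub, e1, neg_ne_zero]
    exact smul_ne_zero hr0.ne' (sub_ne_zero.2 h1.symm)
  · rw [← neg_sub, e2, ← neg_sub (edgePt p (0 - 1) r), e1, smul_neg, neg_smul, neg_neg, smul_smul,
      div_mul_cancel₀ _ hr0.ne', ← smul_neg, neg_sub]

/-- The insertion moves a neighbour of an old joint only along its ray from that joint. -/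
theorem jointAngle_insertLast {r : ℝ} (hr : r ∈ Ioo (0 : ℝ) 1) (j : Fin n) :
    jointAngle (insertLast r p) j.castSucc = jointAngle p j := by
  have hr1 : 0 < 1 - r := by linarith [hr.2]
  have hr0 := hr.1
  have hL : ∃ a > (0 : ℝ), insertLast r p (j.castSucc - 1) - p j = a • (p (j - 1) - p j) := by
    by_cases h0 : j = 0
    · subst h0
      refine ⟨1 - r, hr1, ?_⟩
      have := edgePt_sub_right p (0 - 1) r
      rw [sub_add_cancel] at this
      rw [← last_add_one, add_sub_cancel_right, insertLast_last, this]
    · have hj : 0 < (j : ℕ) := Nat.pos_of_ne_zero fun e => h0 (Fin.ext e)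
      have := val_sub_one hj
      refine ⟨1, one_pos, ?_⟩
      have e : j.castSucc = (j - 1).castSucc + 1 := by
        rw [castSucc_add_one (by omega), sub_add_cancel]
      rw [e, add_sub_cancel_right, insertLast_castSucc, one_smul]
  have hR : ∃ a > (0 : ℝ), insertLast r p (j.castSucc + 1) - p j = a • (p (j + 1) - p j) := by
    by_cases hj : (j : ℕ) + 1 < n
    · exact ⟨1, one_pos, by rw [castSucc_add_one hj, insertLast_castSucc, one_smul]⟩
    · obtain rfl := eq_zero_sub_one hj
      exact ⟨r, hr0, by rw [castSucc_zero_sub_one_add_one, insertLast_last, edgePt_sub_left]⟩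
  obtain ⟨a, ha, ea⟩ := hL
  obtain ⟨b, hb, eb⟩ := hR
  rw [jointAngle, jointAngle, EuclideanGeometry.angle, EuclideanGeometry.angle, insertLast_castSucc]
  simp only [vsub_eq_sub]
  rw [ea, eb, InnerProductGeometry.angle_smul_left_of_pos _ _ ha, InnerProductGeometry.angle_smul_right_of_pos _ _ hb]

theorem dist_insertLast {r : ℝ} (hlen : ∀ j, dist (p j) (p (j + 1)) = dist (q j) (q (j + 1))) (j : Fin (n + 1)) :
    dist (insertLast r p j) (insertLast r p (j + 1)) = dist (insertLast r q j) (insertLast r q (j + 1)) := by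
  have hl := hlen (0 - 1)
  refine Fin.lastCases ?_ (fun i => ?_) j
  · simp only [last_add_one, insertLast_castSucc, insertLast_last]
    rw [sub_add_cancel] at hl
    have e : ∀ x : Conf n, dist (edgePt x (0 - 1) r) (x 0) = ‖1 - r‖ * dist (x (0 - 1)) (x 0) := fun x => by
      have := edgePt_sub_right x (0 - 1) r
      rw [sub_add_cancel] at this
      rw [dist_eq_norm, this, norm_smul, dist_eq_norm]
    rw [e, e, hl]
  · by_cases hi : (i : ℕ) + 1 < n
    · simp only [castSucc_add_one hi, insertLast_castSucc]; exact hlen i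
    · obtain rfl := eq_zero_sub_one hi
      simp only [castSucc_zero_sub_one_add_one, insertLast_castSucc, insertLast_last]
      have e : ∀ x : Conf n, dist (x (0 - 1)) (edgePt x (0 - 1) r) = ‖r‖ * dist (x (0 - 1)) (x (0 - 1 + 1)) := fun x => by
        rw [dist_comm, dist_eq_norm, edgePt_sub_left, norm_smul, ← dist_eq_norm, dist_comm]
      rw [e, e, hl]

/-- Each edge of the longer chain lies on an edge of the old one, whose normal still serves; the new
vertex is a convex combination of two old ones. -/
theorem IsConvexPolygon.insertLast (h : IsConvexPolygon p) {r : ℝ} (hr : r ∈ Ioo (0 : ℝ) 1) :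
    IsConvexPolygon (insertLast r p) := by
  have hr1 : 0 < 1 - r := by linarith [hr.2]
  have hr0 := hr.1
  refine ⟨h.1.insertLast hr, ?_, fun j => ?_⟩
  · have hX : edgePt p (0 - 1) r ∈ affineSpan ℝ (range p) :=
      AffineMap.lineMap_mem _ (subset_affineSpan _ _ (mem_range_self _)) (subset_affineSpan _ _ (mem_range_self _))
    refine ((coplanar_insert_iff_of_mem_affineSpan hX).2 h.2.1).subset ?_
    rintro _ ⟨j, rfl⟩
    refine Fin.lastCases ?_ (fun i => ?_) j
    · rw [insertLast_last]; exact mem_insert _ _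
    · rw [insertLast_castSucc]; exact mem_insert_of_mem _ (mem_range_self i)
  · have hI : (0 : ℝ) ∈ Ico (0 : ℝ) 1 := ⟨le_rfl, one_pos⟩
    obtain ⟨i, a, e0, b, e1⟩ : ∃ i : Fin n, ∃ a : ℝ, Arch.insertLast r p j = edgePt p i a ∧
        ∃ b : ℝ, Arch.insertLast r p (j + 1) = edgePt p i b := by
      refine Fin.lastCases ?_ (fun i => ?_) j
      · refine ⟨0 - 1, r, insertLast_last r p, 1, ?_⟩
        rw [last_add_one, insertLast_castSucc, edgePt_one, sub_add_cancel]
      · by_cases hi : (i : ℕ) + 1 < n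
        · exact ⟨i, 0, by rw [insertLast_castSucc, edgePt_zero], 1,
            by rw [castSucc_add_one hi, insertLast_castSucc, edgePt_one]⟩
        · obtain rfl := eq_zero_sub_one hi
          exact ⟨0 - 1, 0, by rw [insertLast_castSucc, edgePt_zero], r,
            by rw [castSucc_zero_sub_one_add_one, insertLast_last]⟩
    obtain ⟨u, h1, h2, k, h3⟩ := h.2.2 i
    have hline : ∀ a, inner ℝ u (edgePt p i a - p i) = 0 := fun a => by
      rw [edgePt_sub_left, inner_smul_right, h1, mul_zero]
    have hx : ∀ x, inner ℝ u (x - Arch.insertLast r p j) = inner ℝ u (x - p i) := fun x => by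
      rw [← sub_sub_sub_cancel_right x _ (p i), inner_sub_right, e0, hline, sub_zero]
    refine ⟨u, ?_, fun l => ?_, k.castSucc, ?_⟩
    · rw [hx, e1, hline]
    · rw [hx]
      refine Fin.lastCases ?_ (fun l => ?_) l
      · have e : edgePt p (0 - 1) r - p i = (1 - r) • (p (0 - 1) - p i) + r • (p 0 - p i) := by
          simp only [edgePt, AffineMap.lineMap_apply, vsub_eq_sub, vadd_eq_add, sub_add_cancel]; module
        rw [insertLast_last, e, inner_add_right, inner_smul_right, inner_smul_right]
        have := h2 (0 - 1)
        have := h2 0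
        positivity
      · rw [insertLast_castSucc]; exact h2 l
    · rw [hx, insertLast_castSucc]; exact h3

theorem Convexifiable.insertLast (h : Convexifiable p) {r : ℝ} (hr : r ∈ Ioo (0 : ℝ) 1) :
    Convexifiable (insertLast r p) := by
  obtain ⟨γ, q, ⟨hc, h0, h1, hm⟩, hq, hs⟩ := h
  have hn := hq.1.1
  refine ⟨fun t => Arch.insertLast r (γ t), Arch.insertLast r q, ⟨?_, ?_, ?_, fun t ht => ⟨?_, ?_⟩⟩,
    hq.insertLast hr, fun j => ?_⟩
  · have hcj := continuousOn_pi.1 hc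
    refine continuousOn_pi.2 fun j => ?_
    refine Fin.lastCases ?_ (fun i => ?_) j
    · simp only [insertLast_last, edgePt, AffineMap.lineMap_apply, vsub_eq_sub, vadd_eq_add]
      exact (((hcj _).sub (hcj _)).const_smul r).add (hcj _)
    · simp only [insertLast_castSucc]; exact hcj i
  · simp only [h0]
  · simp only [h1]
  · exact (hm t ht).1.insertLast hr
  · exact dist_insertLast (hm t ht).2
  · refine Fin.lastCases ?_ (fun i => ?_) j
    · exact fun _ t ht => isStraight_insertLast_last (hm t ht).1.2.1 hr
    · intro hj t ht
      rw [IsStraight, jointAngle_insertLast hr] at hj ⊢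
      exact hs i hj t ht

theorem eq_insertLast {p : Conf (n + 1)} (h : IsStraight p (Fin.last n)) :
    ∃ r ∈ Ioo (0 : ℝ) 1, p = Arch.insertLast r fun j : Fin n => p j.castSucc := by
  rw [isStraight_iff] at h
  obtain ⟨-, ρ, hρ, e⟩ := h
  rw [last_add_one, ← castSucc_zero_sub_one_add_one, add_sub_cancel_right, castSucc_zero_sub_one_add_one] at e
  have h1 : 0 < 1 - ρ := by linarith
  -- The vector from the preceding to the following vertex is `1 - ρ` times the vector from the
  -- preceding vertex to the straight one, and `ρ < 0`.
  refine ⟨(1 - ρ)⁻¹, ⟨by positivity, inv_lt_one_of_one_lt₀ (by linarith)⟩, ?_⟩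
  funext j
  refine Fin.lastCases ?_ (fun i => ?_) j
  · rw [insertLast_last, edgePt, sub_add_cancel, AffineMap.lineMap_apply, vsub_eq_sub, vadd_eq_add]
    have e2 : p (0 : Fin n).castSucc - p (0 - 1 : Fin n).castSucc =
        (1 - ρ) • (p (Fin.last n) - p (0 - 1 : Fin n).castSucc) := by
      rw [sub_eq_iff_eq_add.1 e]; module
    rw [e2, smul_smul, inv_mul_cancel₀ h1.ne', one_smul, sub_add_cancel]
  · rw [insertLast_castSucc]

end

end Arch
end

noncomputable section

namespace Arch

open Set Filter Topology

/-! ### Convexifying planar polygons -/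

section

variable {n : ℕ} [NeZero n] {p : Conf n}

/-- A straight joint of a triangle would lie on the opposite edge. -/
theorem not_isStraight_of_triangle (h : IsSimplePolygon p) (hn : n = 3) (j : Fin n) : ¬ IsStraight p j := by
  rw [isStraight_iff]
  rintro ⟨-, r, hr, e⟩
  have e3 : j + 1 + 1 = j - 1 := by
    rw [eq_sub_iff_add_eq]
    have a1 := val_add_one j
    have a2 := val_add_one (j + 1)
    have a3 := val_add_one (j + 1 + 1)
    refine Fin.ext ?_
    split_ifs at a1 a2 a3 <;> omega
  refine h.notMem_edge (j := j) (k := j + 1) (add_one_ne (by omega) j) (add_two_ne (by omega) j) ?_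
  have h1 : 0 < 1 - r := by linarith
  refine mem_edge.2 ⟨-r / (1 - r), ⟨div_nonneg (by linarith) h1.le, (div_le_one h1).2 (by linarith)⟩, ?_⟩
  have e5 : p (j - 1) - p (j + 1) = (1 - r) • (p (j - 1) - p j) := by
    rw [sub_eq_iff_eq_add.1 e]; module
  rw [edgePt, e3, AffineMap.lineMap_apply, vsub_eq_sub, vadd_eq_add, e5, smul_smul, div_mul_cancel₀ _ h1.ne',
    sub_eq_iff_eq_add.1 e]
  module

/-- The required normal of an edge is the component, perpendicular to it, of another side. It
vanishes only for collinear vertices, one of which would then lie on the opposite edge. -/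
theorem IsSimplePolygon.isConvexPolygon_of_triangle (h : IsSimplePolygon p) (hc : Coplanar ℝ (range p)) (hn : n = 3) :
    IsConvexPolygon p := by
  refine ⟨h, hc, fun i => ?_⟩
  have cases3 : ∀ j : Fin n, j = i ∨ j = i + 1 ∨ j = i + 1 + 1 := by
    intro j
    have a1 := val_add_one i
    have a2 := val_add_one (i + 1)
    simp only [Fin.ext_iff]
    split_ifs at a1 a2 <;> omega
  have e3 : i + 1 + 1 + 1 = i := by
    have a1 := val_add_one i
    have a2 := val_add_one (i + 1)
    have a3 := val_add_one (i + 1 + 1)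
    refine Fin.ext ?_
    split_ifs at a1 a2 a3 <;> omega
  set e := p (i + 1) - p i with he
  set d := p (i + 1 + 1) - p i with hd
  have he0 : e ≠ 0 := sub_ne_zero.2 (h.2.1 i).symm
  have hee : inner ℝ e e ≠ (0 : ℝ) := inner_self_ne_zero.2 he0
  set r : ℝ := inner ℝ e d / inner ℝ e e with hr
  have hu : inner ℝ (d - r • e) e = 0 := by
    rw [inner_sub_left, real_inner_smul_left, hr, div_mul_cancel₀ _ hee, real_inner_comm, sub_self]
  have hud : inner ℝ (d - r • e) d = ‖d - r • e‖ ^ 2 := by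
    rw [← real_inner_self_eq_norm_sq]
    conv_rhs => rw [inner_sub_right, real_inner_smul_right, hu, mul_zero, sub_zero]
  have hne : d - r • e ≠ 0 := by
    intro h0
    have hd' : d = r • e := sub_eq_zero.1 h0
    have n1 := add_one_ne (n := n) (by omega) i
    have n2 := add_one_ne (n := n) (by omega) (i + 1)
    have n3 := add_two_ne (n := n) (by omega) i
    -- The middle one of the three collinear points is `p i` for `r < 0`, the third vertex for `0 ≤
    -- r ≤ 1`, and `p (i + 1)` for `r > 1`.
    rcases lt_or_ge r 0 with hr0 | hr0
    · have h1 : 0 < 1 - r := by linarith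
      refine h.notMem_edge (j := i) (k := i + 1) n1 n3 (mem_edge.2 ⟨(1 - r)⁻¹, ⟨by positivity, inv_le_one_of_one_le₀ (by linarith)⟩, ?_⟩)
      have : p i - p (i + 1) = (1 - r)⁻¹ • (p (i + 1 + 1) - p (i + 1)) := by
        rw [eq_inv_smul_iff₀ h1.ne', show p (i + 1 + 1) = p i + r • e by rw [← hd', hd]; abel,
          show p (i + 1) = p i + e by rw [he]; abel]
        module
      rw [edgePt, AffineMap.lineMap_apply, vsub_eq_sub, vadd_eq_add, ← this, sub_add_cancel]
    rcases le_or_gt r 1 with hr1 | hr1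
    · refine h.notMem_edge (j := i + 1 + 1) (k := i) n3.symm n2.symm (mem_edge.2 ⟨r, ⟨hr0, hr1⟩, ?_⟩)
      rw [edgePt, AffineMap.lineMap_apply, vsub_eq_sub, vadd_eq_add, ← he, ← hd', hd, sub_add_cancel]
    · have hr2 : 0 < r := by linarith
      refine h.notMem_edge (j := i + 1) (k := i + 1 + 1) n2 (by rw [e3]; exact n1.symm)
        (mem_edge.2 ⟨1 - r⁻¹, ⟨by linarith [inv_le_one_of_one_le₀ hr1.le], by linarith [inv_pos.2 hr2]⟩, ?_⟩)
      have h5 : p (i + 1) = p i + r⁻¹ • d := by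
        rw [hd', smul_smul, inv_mul_cancel₀ hr2.ne', one_smul, he]; abel
      rw [edgePt, e3, AffineMap.lineMap_apply, vsub_eq_sub, vadd_eq_add, h5,
        show p (i + 1 + 1) = p i + d by rw [hd]; abel]
      module
  have hpos : 0 < inner ℝ (d - r • e) d := by
    rw [hud]; exact pow_pos (norm_pos_iff.2 hne) 2
  refine ⟨d - r • e, hu, fun j => ?_, i + 1 + 1, hpos⟩
  rcases cases3 j with rfl | rfl | rfl
  · rw [sub_self, inner_zero_right]
  · exact hu.ge
  · exact hpos.le

/-- A unit normal of the plane becomes the last vector of an orthonormal basis, with `p 0` as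
origin. -/
theorem exists_isometry (hc : Coplanar ℝ (range p)) :
    ∃ Φ : E3 ≃ᵃⁱ[ℝ] E3, ∀ j, height (Φ (p j)) = 0 := by
  set W := vectorSpan ℝ (range p) with hW
  have hW2 : Module.finrank ℝ W ≤ 2 := coplanar_iff_finrank_le_two.1 hc
  have h3 : Module.finrank ℝ E3 = 3 := by simp
  have hsum := W.finrank_add_finrank_orthogonal
  have hne : Wᗮ ≠ ⊥ := by
    intro h0
    rw [h0, finrank_bot] at hsum
    omega
  obtain ⟨x, hx, hx0⟩ := Submodule.exists_mem_ne_zero_of_ne_bot hne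
  set ν : E3 := ‖x‖⁻¹ • x with hν
  have hν1 : ‖ν‖ = 1 := by
    rw [hν, norm_smul, norm_inv, norm_norm, inv_mul_cancel₀ (norm_ne_zero_iff.2 hx0)]
  have hon : Orthonormal ℝ (({2} : Set (Fin 3)).domRestrict fun _ => ν) := by
    refine ⟨fun _ => hν1, fun i j hij => absurd (Subsingleton.elim i j) hij⟩
  obtain ⟨b, hb⟩ := hon.exists_orthonormalBasis_extension_of_card_eq (by simp)
  have hb2 : b 2 = ν := hb 2 rfl
  refine ⟨(AffineIsometryEquiv.vaddConst ℝ (p 0)).symm.trans b.repr.toAffineIsometryEquiv, fun j => ?_⟩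
  change b.repr (p j -ᵥ p 0) 2 = 0
  rw [b.repr_apply_apply, hb2, hν, real_inner_smul_left, real_inner_comm,
    hx _ (vsub_mem_vectorSpan ℝ (mem_range_self j) (mem_range_self 0)), mul_zero]

theorem convexifiable_of_not_isStraight (h : IsSimplePolygon p) (hc : Coplanar ℝ (range p))
    (hs : ∀ j, ¬ IsStraight p j) : Convexifiable p := by
  by_cases hn : n = 3
  · exact (h.isConvexPolygon_of_triangle hc hn).convexifiable
  have hn4 : 4 ≤ n := by have := h.1; omega
  obtain ⟨Φ, hΦ⟩ := exists_isometry hc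
  refine Convexifiable.of_isometry (Φ := Φ) ?_
  have hs' : ∀ j, ¬ IsStraight (fun j => Φ (p j)) j := fun j hj => hs j ((isStraight_isometry Φ).1 hj)
  obtain ⟨δ, hδ⟩ := exists_deltaOK (h.isometry Φ) hΦ hs'
  have hδ0 := hδ.1
  obtain ⟨q, hq⟩ := exists_run hδ hΦ hn4 (ε := δ / 1000) (by positivity) (by linarith)
  obtain ⟨γ, hγ⟩ := hq.movable hn4
  obtain ⟨_, _, _, _, hconv, _⟩ := hq
  exact ⟨γ, q, hγ, hconv, fun j hj => absurd hj (hs' j)⟩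

end

/-- A straight vertex is made the last one by a cyclic shift and removed. The shorter polygon is
convexified by induction, and the vertex is carried along on its edge, where it remains straight. -/
theorem convexifiable_succ (m : ℕ) {p : Conf (m + 1)} (h : IsSimplePolygon p)
    (hc : Coplanar ℝ (range p)) : Convexifiable p := by
  induction m with
  | zero => exact absurd h.1 (by norm_num)
  | succ m ih =>
    by_cases hs : ∀ j, ¬ IsStraight p j
    · exact convexifiable_of_not_isStraight h hc hs
    push Not at hs
    obtain ⟨j, hj⟩ := hs
    refine Convexifiable.of_shift (s := j - Fin.last (m + 1)) ?_
    have hj' : IsStraight (fun k => p (k + (j - Fin.last (m + 1)))) (Fin.last (m + 1)) := by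
      rw [isStraight_shift, add_sub_cancel]; exact hj
    have h' := h.shift (j - Fin.last (m + 1))
    have hc' : Coplanar ℝ (range fun k => p (k + (j - Fin.last (m + 1)))) := by rwa [range_shift]
    obtain ⟨r, hr, e⟩ := eq_insertLast hj'
    have hn : m + 1 ≠ 2 := fun hm => not_isStraight_of_triangle h (by omega) j hj
    have := h.1
    rw [e] at h' ⊢
    refine (ih (h'.of_insertLast (by omega) hr) (hc'.subset ?_)).insertLast hr
    rintro _ ⟨k, rfl⟩
    exact mem_range_self k.castSucc

theorem IsSimplePolygon.convexifiable {n : ℕ} [NeZero n] {p : Conf n} (h : IsSimplePolygon p)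
    (hc : Coplanar ℝ (range p)) : Convexifiable p := by
  obtain ⟨m, rfl⟩ : ∃ m, n = m + 1 := ⟨n - 1, by have := h.1; omega⟩
  exact convexifiable_succ m h hc

end Arch
end

/-! ### The theorem -/

theorem theorem2 :
    (∀ (n : ℕ) [NeZero n] (p : Arch.Conf n),
      Arch.IsSimplePolygon p → Coplanar ℝ (Set.range p) →
      ∃ (γ : ℝ → Arch.Conf n) (q : Arch.Conf n),
        Arch.IsMotion γ p q ∧ Arch.IsConvexPolygon q ∧
        ∀ j, Arch.IsStraight p j → ∀ t ∈ Set.Icc (0 : ℝ) 1, Arch.IsStraight (γ t) j) ∧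
    (∃ epsMax : ℝ → ℝ → ℝ → ℝ,
      (∀ δ σ β : ℝ, 0 < δ → 0 < σ → 0 < β → 0 < epsMax δ σ β) ∧
      ∀ (n : ℕ) [NeZero n] (p : Arch.Conf n),
        4 ≤ n → Arch.IsSimplePolygon p → (∀ j, Arch.height (p j) = 0) →
        (∀ j, ¬ Arch.IsStraight p j) →
        (∃ δ, Arch.DeltaOK p δ) ∧
        ∀ δ, Arch.DeltaOK p δ →
          0 < Arch.sigma p δ ∧ 0 < Arch.beta p δ ∧
          ∀ ε, 0 < ε → ε ≤ epsMax δ (Arch.sigma p δ) (Arch.beta p δ) →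
            ∃ q, Arch.Run ε δ p q) := by
  -- The bound `δ / 1000` comes from the lifts: they require `500 * ε` to be at most the lower bound
  -- `δ / 2` for the altitudes.
  refine ⟨fun n _ p h hc => h.convexifiable hc, fun δ _ _ => δ / 1000, fun δ _ _ hδ _ _ => by positivity,
    fun n _ p hn h h0 hs => ⟨Arch.exists_deltaOK h h0 hs, fun δ hδ => ⟨hδ.sigma_pos h0 (by omega), hδ.beta_pos h0,
      fun ε hε hεδ => Arch.exists_run hδ h0 hn hε (by linarith)⟩⟩⟩
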